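/- **Setting.** Let $\mathcal X$ be a set, $d,N,\tau$ integers with $2\le\tau\le N$, $\varepsilon>0$, $0<\delta<1$ with $\varepsilon<2\sqrt{\log(2/\delta)}$, $T$ a real number, and let $\ell:\mathcal X\times\mathbb R^d\to\mathbb R$ and $r:\mathbb R^d\to\mathbb R$ be differentiable in $\theta\in\mathbb R^d$. A randomized algorithm $\mathcal A$ on $\mathcal X^N$ is $(\varepsilon,\delta)$-differentially private if $\mathbb P(\mathcal A(X)\in S)\le e^{\varepsilon}\,\mathbb P(\mathcal A(Y)\in S)+\delta$ for all measurable $S$ and all $X,Y\in\mathcal X^N$ that differ in at most one entry. **Algorithm (DP-SGFS).** Public inputs: $\ell$, $r$, a matrix $F\in\mathbb R^{d\times d}$ with spectral norm $\|F\|$, $\tau,T,\varepsilon,\delta$, stepsizes $\eta_t>0$, weights $\kappa_t\in\mathbb R$, an initial $\theta_1\in\mathbb R^d$ and an initial matrix $\hat I_0\in\mathbb R^{d\times d}$. Put $$\sigma^2=\frac{32\,T\log\!\big(\tfrac{2.5NT}{\tau\delta}\big)\log(2/\delta)}{N\tau\varepsilon^2}.$$ Given data $X=(x_1,\dots,x_N)$,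 for $t=1,\dots,\lfloor NT/\tau\rfloor$ do the following, with all random draws independent: 1. Draw $S\subset\{1,\dots,N\}$ uniformly among the subsets of size $\tau$, and put $\bar g=\frac1\tau\sum_{i\in S}\nabla\ell(x_i;\theta_t)$. 2. Draw $Z_t\sim\mathcal N\big(0,\max(\sigma^2,\tfrac1{N^2\eta_t})I_d\big)$ and $W\in\mathbb R^{d\times d}$ with i.i.d. entries $W_{ij}\sim\mathcal N(0,49\|F\|^4\sigma^2)$. 3. Put $\tilde g_t=\bar g+FZ_t$ and $V_t=\mathcal P\Big(\frac1{\tau-1}\sum_{i\in S}(\nabla\ell(x_i;\theta_t)-\bar g)(\nabla\ell(x_i;\theta_t)-\bar g)^{T}+W\Big)$, where $\mathcal P$ is the projection in Frobenius norm onto the symmetric positive semidefinite matrices. 4. Put $\hat I_t=(1-\kappa_t)\hat I_{t-1}+\kappa_tV_t$. 5. Put $\theta_{t+1}=\theta_t+2\Big(\frac{(\tau+N)N}{\tau}\hat I_t+\frac{4FF^T}{\eta_t}\Big)^{-1}\big(\nabla r(\theta_t)+N\tilde g_t\big)$ (the inverse of a singular matrix is read as $0$). 6. Release $(\tilde g_t,V_t,\theta_{t+1})$.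 The output is the whole sequence $(\tilde g_t,V_t,\theta_{t+1})_{1\le t\le\lfloor NT/\tau\rfloor}$. **Theorem.** Assume that $F$ satisfies $$\ell(x;\theta')\le\ell(x;\theta)+\nabla\ell(x;\theta)^{T}(\theta'-\theta)+\tfrac12\|F(\theta'-\theta)\|^2\qquad\text{for all }x\in\mathcal X,\ \theta,\theta'\in\mathbb R^d,$$ and that for every $\theta\in\mathbb R^d$ and every $(x_1,\dots,x_N)\in\mathcal X^N$ the ellipsoid $F B^d=\{Fu:\|u\|\le1\}$ contains the symmetric polytope $\mathrm{conv}\{\pm\nabla\ell(x_1;\theta),\dots,\pm\nabla\ell(x_N;\theta)\}$. If $$T\ge\frac{\varepsilon^2N}{32\,\tau\log(2/\delta)},$$ then DP-SGFS is $(2\varepsilon,2\delta)$-differentially private. -/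

import Mathlib

open MeasureTheory ProbabilityTheory
open scoped Matrix Gradient

noncomputable section

/-! ### Differential privacy -/

open Classical in
/-- A randomized algorithm on data sets of size `n`, given by the law `M X` of its output on the
data set `X`, is `(ε, δ)`-differentially private (data sets are neighbours when they differ in at
most one entry). -/
def IsDifferentiallyPrivate {𝒳 Out : Type*} [MeasurableSpace Out] {n : ℕ}
    (M : (Fin n → 𝒳) → Measure Out) (ε δ : ℝ) : Prop :=
  ∀ X Y : Fin n → 𝒳, hammingDist X Y ≤ 1 → ∀ S : Set Out, MeasurableSet S →
    M X S ≤ ENNReal.ofReal (Real.exp ε) * M Y S + ENNReal.ofReal δ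

/-! ### Matrices -/

/-- The Borel (product) σ-algebra on real matrices. -/
instance matrixMeasurableSpace {m n : Type*} : MeasurableSpace (Matrix m n ℝ) :=
  inferInstanceAs (MeasurableSpace (m → n → ℝ))

instance matrixBorelSpace {d : ℕ} : BorelSpace (Matrix (Fin d) (Fin d) ℝ) :=
  inferInstanceAs (BorelSpace (Fin d → Fin d → ℝ))

/-- The squared Frobenius distance of two matrices. -/
def frobDistSq {d : ℕ} (A B : Matrix (Fin d) (Fin d) ℝ) : ℝ :=
  ∑ i, ∑ j, (A i j - B i j) ^ 2

/-- `P` is a point of the cone of symmetric positive semidefinite matrices that is closest to `A`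
in the Frobenius norm. -/
def IsNearestPSD {d : ℕ} (A P : Matrix (Fin d) (Fin d) ℝ) : Prop :=
  P.PosSemidef ∧ ∀ Q : Matrix (Fin d) (Fin d) ℝ, Q.PosSemidef → frobDistSq A P ≤ frobDistSq A Q

/-- A matrix as a vector of the Euclidean space whose norm is the Frobenius norm. -/
def matVec {d : ℕ} (A : Matrix (Fin d) (Fin d) ℝ) : EuclideanSpace ℝ (Fin d × Fin d) :=
  WithLp.toLp 2 fun p => A p.1 p.2

theorem norm_matVec_sub_sq {d : ℕ} (A B : Matrix (Fin d) (Fin d) ℝ) :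
    ‖matVec A - matVec B‖ ^ 2 = frobDistSq A B := by
  simp [EuclideanSpace.norm_sq_eq, matVec, frobDistSq, Fintype.sum_prod_type]

/-- The cone of positive semidefinite matrices, as a subset of the Euclidean space. -/
def psdVecs (d : ℕ) : Set (EuclideanSpace ℝ (Fin d × Fin d)) :=
  {v | (Matrix.of fun i j => v (i, j)).PosSemidef}

theorem matVec_mem_psdVecs {d : ℕ} {A : Matrix (Fin d) (Fin d) ℝ} :
    matVec A ∈ psdVecs d ↔ A.PosSemidef := Iff.rfl

theorem convex_psdVecs (d : ℕ) : Convex ℝ (psdVecs d) := by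
  intro v hv w hw a b ha hb _
  exact (Matrix.PosSemidef.smul hv ha).add (Matrix.PosSemidef.smul hw hb)

theorem isClosed_psdVecs (d : ℕ) : IsClosed (psdVecs d) := by
  have h : psdVecs d = (⋂ i, ⋂ j, {v | v (j, i) = v (i, j)}) ∩
      ⋂ x : Fin d → ℝ, {v | 0 ≤ ∑ i, x i * ∑ j, v (i, j) * x j} := by
    ext v
    simp [psdVecs, Matrix.posSemidef_iff_dotProduct_mulVec, Matrix.IsHermitian, ← Matrix.ext_iff,
      dotProduct, Matrix.mulVec]
  rw [h]
  refine IsClosed.inter ?_ ?_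
  · exact isClosed_iInter fun i => isClosed_iInter fun j =>
      isClosed_eq (by fun_prop) (by fun_prop)
  · exact isClosed_iInter fun x => isClosed_le (by fun_prop) (by fun_prop)

theorem exists_isNearestPSD {d : ℕ} (A : Matrix (Fin d) (Fin d) ℝ) :
    ∃ P, IsNearestPSD A P := by
  have hne : (psdVecs d).Nonempty := ⟨matVec 0, Matrix.PosSemidef.zero⟩
  obtain ⟨v, hv, h⟩ :=
    (isClosed_psdVecs d).exists_infDist_eq_dist hne (matVec A)
  refine ⟨Matrix.of fun i j => v (i, j), hv, fun Q hQ => ?_⟩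
  rw [← norm_matVec_sub_sq, ← norm_matVec_sub_sq]
  have h1 := Metric.infDist_le_dist_of_mem (x := matVec A) (matVec_mem_psdVecs.2 hQ)
  rw [h, dist_eq_norm, dist_eq_norm] at h1
  exact pow_le_pow_left₀ (norm_nonneg _) h1 2

/-- The metric projection `𝒫` onto the cone of symmetric positive semidefinite matrices. -/
def psdProj {d : ℕ} (A : Matrix (Fin d) (Fin d) ℝ) : Matrix (Fin d) (Fin d) ℝ :=
  Classical.choose (exists_isNearestPSD A)

theorem psdProj_spec {d : ℕ} (A : Matrix (Fin d) (Fin d) ℝ) : IsNearestPSD A (psdProj A) :=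
  Classical.choose_spec (exists_isNearestPSD A)

theorem inner_sub_psdProj_nonpos {d : ℕ} (A : Matrix (Fin d) (Fin d) ℝ)
    {w : EuclideanSpace ℝ (Fin d × Fin d)} (hw : w ∈ psdVecs d) :
    inner ℝ (matVec A - matVec (psdProj A)) (w - matVec (psdProj A)) ≤ 0 := by
  have hP := psdProj_spec A
  have hmem : matVec (psdProj A) ∈ psdVecs d := hP.1
  refine (norm_eq_iInf_iff_real_inner_le_zero (convex_psdVecs d) hmem).1 ?_ w hw
  have : Nonempty (psdVecs d) := ⟨⟨_, hmem⟩⟩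
  refine le_antisymm (le_ciInf fun v => ?_)
    (ciInf_le (f := fun v : psdVecs d => ‖matVec A - v‖) ⟨0, by rintro _ ⟨v, rfl⟩; positivity⟩ ⟨_, hmem⟩)
  have h := hP.2 (Matrix.of fun i j => v.1 (i, j)) v.2
  rw [← norm_matVec_sub_sq, ← norm_matVec_sub_sq] at h
  exact le_of_sq_le_sq h (norm_nonneg _)

/-- The projection is nonexpansive in the Frobenius norm. -/
theorem norm_psdProj_sub_le {d : ℕ} (A B : Matrix (Fin d) (Fin d) ℝ) :
    ‖matVec (psdProj A) - matVec (psdProj B)‖ ≤ ‖matVec A - matVec B‖ := by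
  have h1 := inner_sub_psdProj_nonpos A (matVec_mem_psdVecs.2 (psdProj_spec B).1)
  have h2 := inner_sub_psdProj_nonpos B (matVec_mem_psdVecs.2 (psdProj_spec A).1)
  set a := matVec A
  set b := matVec B
  set p := matVec (psdProj A)
  set q := matVec (psdProj B)
  have h3 : ‖p - q‖ * ‖p - q‖ ≤ inner ℝ (a - b) (p - q) := by
    rw [← real_inner_self_eq_norm_mul_norm]
    simp only [inner_sub_left, inner_sub_right] at h1 h2 ⊢
    linarith
  have h4 := h3.trans (real_inner_le_norm _ _)
  rcases (norm_nonneg (p - q)).eq_or_lt with h | h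
  · rw [← h]; positivity
  · exact le_of_mul_le_mul_right h4 h

theorem continuous_psdProj {d : ℕ} : Continuous (psdProj (d := d)) := by
  have hv : Continuous (matVec (d := d)) := by unfold matVec; fun_prop
  have h : Continuous fun A : Matrix (Fin d) (Fin d) ℝ => matVec (psdProj A) := by
    rw [continuous_iff_continuousAt]
    intro A
    have h0 : Filter.Tendsto (fun B => ‖matVec B - matVec A‖) (nhds A) (nhds 0) :=
      tendsto_iff_norm_sub_tendsto_zero.1 hv.continuousAt
    exact tendsto_iff_norm_sub_tendsto_zero.2
      (squeeze_zero (fun _ => norm_nonneg _) (fun B => norm_psdProj_sub_le B A) h0)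
  refine continuous_matrix fun i j => ?_
  have := (EuclideanSpace.proj (𝕜 := ℝ) (i, j)).continuous.comp h
  exact this

theorem measurable_matrixInv {d : ℕ} :
    Measurable fun A : Matrix (Fin d) (Fin d) ℝ => A⁻¹ := by
  have hd : Continuous fun A : Matrix (Fin d) (Fin d) ℝ => A.det := continuous_id.matrix_det
  have ha : Continuous fun A : Matrix (Fin d) (Fin d) ℝ => A.adjugate :=
    continuous_id.matrix_adjugate
  simp only [Matrix.inv_def, Ring.inverse_eq_inv']
  refine measurable_pi_lambda _ fun i => measurable_pi_lambda _ fun j => ?_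
  exact hd.measurable.inv.mul (ha.matrix_elem i j).measurable

theorem measurable_grad {d : ℕ} (f : EuclideanSpace ℝ (Fin d) → ℝ) : Measurable (∇ f) :=
  (InnerProductSpace.toDual ℝ (EuclideanSpace ℝ (Fin d))).symm.continuous.measurable.comp
    (measurable_fderiv ℝ f)

theorem measurable_apply_finset {N : ℕ} {α E G : Type*} [MeasurableSpace α] [MeasurableSpace E]
    [MeasurableSpace G] {f : Finset (Fin N) → E → G} (hf : ∀ S, Measurable (f S))
    {S : α → Finset (Fin N)} {θ : α → E} (hS : Measurable S) (hθ : Measurable θ) :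
    Measurable fun a => f (S a) (θ a) := by
  have h : Measurable fun q : Finset (Fin N) × E => f q.1 q.2 :=
    measurable_from_prod_countable_right hf
  exact h.comp (hS.prodMk hθ)

/-! ### The algorithm -/

/-- The public inputs of the algorithm: everything except the data. -/
structure SGFSInput (𝒳 : Type*) (d : ℕ) where
  /-- the loss `ℓ(x; θ)` -/
  loss : 𝒳 → EuclideanSpace ℝ (Fin d) → ℝ
  /-- the regularizer -/
  reg : EuclideanSpace ℝ (Fin d) → ℝ
  /-- the public Lipschitz matrix -/
  F : Matrix (Fin d) (Fin d) ℝ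
  /-- the size of the minibatches -/
  τ : ℕ
  /-- the number of data passes -/
  T : ℝ
  ε : ℝ
  δ : ℝ
  /-- the stepsizes -/
  η : ℕ → ℝ
  /-- the weights of the running average of the Fisher information estimates -/
  κ : ℕ → ℝ
  /-- the initial parameter -/
  θ₁ : EuclideanSpace ℝ (Fin d)
  /-- the initial guess of the Fisher information -/
  I₀ : Matrix (Fin d) (Fin d) ℝ

/-- The random draws of one iteration: the minibatch `S`, the vector `Z` and the matrix `W`. -/
abbrev SGFSNoise (N d : ℕ) : Type := Finset (Fin N) × (Fin d → ℝ) × (Fin d → Fin d → ℝ)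

/-- The internal state: the current parameter `θ_t` and the estimate `Î_{t-1}`. -/
abbrev SGFSState (d : ℕ) : Type := EuclideanSpace ℝ (Fin d) × Matrix (Fin d) (Fin d) ℝ

/-- What one iteration releases: `(g̃_t, V_t, θ_{t+1})`. -/
abbrev SGFSRelease (d : ℕ) : Type :=
  EuclideanSpace ℝ (Fin d) × Matrix (Fin d) (Fin d) ℝ × EuclideanSpace ℝ (Fin d)

namespace SGFSInput

variable {𝒳 : Type*} {d : ℕ} (P : SGFSInput 𝒳 d)

/-- The number `⌊NT/τ⌋` of iterations on a data set of size `N`. -/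
def steps (N : ℕ) : ℕ := ⌊N * P.T / P.τ⌋₊

/-- The noise level `σ²`. -/
def sigmaSq (N : ℕ) : ℝ :=
  32 * P.T * Real.log (2.5 * N * P.T / (P.τ * P.δ)) * Real.log (2 / P.δ) / (N * P.τ * P.ε ^ 2)

/-- The spectral norm of `F`. -/
def normF : ℝ := ‖Matrix.toEuclideanCLM (𝕜 := ℝ) P.F‖

/-- The law of the random draws `(S, Z_t, W)` of iteration `t`: they are independent, `S` is uniform
among the subsets of `{1, …, N}` of size `τ`, `Z_t ∼ 𝒩(0, (σ² ∨ 1/(N²η_t)) I_d)`, and the entries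
of `W` are i.i.d. `𝒩(0, 49‖F‖⁴σ²)`. -/
def noiseLaw (N t : ℕ) : Measure (SGFSNoise N d) :=
  (uniformOn {S : Finset (Fin N) | S.card = P.τ}).prod
    ((Measure.pi fun _ : Fin d =>
        gaussianReal 0 (max (P.sigmaSq N) (1 / (N ^ 2 * P.η t))).toNNReal).prod
      (Measure.pi fun _ : Fin d => Measure.pi fun _ : Fin d =>
        gaussianReal 0 (49 * P.normF ^ 4 * P.sigmaSq N).toNNReal))

/-- The minibatch gradient `ḡ`. -/
def meanGrad {N : ℕ} (X : Fin N → 𝒳) (S : Finset (Fin N)) (θ : EuclideanSpace ℝ (Fin d)) :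
    EuclideanSpace ℝ (Fin d) :=
  (1 / (P.τ : ℝ)) • ∑ i ∈ S, ∇ (P.loss (X i)) θ

/-- The sample covariance matrix of the minibatch gradients. -/
def gradCov {N : ℕ} (X : Fin N → 𝒳) (S : Finset (Fin N)) (θ : EuclideanSpace ℝ (Fin d)) :
    Matrix (Fin d) (Fin d) ℝ :=
  (1 / ((P.τ : ℝ) - 1)) • ∑ i ∈ S,
    Matrix.vecMulVec (∇ (P.loss (X i)) θ - P.meanGrad X S θ).ofLp
      (∇ (P.loss (X i)) θ - P.meanGrad X S θ).ofLp

/-- The private gradient `g̃ = ḡ + F Z`. -/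
def privGrad {N : ℕ} (X : Fin N → 𝒳) (θ : EuclideanSpace ℝ (Fin d)) (ω : SGFSNoise N d) :
    EuclideanSpace ℝ (Fin d) :=
  P.meanGrad X ω.1 θ + WithLp.toLp 2 (P.F *ᵥ ω.2.1)

/-- The private covariance `V`. -/
def privCov {N : ℕ} (X : Fin N → 𝒳) (θ : EuclideanSpace ℝ (Fin d)) (ω : SGFSNoise N d) :
    Matrix (Fin d) (Fin d) ℝ :=
  psdProj (P.gradCov X ω.1 θ + Matrix.of ω.2.2)

/-- `Î_t = (1 - κ_t) Î_{t-1} + κ_t V`. -/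
def nextInfo (t : ℕ) (I V : Matrix (Fin d) (Fin d) ℝ) : Matrix (Fin d) (Fin d) ℝ :=
  (1 - P.κ t) • I + P.κ t • V

/-- `θ_{t+1} = θ_t + 2 ((τ + N) N / τ · Î_t + 4 F Fᵀ / η_t)⁻¹ (∇r(θ_t) + N g̃)`. -/
def nextParam (N t : ℕ) (θ : EuclideanSpace ℝ (Fin d)) (I : Matrix (Fin d) (Fin d) ℝ)
    (g : EuclideanSpace ℝ (Fin d)) : EuclideanSpace ℝ (Fin d) :=
  θ + (2 : ℝ) • WithLp.toLp 2
    ((((((P.τ : ℝ) + N) * N / P.τ) • I + (4 / P.η t) • (P.F * P.Fᵀ))⁻¹) *ᵥ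
      (∇ P.reg θ + (N : ℝ) • g).ofLp)

/-- What iteration `t` releases when it starts in the state `s`. -/
def release {N : ℕ} (X : Fin N → 𝒳) (t : ℕ) (s : SGFSState d) (ω : SGFSNoise N d) :
    SGFSRelease d :=
  (P.privGrad X s.1 ω, P.privCov X s.1 ω,
    P.nextParam N t s.1 (P.nextInfo t s.2 (P.privCov X s.1 ω)) (P.privGrad X s.1 ω))

/-- The state after iteration `t`, when that starts in the state `s`. -/
def nextState {N : ℕ} (X : Fin N → 𝒳) (t : ℕ) (s : SGFSState d) (ω : SGFSNoise N d) :
    SGFSState d :=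
  ((P.release X t s ω).2.2, P.nextInfo t s.2 (P.privCov X s.1 ω))

/-- The releases of iterations `t, t + 1, …, t + n - 1`, when iteration `t` starts in the state `s`
and the random draws of these iterations are `ω 0, …, ω (n - 1)`. -/
def run {N : ℕ} (X : Fin N → 𝒳) : (n t : ℕ) → SGFSState d → (Fin n → SGFSNoise N d) →
    Fin n → SGFSRelease d
  | 0, _, _, _ => Fin.elim0
  | n + 1, t, s, ω =>
      Fin.cons (P.release X t s (ω 0)) (run X n (t + 1) (P.nextState X t s (ω 0)) (Fin.tail ω))

/-- The law of the output `(g̃_t, V_t, θ_{t+1})`, `t = 1, …, ⌊NT/τ⌋`, of DP-SGFS on the data set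
`X`. -/
def law {N : ℕ} (X : Fin N → 𝒳) : Measure (Fin (P.steps N) → SGFSRelease d) :=
  (Measure.pi fun i : Fin (P.steps N) => P.noiseLaw N (i + 1)).map
    (P.run X (P.steps N) 1 (P.θ₁, P.I₀))

theorem measurable_meanGrad {N : ℕ} (X : Fin N → 𝒳) (S : Finset (Fin N)) :
    Measurable (P.meanGrad X S) := by
  unfold meanGrad
  have h : Measurable fun θ => ∑ i ∈ S, ∇ (P.loss (X i)) θ :=
    Finset.measurable_fun_sum S fun i _ => measurable_grad (P.loss (X i))
  exact Measurable.const_smul h (1 / (P.τ : ℝ))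

theorem measurable_gradCov {N : ℕ} (X : Fin N → 𝒳) (S : Finset (Fin N)) :
    Measurable (P.gradCov X S) := by
  refine measurable_pi_lambda _ fun a => measurable_pi_lambda _ fun b => ?_
  simp only [gradCov, Matrix.smul_apply, Matrix.sum_apply, Matrix.vecMulVec_apply, smul_eq_mul]
  refine (Finset.measurable_fun_sum S fun i _ => ?_).const_mul _
  have hi : Measurable fun θ => (∇ (P.loss (X i)) θ - P.meanGrad X S θ) :=
    (measurable_grad (P.loss (X i))).sub (P.measurable_meanGrad X S)
  have hc : ∀ c : Fin d, Measurable fun θ => (∇ (P.loss (X i)) θ - P.meanGrad X S θ).ofLp c :=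
    fun c => (EuclideanSpace.proj (𝕜 := ℝ) c).continuous.measurable.comp hi
  exact (hc a).mul (hc b)

theorem measurable_privGrad {N : ℕ} (X : Fin N → 𝒳) {α : Type*} [MeasurableSpace α]
    {θ : α → EuclideanSpace ℝ (Fin d)} {ω : α → SGFSNoise N d}
    (hθ : Measurable θ) (hω : Measurable ω) :
    Measurable fun a => P.privGrad X (θ a) (ω a) := by
  have h1 : Measurable fun a => P.meanGrad X (ω a).1 (θ a) :=
    measurable_apply_finset (P.measurable_meanGrad X) hω.fst hθ
  have h2 : Continuous fun z : Fin d → ℝ => WithLp.toLp 2 (P.F *ᵥ z) := by fun_prop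
  exact h1.add (h2.measurable.comp hω.snd.fst)

theorem measurable_privCov {N : ℕ} (X : Fin N → 𝒳) {α : Type*} [MeasurableSpace α]
    {θ : α → EuclideanSpace ℝ (Fin d)} {ω : α → SGFSNoise N d}
    (hθ : Measurable θ) (hω : Measurable ω) :
    Measurable fun a => P.privCov X (θ a) (ω a) := by
  have h1 : Measurable fun a => P.gradCov X (ω a).1 (θ a) :=
    measurable_apply_finset (P.measurable_gradCov X) hω.fst hθ
  have h2 : Measurable fun a => (ω a).2.2 := hω.snd.snd
  refine continuous_psdProj.measurable.comp ?_
  refine measurable_pi_lambda _ fun i => measurable_pi_lambda _ fun j => ?_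
  exact ((measurable_pi_iff.1 ((measurable_pi_iff.1 h1) i)) j).add
    ((measurable_pi_iff.1 ((measurable_pi_iff.1 h2) i)) j)

theorem measurable_nextInfo (t : ℕ) {α : Type*} [MeasurableSpace α]
    {I V : α → Matrix (Fin d) (Fin d) ℝ} (hI : Measurable I) (hV : Measurable V) :
    Measurable fun a => P.nextInfo t (I a) (V a) := by
  refine measurable_pi_lambda _ fun i => measurable_pi_lambda _ fun j => ?_
  exact (((measurable_pi_iff.1 ((measurable_pi_iff.1 hI) i)) j).const_mul _).add
    (((measurable_pi_iff.1 ((measurable_pi_iff.1 hV) i)) j).const_mul _)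

theorem measurable_nextParam (N t : ℕ) {α : Type*} [MeasurableSpace α]
    {θ g : α → EuclideanSpace ℝ (Fin d)} {I : α → Matrix (Fin d) (Fin d) ℝ}
    (hθ : Measurable θ) (hI : Measurable I) (hg : Measurable g) :
    Measurable fun a => P.nextParam N t (θ a) (I a) (g a) := by
  have h1 : Continuous fun I : Matrix (Fin d) (Fin d) ℝ =>
      (((P.τ : ℝ) + N) * N / P.τ) • I + (4 / P.η t) • (P.F * P.Fᵀ) := by fun_prop
  have h2 := measurable_matrixInv.comp (h1.measurable.comp hI)
  have h3 : Measurable fun a => ∇ P.reg (θ a) + (N : ℝ) • g a :=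
    Measurable.add (M := EuclideanSpace ℝ (Fin d)) ((measurable_grad P.reg).comp hθ)
      (Measurable.const_smul hg (N : ℝ))
  suffices h : Measurable fun a => WithLp.toLp 2
      (((((((P.τ : ℝ) + N) * N / P.τ) • I a + (4 / P.η t) • (P.F * P.Fᵀ))⁻¹) *ᵥ
        (∇ P.reg (θ a) + (N : ℝ) • g a).ofLp)) by
    have h' := Measurable.const_smul h (2 : ℝ)
    unfold nextParam
    exact Measurable.add (M := EuclideanSpace ℝ (Fin d)) hθ h'
  refine (PiLp.continuous_toLp 2 _).measurable.comp (measurable_pi_lambda _ fun i => ?_)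
  simp only [Matrix.mulVec, dotProduct]
  refine Finset.measurable_fun_sum _ fun j _ => ?_
  exact ((measurable_pi_iff.1 ((measurable_pi_iff.1 h2) i)) j).mul
    ((EuclideanSpace.proj (𝕜 := ℝ) j).continuous.measurable.comp h3)

theorem measurable_release {N : ℕ} (X : Fin N → 𝒳) (t : ℕ) {α : Type*} [MeasurableSpace α]
    {s : α → SGFSState d} {ω : α → SGFSNoise N d} (hs : Measurable s) (hω : Measurable ω) :
    Measurable fun a => P.release X t (s a) (ω a) := by
  have hg := P.measurable_privGrad X hs.fst hω
  have hV := P.measurable_privCov X hs.fst hω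
  have hI := P.measurable_nextInfo t hs.snd hV
  exact hg.prodMk (hV.prodMk (P.measurable_nextParam N t hs.fst hI hg))

theorem measurable_nextState {N : ℕ} (X : Fin N → 𝒳) (t : ℕ) {α : Type*} [MeasurableSpace α]
    {s : α → SGFSState d} {ω : α → SGFSNoise N d} (hs : Measurable s) (hω : Measurable ω) :
    Measurable fun a => P.nextState X t (s a) (ω a) :=
  (P.measurable_release X t hs hω).snd.snd.prodMk
    (P.measurable_nextInfo t hs.snd (P.measurable_privCov X hs.fst hω))

theorem measurable_run {N : ℕ} (X : Fin N → 𝒳) (n t : ℕ) :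
    Measurable fun p : SGFSState d × (Fin n → SGFSNoise N d) => P.run X n t p.1 p.2 := by
  induction n generalizing t with
  | zero => exact measurable_pi_lambda _ fun i => i.elim0
  | succ n ih =>
    have hs : Measurable fun p : SGFSState d × (Fin (n + 1) → SGFSNoise N d) => p.1 :=
      measurable_fst
    have hω : ∀ i, Measurable fun p : SGFSState d × (Fin (n + 1) → SGFSNoise N d) => p.2 i :=
      fun i => (measurable_pi_apply i).comp measurable_snd
    have h2 : Measurable fun p : SGFSState d × (Fin (n + 1) → SGFSNoise N d) =>
        Fin.tail p.2 := measurable_pi_lambda _ fun i => hω i.succ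
    have h3 := (ih (t + 1)).comp ((P.measurable_nextState X t hs (hω 0)).prodMk h2)
    refine measurable_pi_lambda _ fun i => ?_
    refine Fin.cases ?_ (fun j => ?_) i
    · exact P.measurable_release X t hs (hω 0)
    · exact (measurable_pi_iff.1 h3) j

/-- The law is that of an honest randomized algorithm. -/
theorem isProbabilityMeasure_law {N : ℕ} (hτ : P.τ ≤ N) (X : Fin N → 𝒳) :
    IsProbabilityMeasure (P.law X) := by
  have h : ∀ t, IsProbabilityMeasure (P.noiseLaw N t) := by
    intro t
    obtain ⟨S, -, hS⟩ := Finset.exists_subset_card_eq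
      (s := (Finset.univ : Finset (Fin N))) (n := P.τ) (by simpa using hτ)
    have := isProbabilityMeasure_uniformOn (s := {S : Finset (Fin N) | S.card = P.τ})
      (Set.toFinite _) ⟨S, hS⟩
    unfold noiseLaw
    infer_instance
  exact Measure.isProbabilityMeasure_map
    ((P.measurable_run X (P.steps N) 1).comp measurable_prodMk_left).aemeasurable

end SGFSInput

end

/-!
The proof treats each iteration as a subsampled Gaussian mechanism and composes the iterations
adaptively.

*One iteration.* Every gradient at `θ` is `F u` with `‖u‖ ≤ 1`, by the assumption on the ellipsoid.
Hence an iteration is a fixed function of a Gaussian vector in `ℝᵈ × ℝᵈˣᵈ`, whose centre, in units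
of the standard deviations, collects the mean of the `u`'s and the sample covariance of the
gradients (`SGFSInput.releaseLaw_eq`). Replacing one data point moves that centre by a vector of
squared length at most `m = 4.36 / (τ² σ²)`: the shifts of the mean and of the covariance cannot be
extremal simultaneously (`SGFSInput.norm_noiseCentre_insert_sub_sq_le`). Pairing each minibatch
without the exchanged index `i` with those in which `i` replaces one of its elements, the law of an
iteration becomes an average of mixtures `(1 - q) 𝒩(a, 1) + q 𝒩(b, 1)` with `q = τ / N`
(`isStepBound_subsampling`).

*Composition.* Let `h` and `k` be the probabilities of an event under the two data sets, given the
past. An estimate `h ≤ γ k + γ⁻ˡ c + D` for all `γ > 0` passes from the last `n` iterations to the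
last `n + 1`: choose `γ` depending on the density ratio of the current iteration, which multiplies
`c` by the moment of order `l` of this ratio off an exceptional set, and adds the mass of that set
to `D`. This is the notion `IsStepBound`, and `SGFSInput.runLaw_le_of_isStepBound` is the resulting
composition theorem. It needs no moments of the whole privacy loss, and allows the exceptional set
to be truncated in each iteration.

*Numbers.* With `L₂ = log (2 / δ)` and `L = log (2.5 N T / (τ δ))`, the lower bound on `T` gives
`m L ≤ 4.36`, and the choice of `σ²` bounds the total of `q² m` by `4.36 ε² / (32 L₂ L)`. If `2 ε`
is at least `L₂ - 2.5`, second moments (`l = 1`) suffice. For smaller `ε` the order is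
`l = 3 L₂ / (4 ε)`, and the moments are taken off the event that the log-density ratio of the
shifted Gaussians exceeds `3`; this event accounts for at most `3 δ / 2` in total, and the
moments for at most `δ / 2`.
-/

noncomputable section

open scoped ENNReal

/-! ### The standard Gaussian measure -/

section Gaussian

theorem gaussianReal_map_add_eq_withDensity (a : ℝ) :
    (gaussianReal 0 1).map (· + a) =
      (gaussianReal 0 1).withDensity fun x => ENNReal.ofReal (Real.exp (a * x - a ^ 2 / 2)) := by
  rw [gaussianReal_map_add_const, gaussianReal_of_var_ne_zero _ one_ne_zero,
    gaussianReal_of_var_ne_zero _ one_ne_zero, ← withDensity_mul _ (by fun_prop) (by fun_prop)]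
  congr 1
  ext x
  simp only [gaussianPDF, Pi.mul_apply]
  rw [← ENNReal.ofReal_mul (gaussianPDFReal_nonneg _ _ _)]
  congr 1
  simp only [gaussianPDFReal, mul_assoc, ← Real.exp_add]
  congr 2
  simp
  ring

theorem pi_withDensity_eq {ι : Type*} [Fintype ι] {μ : ι → Measure ℝ}
    [∀ i, IsProbabilityMeasure (μ i)] {D : ι → ℝ → ℝ≥0∞} (hD : ∀ i, Measurable (D i))
    [∀ i, IsProbabilityMeasure ((μ i).withDensity (D i))] :
    Measure.pi (fun i => (μ i).withDensity (D i)) =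
      (Measure.pi μ).withDensity fun x => ∏ i, D i (x i) := by
  refine Measure.pi_eq fun s hs => ?_
  rw [withDensity_apply _ (.univ_pi hs), ← lintegral_indicator (.univ_pi hs)]
  have h : ∀ x : ι → ℝ, (Set.univ.pi s).indicator (fun x => ∏ i, D i (x i)) x =
      ∏ i, (s i).indicator (D i) (x i) := by
    intro x
    by_cases hx : x ∈ Set.univ.pi s
    · rw [Set.indicator_of_mem hx]
      exact Finset.prod_congr rfl fun i _ => (Set.indicator_of_mem (hx i (Set.mem_univ i)) _).symm
    · rw [Set.indicator_of_notMem hx]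
      simp only [Set.mem_pi, Set.mem_univ, true_implies, not_forall] at hx
      obtain ⟨i, hi⟩ := hx
      exact (Finset.prod_eq_zero (Finset.mem_univ i) (Set.indicator_of_notMem hi _)).symm
  simp_rw [h]
  have hm : ∀ i, Measurable ((s i).indicator (D i)) := fun i => (hD i).indicator (hs i)
  rw [lintegral_prod_eq_prod_lintegral_of_indepFun Finset.univ
    (fun i (x : ι → ℝ) => (s i).indicator (D i) (x i))
    (iIndepFun_pi (X := fun i => (s i).indicator (D i)) fun i => (hm i).aemeasurable)
    (fun i => (hm i).comp (measurable_pi_apply i))]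
  refine Finset.prod_congr rfl fun i _ => ?_
  rw [withDensity_apply _ (hs i), ← lintegral_indicator (hs i)]
  exact ((measurePreserving_eval μ i).lintegral_comp (hm i))

variable {ι : Type*} [Fintype ι]

/-- The Cameron–Martin formula: a translate of the standard Gaussian measure has an explicit
density with respect to it. -/
theorem lintegral_stdGaussian_add (a : EuclideanSpace ℝ ι) {f : EuclideanSpace ℝ ι → ℝ≥0∞}
    (hf : Measurable f) :
    ∫⁻ ω, f (ω + a) ∂stdGaussian (EuclideanSpace ℝ ι) =
      ∫⁻ ω, f ω * ENNReal.ofReal (Real.exp (inner ℝ a ω - ‖a‖ ^ 2 / 2))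
        ∂stdGaussian (EuclideanSpace ℝ ι) := by
  have hpi : (Measure.pi fun _ : ι => gaussianReal 0 1).map (fun x i => x i + a i) =
      (Measure.pi fun _ : ι => gaussianReal 0 1).withDensity
        fun x => ∏ i, ENNReal.ofReal (Real.exp (a i * x i - a i ^ 2 / 2)) := by
    have hp : ∀ i, IsProbabilityMeasure ((gaussianReal 0 1).withDensity
        fun x => ENNReal.ofReal (Real.exp (a i * x - a i ^ 2 / 2))) := fun i => by
      rw [← gaussianReal_map_add_eq_withDensity]
      exact Measure.isProbabilityMeasure_map (by fun_prop)
    have hp' : ∀ i, IsProbabilityMeasure ((gaussianReal 0 1).map (· + a i)) := fun i =>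
      Measure.isProbabilityMeasure_map (by fun_prop)
    rw [Measure.pi_map_pi (f := fun i x => x + a i) (fun i => by fun_prop)]
    simp_rw [gaussianReal_map_add_eq_withDensity]
    exact pi_withDensity_eq fun i => by fun_prop
  rw [← map_pi_eq_stdGaussian, lintegral_map (by fun_prop) (by fun_prop),
    lintegral_map (by fun_prop) (by fun_prop)]
  have h1 : ∫⁻ x : ι → ℝ, f (WithLp.toLp 2 x + a) ∂(Measure.pi fun _ : ι => gaussianReal 0 1) =
      ∫⁻ x, f (WithLp.toLp 2 x)
        ∂(Measure.pi fun _ : ι => gaussianReal 0 1).map (fun x i => x i + a i) := by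
    rw [lintegral_map (by fun_prop) (by fun_prop)]
    rfl
  rw [h1, hpi, lintegral_withDensity_eq_lintegral_mul _ (by fun_prop) (by fun_prop)]
  refine lintegral_congr fun x => ?_
  simp only [Pi.mul_apply]
  rw [mul_comm, ← ENNReal.ofReal_prod_of_nonneg fun i _ => (Real.exp_pos _).le, ← Real.exp_sum,
    Finset.sum_sub_distrib, EuclideanSpace.real_norm_sq_eq, Finset.sum_div]
  simp [PiLp.inner_apply, mul_comm]

theorem stdGaussian_map_neg :
    (stdGaussian (EuclideanSpace ℝ ι)).map (fun x => -x) = stdGaussian (EuclideanSpace ℝ ι) :=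
  stdGaussian_map (LinearIsometryEquiv.neg ℝ)

theorem lintegral_exp_inner_stdGaussian (a : EuclideanSpace ℝ ι) :
    ∫⁻ ω, ENNReal.ofReal (Real.exp (inner ℝ a ω)) ∂stdGaussian (EuclideanSpace ℝ ι) =
      ENNReal.ofReal (Real.exp (‖a‖ ^ 2 / 2)) := by
  have h := lintegral_stdGaussian_add a (f := fun _ => ENNReal.ofReal (Real.exp (‖a‖ ^ 2 / 2)))
    measurable_const
  simp only [lintegral_const, measure_univ, mul_one] at h
  rw [h]
  refine lintegral_congr fun ω => ?_
  rw [← ENNReal.ofReal_mul (Real.exp_pos _).le, ← Real.exp_add]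
  congr 2
  ring

theorem integrable_exp_inner_stdGaussian (a : EuclideanSpace ℝ ι) :
    Integrable (fun ω => Real.exp (inner ℝ a ω)) (stdGaussian (EuclideanSpace ℝ ι)) := by
  refine ⟨by fun_prop, ?_⟩
  rw [hasFiniteIntegral_iff_ofReal (Filter.Eventually.of_forall fun _ => (Real.exp_pos _).le),
    lintegral_exp_inner_stdGaussian]
  exact ENNReal.ofReal_lt_top

theorem integral_exp_inner_stdGaussian (a : EuclideanSpace ℝ ι) :
    ∫ ω, Real.exp (inner ℝ a ω) ∂stdGaussian (EuclideanSpace ℝ ι) = Real.exp (‖a‖ ^ 2 / 2) := by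
  rw [integral_eq_lintegral_of_nonneg_ae
    (Filter.Eventually.of_forall fun _ => (Real.exp_pos _).le) (by fun_prop),
    lintegral_exp_inner_stdGaussian, ENNReal.toReal_ofReal (Real.exp_pos _).le]

theorem integrable_inner_stdGaussian (a : EuclideanSpace ℝ ι) :
    Integrable (fun ω => inner ℝ a ω) (stdGaussian (EuclideanSpace ℝ ι)) :=
  (IsGaussian.integrable_id (μ := stdGaussian (EuclideanSpace ℝ ι))).const_inner a

theorem integral_inner_stdGaussian (a : EuclideanSpace ℝ ι) :
    ∫ ω, inner ℝ a ω ∂stdGaussian (EuclideanSpace ℝ ι) = 0 :=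
  integral_strongDual_stdGaussian (innerSL ℝ a)

/-- A Gaussian tail bound with the sharp factor `1 / 2`. -/
theorem stdGaussian_inner_gt_le {h : EuclideanSpace ℝ ι} {m t : ℝ} (hm : ‖h‖ ^ 2 ≤ m)
    (ht : 0 < t) :
    stdGaussian (EuclideanSpace ℝ ι) {ω | t < inner ℝ h ω} ≤
      ENNReal.ofReal (Real.exp (-(t ^ 2 / (2 * m))) / 2) := by
  set ν := stdGaussian (EuclideanSpace ℝ ι)
  rcases eq_or_ne h 0 with rfl | h0
  · simp [ht.not_gt]
  have hpos : 0 < ‖h‖ ^ 2 := by positivity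
  have hms : ∀ c : ℝ, MeasurableSet {ω : EuclideanSpace ℝ ι | c < inner ℝ h ω} := fun c =>
    measurableSet_lt measurable_const (by fun_prop)
  have hhalf : ν {ω | 0 < inner ℝ h ω} ≤ ENNReal.ofReal (1 / 2) := by
    have h1 : ν {ω | inner ℝ h ω < 0} = ν {ω | 0 < inner ℝ h ω} := by
      conv_rhs => rw [show ν = ν.map (fun x => -x) from stdGaussian_map_neg.symm]
      rw [Measure.map_apply (by fun_prop) (hms 0)]
      congr 1
      ext ω
      simp [inner_neg_right]
    have h2 : ν {ω | inner ℝ h ω < 0} + ν {ω | 0 < inner ℝ h ω} ≤ 1 := by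
      rw [← measure_union _ (hms 0)]
      · exact prob_le_one
      · rw [Set.disjoint_left]
        intro ω (h3 : inner ℝ h ω < 0) (h4 : 0 < inner ℝ h ω)
        exact lt_asymm h3 h4
    rw [h1, ← two_mul] at h2
    rw [one_div, ENNReal.ofReal_inv_of_pos two_pos]
    simpa using ENNReal.le_inv_iff_mul_le.2 (by rwa [mul_comm] at h2)
  -- translating by `b` moves the half-space `t < ⟪h, ω⟫` to `0 < ⟪h, ω⟫`
  set b : EuclideanSpace ℝ ι := (t / ‖h‖ ^ 2) • h with hb
  have hbω : ∀ ω, inner ℝ b ω = t / ‖h‖ ^ 2 * inner ℝ h ω := fun ω => by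
    rw [hb, real_inner_smul_left]
  have hhb : inner ℝ h b = t := by
    rw [hb, real_inner_smul_right, real_inner_self_eq_norm_sq]; field_simp
  have hbb : ‖b‖ ^ 2 = t ^ 2 / ‖h‖ ^ 2 := by
    rw [hb, norm_smul, mul_pow, Real.norm_eq_abs, sq_abs]; field_simp
  have key := lintegral_stdGaussian_add b
    (f := fun ω => {ω | t < inner ℝ h ω}.indicator (fun ω =>
      ENNReal.ofReal (Real.exp (-(inner ℝ b ω - ‖b‖ ^ 2 / 2)))) ω)
    (Measurable.indicator (by fun_prop) (hms t))
  have hr : ∀ ω, {ω | t < inner ℝ h ω}.indicator (fun ω =>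
      ENNReal.ofReal (Real.exp (-(inner ℝ b ω - ‖b‖ ^ 2 / 2)))) ω *
      ENNReal.ofReal (Real.exp (inner ℝ b ω - ‖b‖ ^ 2 / 2)) =
      {ω | t < inner ℝ h ω}.indicator 1 ω := by
    intro ω
    by_cases hω : ω ∈ {ω | t < inner ℝ h ω}
    · rw [Set.indicator_of_mem hω, Set.indicator_of_mem hω,
        ← ENNReal.ofReal_mul (Real.exp_pos _).le, ← Real.exp_add]
      simp
    · rw [Set.indicator_of_notMem hω, Set.indicator_of_notMem hω, zero_mul]
  simp_rw [hr] at key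
  rw [lintegral_indicator_one (hms t)] at key
  rw [← key]
  have hle : ∀ ω, {ω | t < inner ℝ h ω}.indicator (fun ω =>
      ENNReal.ofReal (Real.exp (-(inner ℝ b ω - ‖b‖ ^ 2 / 2)))) (ω + b) ≤
      ENNReal.ofReal (Real.exp (-(t ^ 2 / (2 * m)))) * {ω | 0 < inner ℝ h ω}.indicator 1 ω := by
    intro ω
    by_cases hω : 0 < inner ℝ h ω
    · have h1 : ω + b ∈ {ω | t < inner ℝ h ω} := by
        simp only [Set.mem_ofPred_eq, inner_add_right, hhb]; linarith
      have h2 : ω ∈ {ω | 0 < inner ℝ h ω} := hω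
      rw [Set.indicator_of_mem h1, Set.indicator_of_mem h2, Pi.one_apply, mul_one]
      refine ENNReal.ofReal_le_ofReal (Real.exp_le_exp.2 (neg_le_neg ?_))
      have h3 : t ^ 2 / (2 * m) ≤ t ^ 2 / (2 * ‖h‖ ^ 2) := by gcongr
      have h4 : t ^ 2 / (2 * ‖h‖ ^ 2) = ‖b‖ ^ 2 / 2 := by rw [hbb]; field_simp
      have h5 : 0 ≤ inner ℝ b ω := by rw [hbω]; positivity
      rw [inner_add_right, real_inner_self_eq_norm_sq]
      linarith
    · have h1 : ω + b ∉ {ω | t < inner ℝ h ω} := by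
        simp only [Set.mem_ofPred_eq, inner_add_right, hhb]; linarith
      rw [Set.indicator_of_notMem h1]
      exact zero_le
  calc _ ≤ ∫⁻ ω, ENNReal.ofReal (Real.exp (-(t ^ 2 / (2 * m)))) *
        {ω | 0 < inner ℝ h ω}.indicator 1 ω ∂ν := lintegral_mono hle
    _ = ENNReal.ofReal (Real.exp (-(t ^ 2 / (2 * m)))) * ν {ω | 0 < inner ℝ h ω} := by
        rw [lintegral_const_mul _ (measurable_one.indicator (hms 0)),
          lintegral_indicator_one (hms 0)]
    _ ≤ ENNReal.ofReal (Real.exp (-(t ^ 2 / (2 * m)))) * ENNReal.ofReal (1 / 2) := by gcongr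
    _ = _ := by rw [← ENNReal.ofReal_mul (Real.exp_pos _).le]; congr 1; ring

end Gaussian

/-! ### Elementary inequalities -/

/-- The second-order remainder `eˣ - 1 - x` of the exponential. -/
def expRem (x : ℝ) : ℝ := Real.exp x - 1 - x

theorem expRem_nonneg (x : ℝ) : 0 ≤ expRem x := by
  have := Real.add_one_le_exp x
  unfold expRem
  linarith

theorem expRem_le_expRem {x y : ℝ} (hx : 0 ≤ x) (hxy : x ≤ y) : expRem x ≤ expRem y := by
  unfold expRem
  have h1 : Real.exp y = Real.exp x * Real.exp (y - x) := by rw [← Real.exp_add]; congr 1; ring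
  have h2 := Real.add_one_le_exp (y - x)
  have h3 := Real.one_le_exp hx
  nlinarith

/-- The perspective `(c, t) ↦ t (e^{c/t} - 1 - c/t)` is increasing in `c` and decreasing in `t`. -/
theorem mul_expRem_div_le {c c' s t : ℝ} (hs : 0 < s) (hst : s ≤ t) (hc : 0 ≤ c) (hcc : c ≤ c') :
    t * expRem (c / t) ≤ s * expRem (c' / s) := by
  have ht := hs.trans_le hst
  have h1 : expRem (c / t) ≤ expRem (c' / t) :=
    expRem_le_expRem (by positivity) (by gcongr)
  have h2 : expRem (c' / t) ≤ s / t * expRem (c' / s) := by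
    have ha : 0 ≤ 1 - s / t := by rw [sub_nonneg, div_le_one ht]; exact hst
    have hb : 0 ≤ s / t := by positivity
    have h3 := convexOn_exp.2 (Set.mem_univ 0) (Set.mem_univ (c' / s)) ha hb (by ring)
    simp only [smul_eq_mul, mul_zero, zero_add, Real.exp_zero, mul_one] at h3
    have h4 : s / t * (c' / s) = c' / t := by field_simp
    rw [h4] at h3
    unfold expRem
    rw [mul_sub, mul_sub, h4]
    linarith
  calc t * expRem (c / t) ≤ t * (s / t * expRem (c' / s)) := by gcongr; exact h1.trans h2
    _ = s * expRem (c' / s) := by field_simp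

/-- The exponential lies below its chords. -/
theorem exp_sub_one_le_chord {x X : ℝ} (hx : 0 ≤ x) (hxX : x ≤ X) (hX : 0 < X) :
    Real.exp x - 1 ≤ (Real.exp X - 1) / X * x := by
  have ha : 0 ≤ 1 - x / X := by rw [sub_nonneg, div_le_one hX]; exact hxX
  have hb : 0 ≤ x / X := by positivity
  have h3 := convexOn_exp.2 (Set.mem_univ 0) (Set.mem_univ X) ha hb (by ring)
  simp only [smul_eq_mul, mul_zero, zero_add, Real.exp_zero, mul_one] at h3
  rw [div_mul_cancel₀ _ hX.ne'] at h3
  have : (Real.exp X - 1) / X * x = x / X * Real.exp X - x / X := by field_simp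
  linarith

theorem one_add_rpow_le_of_nonneg {v l : ℝ} (hl : 0 < l) (hv : 0 ≤ v) :
    (1 + v) ^ (1 + l) ≤ 1 + (1 + l) * v + (1 + 1 / l) * expRem (l * v) := by
  have hd : ∀ v ∈ Set.Ici (0 : ℝ), HasDerivAt
      (fun v => (1 + 1 / l) * Real.exp (l * v) - 1 / l - (1 + v) ^ (1 + l))
      ((1 + 1 / l) * (Real.exp (l * v) * l) - (1 + l) * (1 + v) ^ l) v := by
    intro v (hv : 0 ≤ v)
    have h1 : HasDerivAt (fun v => Real.exp (l * v)) (Real.exp (l * v) * l) v := by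
      simpa using ((hasDerivAt_id v).const_mul l).exp
    have h2 : HasDerivAt (fun v : ℝ => (1 + v) ^ (1 + l)) ((1 + l) * (1 + v) ^ l) v := by
      have := ((hasDerivAt_id v).const_add 1).rpow_const (p := 1 + l) (Or.inl (by simp; positivity))
      simpa using this
    exact ((h1.const_mul _).sub_const _).sub h2
  have hmono : MonotoneOn
      (fun v => (1 + 1 / l) * Real.exp (l * v) - 1 / l - (1 + v) ^ (1 + l)) (Set.Ici 0) := by
    refine monotoneOn_of_deriv_nonneg (convex_Ici 0)
      (fun v hv => (hd v hv).continuousAt.continuousWithinAt)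
      (fun v hv => (hd v (interior_subset hv)).differentiableAt.differentiableWithinAt) ?_
    intro v hv
    rw [(hd v (interior_subset hv)).deriv]
    have hv0 : 0 ≤ v := interior_subset hv
    have h1 : (1 + v) ^ l ≤ Real.exp (l * v) := by
      rw [mul_comm, Real.exp_mul]
      exact Real.rpow_le_rpow (by positivity) (by linarith [Real.add_one_le_exp v]) hl.le
    have h2 : (1 + 1 / l) * (Real.exp (l * v) * l) = (1 + l) * Real.exp (l * v) := by
      field_simp; ring
    rw [h2, ← mul_sub]
    exact mul_nonneg (by positivity) (sub_nonneg.2 h1)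
  have h := hmono (Set.mem_Ici.2 le_rfl) (Set.mem_Ici.2 hv) hv
  simp only [mul_zero, Real.exp_zero, mul_one, add_zero, Real.one_rpow] at h
  unfold expRem
  have h2 : 1 + (1 + l) * v + (1 + 1 / l) * (Real.exp (l * v) - 1 - l * v) =
      (1 + 1 / l) * Real.exp (l * v) - 1 / l := by field_simp; ring
  rw [h2]
  linarith

theorem one_add_rpow_le_of_nonpos {v l : ℝ} (hl : 1 ≤ l) (hv : v ≤ 0) (hv1 : -1 < v) :
    (1 + v) ^ (1 + l) ≤ 1 + (1 + l) * v + l * (l + 1) / 2 * v ^ 2 := by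
  have hd : ∀ v ∈ Set.Ioc (-1 : ℝ) 0, HasDerivAt
      (fun v => (1 + v) ^ (1 + l) - (1 + l) * v - l * (l + 1) / 2 * v ^ 2)
      ((1 + l) * (1 + v) ^ l - (1 + l) - l * (l + 1) / 2 * (2 * v)) v := by
    intro v hv
    have h2 : HasDerivAt (fun v : ℝ => (1 + v) ^ (1 + l)) ((1 + l) * (1 + v) ^ l) v := by
      have := ((hasDerivAt_id v).const_add 1).rpow_const (p := 1 + l)
        (Or.inl (by simp; linarith [hv.1]))
      simpa using this
    have h3 : HasDerivAt (fun v : ℝ => v ^ 2) (2 * v) v := by simpa using hasDerivAt_pow 2 v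
    have h4 : HasDerivAt (fun v : ℝ => (1 + l) * v) (1 + l) v := by
      simpa using (hasDerivAt_id v).const_mul (1 + l)
    exact (h2.sub h4).sub (h3.const_mul _)
  have hmono : MonotoneOn
      (fun v => (1 + v) ^ (1 + l) - (1 + l) * v - l * (l + 1) / 2 * v ^ 2) (Set.Ioc (-1) 0) := by
    refine monotoneOn_of_deriv_nonneg (convex_Ioc _ _)
      (fun v hv => (hd v hv).continuousAt.continuousWithinAt)
      (fun v hv => (hd v (interior_subset hv)).differentiableAt.differentiableWithinAt) ?_
    intro v hv
    have hv' := interior_subset hv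
    rw [(hd v hv').deriv]
    have h1 := one_add_mul_self_le_rpow_one_add (s := v) hv'.1.le hl
    nlinarith
  have h := hmono (a := v) (b := 0) ⟨hv1, hv⟩ ⟨by norm_num, le_rfl⟩ hv
  simp only [mul_zero, add_zero, Real.one_rpow] at h
  norm_num at h
  linarith

/-! ### One step of adaptive composition -/

/-- If `h` is bounded by a hockey-stick type estimate in terms of `k` at all thresholds, then so is
the mean of `h` under a law with density `p` in terms of the mean of `k` under a law with density
`g`: at the point `ω` the estimate is used at the threshold `γ g / p`. The price is the `l`-th
moment of the density ratio on a good set `G`, and the mass of the complement of `G`. -/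
theorem lintegral_mul_density_le {E : Type*} [MeasurableSpace E] {ν : Measure E}
    {p g : E → ℝ} (hp : Measurable p) (hg : Measurable g) (hp0 : ∀ ω, 0 < p ω)
    (hg0 : ∀ ω, 0 < g ω) {h k : E → ℝ≥0∞} (hk : Measurable k) (hh1 : ∀ ω, h ω ≤ 1)
    {l : ℝ} {c D η M : ℝ≥0∞}
    (hhk : ∀ ω, ∀ γ : ℝ, 0 < γ →
      h ω ≤ ENNReal.ofReal γ * k ω + ENNReal.ofReal (γ ^ (-l)) * c + D)
    {G : Set E} (hG : MeasurableSet G) (hp1 : ∫⁻ ω, ENNReal.ofReal (p ω) ∂ν ≤ 1)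
    (hη : ∫⁻ ω in Gᶜ, ENNReal.ofReal (p ω) ∂ν ≤ η)
    (hM : ∫⁻ ω in G, ENNReal.ofReal (p ω * (p ω / g ω) ^ l) ∂ν ≤ M) {γ : ℝ} (hγ : 0 < γ) :
    ∫⁻ ω, h ω * ENNReal.ofReal (p ω) ∂ν ≤
      ENNReal.ofReal γ * ∫⁻ ω, k ω * ENNReal.ofReal (g ω) ∂ν
        + ENNReal.ofReal (γ ^ (-l)) * (M * c) + D + η := by
  have hpt : ∀ ω, h ω * ENNReal.ofReal (p ω) ≤
      ENNReal.ofReal γ * (k ω * ENNReal.ofReal (g ω)) +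
      ENNReal.ofReal (γ ^ (-l)) * c * ENNReal.ofReal (p ω * (p ω / g ω) ^ l)
      + D * ENNReal.ofReal (p ω) := by
    intro ω
    have hp' := hp0 ω
    have hg' := hg0 ω
    have hr : 0 < γ * (g ω / p ω) := by positivity
    have h1 := mul_le_mul_left (hhk ω _ hr) (ENNReal.ofReal (p ω))
    refine h1.trans (le_of_eq ?_)
    rw [add_mul, add_mul]
    congr 2
    · rw [mul_right_comm, ← ENNReal.ofReal_mul hr.le, mul_left_comm, ← ENNReal.ofReal_mul hγ.le,
        mul_comm]
      congr 2
      field_simp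
    · rw [mul_right_comm, mul_right_comm _ c, ← ENNReal.ofReal_mul (by positivity),
        ← ENNReal.ofReal_mul (by positivity)]
      congr 2
      rw [Real.mul_rpow hγ.le (by positivity), Real.rpow_neg (x := g ω / p ω) (by positivity),
        ← Real.inv_rpow (by positivity), inv_div]
      ring
  have hgood : ∫⁻ ω in G, h ω * ENNReal.ofReal (p ω) ∂ν ≤
      ENNReal.ofReal γ * ∫⁻ ω, k ω * ENNReal.ofReal (g ω) ∂ν
        + ENNReal.ofReal (γ ^ (-l)) * (M * c) + D := by
    refine (lintegral_mono hpt).trans ?_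
    rw [lintegral_add_right _ (by fun_prop), lintegral_add_left (by fun_prop),
      lintegral_const_mul _ (by fun_prop), lintegral_const_mul _ (by fun_prop),
      lintegral_const_mul _ (by fun_prop)]
    rw [mul_assoc, mul_comm c]
    gcongr
    · exact Measure.restrict_le_self
    · calc D * ∫⁻ ω in G, ENNReal.ofReal (p ω) ∂ν ≤ D * 1 := by
            gcongr; exact (setLIntegral_le_lintegral _ _).trans hp1
        _ = D := mul_one D
  rw [← lintegral_add_compl _ hG]
  refine add_le_add hgood (le_trans (lintegral_mono fun ω => ?_) hη)
  exact mul_le_of_le_one_left' (hh1 ω)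

/-! ### Mixtures of Gaussian translates -/

section Mixture

variable {ι : Type*} [Fintype ι]

/-- The density of the translate by `b` of the standard Gaussian measure. -/
def shiftDensity (b ω : EuclideanSpace ℝ ι) : ℝ :=
  Real.exp (inner ℝ b ω - ‖b‖ ^ 2 / 2)

/-- The density of the mixture, with weights `1 - q` and `q`, of the standard Gaussian measure and
its translate by `b`. -/
def mixDensity (q : ℝ) (b ω : EuclideanSpace ℝ ι) : ℝ :=
  1 - q + q * shiftDensity b ω

theorem shiftDensity_pos (b ω : EuclideanSpace ℝ ι) : 0 < shiftDensity b ω := Real.exp_pos _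

theorem mixDensity_pos {q : ℝ} (hq0 : 0 ≤ q) (hq1 : q ≤ 1) (b ω : EuclideanSpace ℝ ι) :
    0 < mixDensity q b ω := by
  unfold mixDensity
  rcases hq1.lt_or_eq with h | rfl
  · have := mul_nonneg hq0 (shiftDensity_pos b ω).le
    linarith
  · simpa using shiftDensity_pos b ω

@[fun_prop]
theorem measurable_shiftDensity (b : EuclideanSpace ℝ ι) : Measurable (shiftDensity b) := by
  unfold shiftDensity; fun_prop

@[fun_prop]
theorem measurable_mixDensity (q : ℝ) (b : EuclideanSpace ℝ ι) :
    Measurable (mixDensity q b) := by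
  unfold mixDensity; fun_prop

theorem integrable_exp_inner_sub (b : EuclideanSpace ℝ ι) (c : ℝ) :
    Integrable (fun ω => Real.exp (inner ℝ b ω - c)) (stdGaussian (EuclideanSpace ℝ ι)) := by
  simp_rw [Real.exp_sub]
  exact (integrable_exp_inner_stdGaussian b).div_const _

theorem integral_exp_inner_sub (b : EuclideanSpace ℝ ι) (c : ℝ) :
    ∫ ω, Real.exp (inner ℝ b ω - c) ∂stdGaussian (EuclideanSpace ℝ ι) =
      Real.exp (‖b‖ ^ 2 / 2 - c) := by
  simp_rw [Real.exp_sub]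
  rw [integral_div, integral_exp_inner_stdGaussian]

theorem integrable_shiftDensity (b : EuclideanSpace ℝ ι) :
    Integrable (shiftDensity b) (stdGaussian (EuclideanSpace ℝ ι)) :=
  integrable_exp_inner_sub _ _

theorem integral_shiftDensity (b : EuclideanSpace ℝ ι) :
    ∫ ω, shiftDensity b ω ∂stdGaussian (EuclideanSpace ℝ ι) = 1 := by
  unfold shiftDensity
  rw [integral_exp_inner_sub]
  simp

theorem integrable_mixDensity (q : ℝ) (b : EuclideanSpace ℝ ι) :
    Integrable (mixDensity q b) (stdGaussian (EuclideanSpace ℝ ι)) :=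
  (integrable_const (1 - q)).add ((integrable_shiftDensity b).const_mul q)

theorem integral_mixDensity (q : ℝ) (b : EuclideanSpace ℝ ι) :
    ∫ ω, mixDensity q b ω ∂stdGaussian (EuclideanSpace ℝ ι) = 1 := by
  unfold mixDensity
  rw [integral_add (integrable_const _) ((integrable_shiftDensity b).const_mul q),
    integral_const_mul, integral_shiftDensity]
  simp

theorem lintegral_mixDensity {q : ℝ} (hq0 : 0 ≤ q) (hq1 : q ≤ 1) (b : EuclideanSpace ℝ ι) :
    ∫⁻ ω, ENNReal.ofReal (mixDensity q b ω) ∂stdGaussian (EuclideanSpace ℝ ι) = 1 := by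
  rw [← ofReal_integral_eq_lintegral_ofReal (integrable_mixDensity q b)
    (Filter.Eventually.of_forall fun ω => (mixDensity_pos hq0 hq1 b ω).le), integral_mixDensity,
    ENNReal.ofReal_one]

/-- The mean under the mixture, as a mixture of means of translates. -/
theorem lintegral_mul_mixDensity {q : ℝ} (hq0 : 0 ≤ q) (hq1 : q ≤ 1) (b : EuclideanSpace ℝ ι)
    {f : EuclideanSpace ℝ ι → ℝ≥0∞} (hf : Measurable f) :
    ∫⁻ ω, f ω * ENNReal.ofReal (mixDensity q b ω) ∂stdGaussian (EuclideanSpace ℝ ι) =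
      ENNReal.ofReal (1 - q) * ∫⁻ ω, f ω ∂stdGaussian (EuclideanSpace ℝ ι) +
        ENNReal.ofReal q * ∫⁻ ω, f (ω + b) ∂stdGaussian (EuclideanSpace ℝ ι) := by
  rw [lintegral_stdGaussian_add b hf, ← lintegral_const_mul _ hf,
    ← lintegral_const_mul _ (by fun_prop), ← lintegral_add_left (by fun_prop)]
  refine lintegral_congr fun ω => ?_
  unfold mixDensity
  rw [ENNReal.ofReal_add (by linarith) (mul_nonneg hq0 (shiftDensity_pos b ω).le),
    ENNReal.ofReal_mul hq0, mul_add, mul_comm (f ω), mul_left_comm]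
  rfl

theorem setLIntegral_mixDensity_le {q : ℝ} (hq0 : 0 ≤ q) (hq1 : q ≤ 1)
    (b : EuclideanSpace ℝ ι) {U : Set (EuclideanSpace ℝ ι)} (hU : MeasurableSet U) {η : ℝ≥0∞}
    (h0 : stdGaussian (EuclideanSpace ℝ ι) U ≤ η)
    (h1 : stdGaussian (EuclideanSpace ℝ ι) {ω | ω + b ∈ U} ≤ η) :
    ∫⁻ ω in U, ENNReal.ofReal (mixDensity q b ω) ∂stdGaussian (EuclideanSpace ℝ ι) ≤ η := by
  have h := lintegral_mul_mixDensity hq0 hq1 b (f := U.indicator 1) (measurable_one.indicator hU)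
  have h2 : ∫⁻ ω, U.indicator 1 (ω + b) ∂stdGaussian (EuclideanSpace ℝ ι) =
      stdGaussian (EuclideanSpace ℝ ι) {ω | ω + b ∈ U} :=
    lintegral_indicator_one (measurableSet_preimage (measurable_add_const b) hU)
  rw [h2, lintegral_indicator_one hU] at h
  rw [← lintegral_indicator hU]
  have h3 : ∀ ω, U.indicator (fun ω => ENNReal.ofReal (mixDensity q b ω)) ω =
      U.indicator 1 ω * ENNReal.ofReal (mixDensity q b ω) := fun ω => by
    by_cases hω : ω ∈ U <;> simp [hω]
  simp_rw [h3]
  rw [h]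
  calc _ ≤ ENNReal.ofReal (1 - q) * η + ENNReal.ofReal q * η := by gcongr
    _ = η := by
      rw [← add_mul, ← ENNReal.ofReal_add (by linarith) hq0]
      simp

/-- A convex majorant of the relative quadratic deviation of two mixtures: it bounds
`(x - y)² / (1 - q + q y)`, where `x` and `y` are the densities of the translates. -/
def quadDev (q : ℝ) (b b' ω : EuclideanSpace ℝ ι) : ℝ :=
  (1 - q) * (shiftDensity b ω - shiftDensity b' ω) ^ 2 +
    q * ((shiftDensity b ω - shiftDensity b' ω) ^ 2 / shiftDensity b' ω)

theorem sq_sub_mixDensity_div_le {q : ℝ} (hq0 : 0 ≤ q) (hq1 : q ≤ 1)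
    (b b' ω : EuclideanSpace ℝ ι) :
    (mixDensity q b ω - mixDensity q b' ω) ^ 2 / mixDensity q b' ω ≤
      q ^ 2 * quadDev q b b' ω := by
  have hy := shiftDensity_pos b' ω
  have hQ := mixDensity_pos hq0 hq1 b' ω
  have h1 : mixDensity q b ω - mixDensity q b' ω =
      q * (shiftDensity b ω - shiftDensity b' ω) := by unfold mixDensity; ring
  rw [h1, mul_pow, mul_div_assoc]
  refine mul_le_mul_of_nonneg_left ?_ (sq_nonneg q)
  have h2 : 1 / mixDensity q b' ω ≤ 1 - q + q / shiftDensity b' ω := by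
    rw [div_le_iff₀ hQ]
    unfold mixDensity
    set y := shiftDensity b' ω
    have h3 : (1 - q + q / y) * (1 - q + q * y) - 1 = q * (1 - q) * (y - 1) ^ 2 / y := by
      field_simp; ring
    have h4 : 0 ≤ q * (1 - q) * (y - 1) ^ 2 / y := by
      have : 0 ≤ 1 - q := by linarith
      positivity
    linarith
  calc _ = (shiftDensity b ω - shiftDensity b' ω) ^ 2 * (1 / mixDensity q b' ω) := by ring
    _ ≤ (shiftDensity b ω - shiftDensity b' ω) ^ 2 * (1 - q + q / shiftDensity b' ω) := by gcongr
    _ = _ := by unfold quadDev; ring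

theorem quadDev_eq (q : ℝ) (b b' ω : EuclideanSpace ℝ ι) :
    quadDev q b b' ω =
      (1 - q) * (Real.exp (inner ℝ ((2 : ℝ) • b) ω - ‖b‖ ^ 2) +
        Real.exp (inner ℝ ((2 : ℝ) • b') ω - ‖b'‖ ^ 2) -
        2 * Real.exp (inner ℝ (b + b') ω - (‖b‖ ^ 2 + ‖b'‖ ^ 2) / 2)) +
      q * (Real.exp (inner ℝ ((2 : ℝ) • b - b') ω - (‖b‖ ^ 2 - ‖b'‖ ^ 2 / 2)) -
        2 * shiftDensity b ω + shiftDensity b' ω) := by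
  have hx2 : Real.exp (inner ℝ ((2 : ℝ) • b) ω - ‖b‖ ^ 2) = shiftDensity b ω ^ 2 := by
    rw [shiftDensity, ← Real.exp_nat_mul, real_inner_smul_left]; congr 1; push_cast; ring
  have hy2 : Real.exp (inner ℝ ((2 : ℝ) • b') ω - ‖b'‖ ^ 2) = shiftDensity b' ω ^ 2 := by
    rw [shiftDensity, ← Real.exp_nat_mul, real_inner_smul_left]; congr 1; push_cast; ring
  have hxy : Real.exp (inner ℝ (b + b') ω - (‖b‖ ^ 2 + ‖b'‖ ^ 2) / 2) =
      shiftDensity b ω * shiftDensity b' ω := by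
    rw [shiftDensity, shiftDensity, ← Real.exp_add, inner_add_left]; congr 1; ring
  have hz : Real.exp (inner ℝ ((2 : ℝ) • b - b') ω - (‖b‖ ^ 2 - ‖b'‖ ^ 2 / 2)) =
      shiftDensity b ω ^ 2 / shiftDensity b' ω := by
    rw [shiftDensity, shiftDensity, ← Real.exp_nat_mul, ← Real.exp_sub, inner_sub_left,
      real_inner_smul_left]
    congr 1; push_cast; ring
  rw [hx2, hy2, hxy, hz, quadDev]
  have := (shiftDensity_pos b' ω).ne'
  field_simp
  ring

theorem integrable_quadDev (q : ℝ) (b b' : EuclideanSpace ℝ ι) :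
    Integrable (quadDev q b b') (stdGaussian (EuclideanSpace ℝ ι)) := by
  have : quadDev q b b' = fun ω => _ := funext fun ω => quadDev_eq q b b' ω
  rw [this]
  refine Integrable.add (Integrable.const_mul (Integrable.sub (Integrable.add ?_ ?_) ?_) _)
    (Integrable.const_mul (Integrable.add (Integrable.sub ?_ ?_) ?_) _)
  · exact integrable_exp_inner_sub _ _
  · exact integrable_exp_inner_sub _ _
  · exact (integrable_exp_inner_sub _ _).const_mul 2
  · exact integrable_exp_inner_sub _ _
  · exact (integrable_shiftDensity b).const_mul 2
  · exact integrable_shiftDensity b'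

theorem integral_quadDev_le {q m : ℝ} (hq0 : 0 ≤ q) (hq1 : q ≤ 1) {b b' : EuclideanSpace ℝ ι}
    (hb : ‖b‖ ^ 2 ≤ m) (hb' : ‖b'‖ ^ 2 ≤ m) (hbb : ‖b - b'‖ ^ 2 ≤ m) :
    ∫ ω, quadDev q b b' ω ∂stdGaussian (EuclideanSpace ℝ ι) ≤ 2 * (Real.exp m - 1) := by
  have hs : ‖b - b'‖ ^ 2 = ‖b‖ ^ 2 - 2 * inner ℝ b b' + ‖b'‖ ^ 2 := norm_sub_sq_real b b'
  have i1 := fun (c : EuclideanSpace ℝ ι) (s : ℝ) => integrable_exp_inner_sub c s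
  have hval : ∫ ω, quadDev q b b' ω ∂stdGaussian (EuclideanSpace ℝ ι) =
      (1 - q) * (Real.exp (‖b‖ ^ 2) + Real.exp (‖b'‖ ^ 2) - 2 * Real.exp (inner ℝ b b')) +
        q * (Real.exp (‖b - b'‖ ^ 2) - 1) := by
    simp_rw [quadDev_eq]
    rw [integral_add, integral_const_mul, integral_const_mul, integral_sub, integral_add,
      integral_const_mul, integral_add, integral_sub, integral_const_mul, integral_shiftDensity,
      integral_shiftDensity, integral_exp_inner_sub, integral_exp_inner_sub,
      integral_exp_inner_sub, integral_exp_inner_sub]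
    · have e1 : ‖(2 : ℝ) • b‖ ^ 2 / 2 - ‖b‖ ^ 2 = ‖b‖ ^ 2 := by
        rw [norm_smul, mul_pow]; norm_num; ring
      have e2 : ‖(2 : ℝ) • b'‖ ^ 2 / 2 - ‖b'‖ ^ 2 = ‖b'‖ ^ 2 := by
        rw [norm_smul, mul_pow]; norm_num; ring
      have e3 : ‖b + b'‖ ^ 2 / 2 - (‖b‖ ^ 2 + ‖b'‖ ^ 2) / 2 = inner ℝ b b' := by
        rw [norm_add_sq_real]; ring
      have e4 : ‖(2 : ℝ) • b - b'‖ ^ 2 / 2 - (‖b‖ ^ 2 - ‖b'‖ ^ 2 / 2) = ‖b - b'‖ ^ 2 := by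
        rw [norm_sub_sq_real, norm_sub_sq_real, norm_smul, mul_pow, real_inner_smul_left]
        norm_num; ring
      rw [e1, e2, e3, e4]
      ring
    · exact i1 _ _
    · exact (integrable_shiftDensity b).const_mul 2
    · exact (i1 _ _).sub ((integrable_shiftDensity b).const_mul 2)
    · exact integrable_shiftDensity b'
    · exact i1 _ _
    · exact i1 _ _
    · exact (i1 _ _).add (i1 _ _)
    · exact (i1 _ _).const_mul 2
    · exact (((i1 _ _).add (i1 _ _)).sub ((i1 _ _).const_mul 2)).const_mul _
    · exact (((i1 _ _).sub ((integrable_shiftDensity b).const_mul 2)).add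
        (integrable_shiftDensity b')).const_mul _
  have hm0 : 0 ≤ m := (sq_nonneg _).trans hb
  have h2 : Real.exp (‖b - b'‖ ^ 2) - 1 ≤ 2 * (Real.exp m - 1) := by
    have := Real.exp_le_exp.2 hbb
    have := Real.one_le_exp hm0
    linarith
  have h1 : Real.exp (‖b‖ ^ 2) + Real.exp (‖b'‖ ^ 2) - 2 * Real.exp (inner ℝ b b') ≤
      2 * (Real.exp m - 1) := by
    set A := Real.exp (‖b‖ ^ 2 / 2) with hA
    set B := Real.exp (‖b'‖ ^ 2 / 2) with hB
    set R := Real.exp (m / 2) with hR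
    have hA1 : 1 ≤ A := Real.one_le_exp (by positivity)
    have hB1 : 1 ≤ B := Real.one_le_exp (by positivity)
    have hAR : A ≤ R := Real.exp_le_exp.2 (by linarith)
    have hBR : B ≤ R := Real.exp_le_exp.2 (by linarith)
    have eA : Real.exp (‖b‖ ^ 2) = A ^ 2 := by rw [hA, ← Real.exp_nat_mul]; congr 1; push_cast; ring
    have eB : Real.exp (‖b'‖ ^ 2) = B ^ 2 := by
      rw [hB, ← Real.exp_nat_mul]; congr 1; push_cast; ring
    have eR : Real.exp m = R ^ 2 := by rw [hR, ← Real.exp_nat_mul]; congr 1; push_cast; ring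
    have hR0 : 0 < R := Real.exp_pos _
    have hc : A * B / R ≤ Real.exp (inner ℝ b b') := by
      rw [hA, hB, hR, ← Real.exp_add, ← Real.exp_sub]
      exact Real.exp_le_exp.2 (by linarith)
    have h3 : A ^ 2 - 2 * (A * B / R) ≤ R ^ 2 - 2 * B := by
      have h4 : A * B / R = A * (B / R) := by ring
      have h5 : B = R * (B / R) := by field_simp
      have h6 : B / R ≤ 1 := (div_le_one hR0).2 hBR
      rw [h4]
      nlinarith
    rw [eA, eB, eR]
    nlinarith
  rw [hval]
  have := mul_le_mul_of_nonneg_left h1 (sub_nonneg.2 hq1)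
  have := mul_le_mul_of_nonneg_left h2 hq0
  linarith

end Mixture

/-! ### Moments of the density ratio of two mixtures -/

theorem mul_div_rpow_le_of_le {p g l : ℝ} (hl : 0 < l) (hg : 0 < g) (hgp : g ≤ p) :
    p * (p / g) ^ l ≤ g + (1 + l) * (p - g) + (1 + 1 / l) * (g * expRem (l * (p - g) / g)) := by
  have hr : 0 < p / g := by have := hg.trans_le hgp; positivity
  have h := one_add_rpow_le_of_nonneg (v := (p - g) / g) hl (div_nonneg (by linarith) hg.le)
  have e : 1 + (p - g) / g = p / g := by field_simp; ring
  rw [e, Real.rpow_add hr, Real.rpow_one, ← mul_div_assoc] at h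
  have h2 := mul_le_mul_of_nonneg_left h hg.le
  calc p * (p / g) ^ l = g * (p / g * (p / g) ^ l) := by field_simp
    _ ≤ _ := h2
    _ = _ := by field_simp

theorem mul_div_rpow_le_of_ge {p g l : ℝ} (hl : 1 ≤ l) (hp : 0 < p) (hpg : p ≤ g) :
    p * (p / g) ^ l ≤ g + (1 + l) * (p - g) + l * (l + 1) / 2 * ((p - g) ^ 2 / g) := by
  have hg := hp.trans_le hpg
  have hr : 0 < p / g := by positivity
  have e : 1 + (p - g) / g = p / g := by field_simp; ring
  have h := one_add_rpow_le_of_nonpos (v := (p - g) / g) hl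
    (div_nonpos_of_nonpos_of_nonneg (by linarith) hg.le) (by linarith)
  rw [e, Real.rpow_add hr, Real.rpow_one] at h
  have h2 := mul_le_mul_of_nonneg_left h hg.le
  calc p * (p / g) ^ l = g * (p / g * (p / g) ^ l) := by field_simp
    _ ≤ _ := h2
    _ = _ := by field_simp

section Mixture

variable {ι : Type*} [Fintype ι]

theorem integrable_expRem_inner (c : ℝ) (b : EuclideanSpace ℝ ι) :
    Integrable (fun ω => expRem (c * inner ℝ b ω)) (stdGaussian (EuclideanSpace ℝ ι)) := by
  have h : (fun ω => expRem (c * inner ℝ b ω)) =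
      fun ω => Real.exp (inner ℝ (c • b) ω) - 1 - inner ℝ (c • b) ω := by
    ext ω; rw [real_inner_smul_left]; rfl
  rw [h]
  exact ((integrable_exp_inner_stdGaussian _).sub (integrable_const _)).sub
    (integrable_inner_stdGaussian _)

theorem integral_expRem_inner (c : ℝ) (b : EuclideanSpace ℝ ι) :
    ∫ ω, expRem (c * inner ℝ b ω) ∂stdGaussian (EuclideanSpace ℝ ι) =
      Real.exp (c ^ 2 * ‖b‖ ^ 2 / 2) - 1 := by
  have h : (fun ω => expRem (c * inner ℝ b ω)) =
      fun ω => Real.exp (inner ℝ (c • b) ω) - 1 - inner ℝ (c • b) ω := by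
    ext ω; rw [real_inner_smul_left]; rfl
  rw [h, integral_sub, integral_sub (integrable_exp_inner_stdGaussian _) (integrable_const _),
    integral_exp_inner_stdGaussian, integral_inner_stdGaussian, norm_smul, mul_pow,
    Real.norm_eq_abs, sq_abs]
  · simp
  · exact (integrable_exp_inner_stdGaussian _).sub (integrable_const _)
  · exact integrable_inner_stdGaussian _

theorem measurable_expRem : Measurable expRem := by unfold expRem; fun_prop

theorem lintegral_shiftDensity_mul_expRem (c : ℝ) (b b' : EuclideanSpace ℝ ι) :
    ∫⁻ ω, ENNReal.ofReal (shiftDensity b' ω * expRem (c * inner ℝ b (ω - b')))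
        ∂stdGaussian (EuclideanSpace ℝ ι) =
      ENNReal.ofReal (Real.exp (c ^ 2 * ‖b‖ ^ 2 / 2) - 1) := by
  have hm : Measurable fun ω => ENNReal.ofReal (expRem (c * inner ℝ b (ω - b'))) := by
    have := measurable_expRem
    fun_prop
  have h := lintegral_stdGaussian_add b' hm
  simp only [add_sub_cancel_right] at h
  rw [← ofReal_integral_eq_lintegral_ofReal (integrable_expRem_inner c b)
    (Filter.Eventually.of_forall fun _ => expRem_nonneg _), integral_expRem_inner] at h
  rw [h]
  refine lintegral_congr fun ω => ?_
  rw [mul_comm, ENNReal.ofReal_mul (expRem_nonneg _)]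
  rfl

theorem integrable_shiftDensity_mul_expRem (c : ℝ) (b b' : EuclideanSpace ℝ ι) :
    Integrable (fun ω => shiftDensity b' ω * expRem (c * inner ℝ b (ω - b')))
      (stdGaussian (EuclideanSpace ℝ ι)) := by
  have := measurable_expRem
  refine ⟨by fun_prop, ?_⟩
  rw [hasFiniteIntegral_iff_ofReal (Filter.Eventually.of_forall fun ω =>
    mul_nonneg (shiftDensity_pos b' ω).le (expRem_nonneg _)), lintegral_shiftDensity_mul_expRem]
  exact ENNReal.ofReal_lt_top

theorem integral_shiftDensity_mul_expRem (c : ℝ) (b b' : EuclideanSpace ℝ ι) :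
    ∫ ω, shiftDensity b' ω * expRem (c * inner ℝ b (ω - b')) ∂stdGaussian (EuclideanSpace ℝ ι) =
      Real.exp (c ^ 2 * ‖b‖ ^ 2 / 2) - 1 := by
  rw [integral_eq_lintegral_of_nonneg_ae (Filter.Eventually.of_forall fun ω =>
    mul_nonneg (shiftDensity_pos b' ω).le (expRem_nonneg _))
    (integrable_shiftDensity_mul_expRem c b b').1, lintegral_shiftDensity_mul_expRem,
    ENNReal.toReal_ofReal (sub_nonneg.2 (Real.one_le_exp (by positivity)))]

/-- The set on which the privacy loss may be large: there the log-density ratio of the translate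
by `b` exceeds `s`, relative to the translate by `b'` or, where that is relevant, relative to the
untranslated measure. -/
def largeLossSet (s : ℝ) (b b' : EuclideanSpace ℝ ι) : Set (EuclideanSpace ℝ ι) :=
  {ω | s + ‖b‖ ^ 2 / 2 < inner ℝ b ω ∧ shiftDensity b' ω ≤ shiftDensity b ω} ∪
    {ω | s + (‖b‖ ^ 2 - ‖b'‖ ^ 2) / 2 < inner ℝ (b - b') ω}

theorem measurableSet_largeLossSet (s : ℝ) (b b' : EuclideanSpace ℝ ι) :
    MeasurableSet (largeLossSet s b b') := by
  refine MeasurableSet.union (MeasurableSet.inter ?_ ?_) ?_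
  · exact measurableSet_lt (g := fun ω => inner ℝ b ω) measurable_const (by fun_prop)
  · exact measurableSet_le (measurable_shiftDensity b') (measurable_shiftDensity b)
  · exact measurableSet_lt measurable_const (by fun_prop)

theorem setLIntegral_largeLossSet_le {q m s : ℝ} (hq0 : 0 ≤ q) (hq1 : q ≤ 1)
    {b b' : EuclideanSpace ℝ ι} (hb : ‖b‖ ^ 2 ≤ m) (hb' : ‖b'‖ ^ 2 ≤ m)
    (hbb : ‖b - b'‖ ^ 2 ≤ m) (hs : m / 2 < s) :
    ∫⁻ ω in largeLossSet s b b', ENNReal.ofReal (mixDensity q b ω)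
        ∂stdGaussian (EuclideanSpace ℝ ι) ≤
      ENNReal.ofReal (Real.exp (-((s - m / 2) ^ 2 / (2 * m)))) := by
  have hsub : ‖b - b'‖ ^ 2 = ‖b‖ ^ 2 - 2 * inner ℝ b b' + ‖b'‖ ^ 2 := norm_sub_sq_real b b'
  have hpos : 0 < s - m / 2 := by linarith
  have hn : 0 ≤ ‖b‖ ^ 2 := sq_nonneg _
  set η := ENNReal.ofReal (Real.exp (-((s - m / 2) ^ 2 / (2 * m))) / 2) with hη
  have t1 := stdGaussian_inner_gt_le hb hpos
  have t2 := stdGaussian_inner_gt_le hbb hpos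
  have h1 : ∫⁻ ω in {ω | s + ‖b‖ ^ 2 / 2 < inner ℝ b ω}, ENNReal.ofReal (mixDensity q b ω)
      ∂stdGaussian (EuclideanSpace ℝ ι) ≤ η := by
    refine setLIntegral_mixDensity_le hq0 hq1 b
      (measurableSet_lt measurable_const (by fun_prop))
      ((measure_mono fun ω hω => ?_).trans t1) ((measure_mono fun ω hω => ?_).trans t1)
    · simp only [Set.mem_ofPred_eq] at hω ⊢
      linarith
    · simp only [Set.mem_ofPred_eq, inner_add_right, real_inner_self_eq_norm_sq] at hω ⊢
      linarith
  have h2 : ∫⁻ ω in {ω | s + (‖b‖ ^ 2 - ‖b'‖ ^ 2) / 2 < inner ℝ (b - b') ω},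
      ENNReal.ofReal (mixDensity q b ω) ∂stdGaussian (EuclideanSpace ℝ ι) ≤ η := by
    refine setLIntegral_mixDensity_le hq0 hq1 b
      (measurableSet_lt measurable_const (by fun_prop))
      ((measure_mono fun ω hω => ?_).trans t2) ((measure_mono fun ω hω => ?_).trans t2)
    · simp only [Set.mem_ofPred_eq] at hω ⊢
      linarith
    · have h3 : inner ℝ (b - b') b = ‖b‖ ^ 2 - inner ℝ b b' := by
        rw [inner_sub_left, real_inner_self_eq_norm_sq, real_inner_comm]
      simp only [Set.mem_ofPred_eq, inner_add_right, h3] at hω ⊢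
      linarith
  refine (lintegral_union_le _ _ _).trans ?_
  calc _ ≤ η + η := add_le_add ((lintegral_mono_set fun ω hω => hω.1).trans h1) h2
    _ = _ := by
      rw [hη, ← ENNReal.ofReal_add (by positivity) (by positivity), add_halves]

/-- The second moment of the density ratio. -/
theorem lintegral_mixDensity_ratio_sq_le {q m : ℝ} (hq0 : 0 ≤ q) (hq1 : q ≤ 1)
    {b b' : EuclideanSpace ℝ ι} (hb : ‖b‖ ^ 2 ≤ m) (hb' : ‖b'‖ ^ 2 ≤ m)
    (hbb : ‖b - b'‖ ^ 2 ≤ m) :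
    ∫⁻ ω, ENNReal.ofReal (mixDensity q b ω * (mixDensity q b ω / mixDensity q b' ω) ^ (1 : ℝ))
        ∂stdGaussian (EuclideanSpace ℝ ι) ≤
      ENNReal.ofReal (1 + 2 * q ^ 2 * (Real.exp m - 1)) := by
  set ν := stdGaussian (EuclideanSpace ℝ ι)
  have hI : Integrable (fun ω => mixDensity q b' ω + 2 * (mixDensity q b ω - mixDensity q b' ω)
      + q ^ 2 * quadDev q b b' ω) ν :=
    ((integrable_mixDensity q b').add (((integrable_mixDensity q b).sub
      (integrable_mixDensity q b')).const_mul 2)).add ((integrable_quadDev q b b').const_mul _)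
  have hpt : ∀ ω, mixDensity q b ω * (mixDensity q b ω / mixDensity q b' ω) ^ (1 : ℝ) ≤
      mixDensity q b' ω + 2 * (mixDensity q b ω - mixDensity q b' ω)
      + q ^ 2 * quadDev q b b' ω := by
    intro ω
    have hg := mixDensity_pos hq0 hq1 b' ω
    have h := sq_sub_mixDensity_div_le hq0 hq1 b b' ω
    rw [Real.rpow_one]
    have e : mixDensity q b ω * (mixDensity q b ω / mixDensity q b' ω) =
        mixDensity q b' ω + 2 * (mixDensity q b ω - mixDensity q b' ω) +
          (mixDensity q b ω - mixDensity q b' ω) ^ 2 / mixDensity q b' ω := by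
      field_simp; ring
    linarith
  refine (lintegral_mono fun ω => ENNReal.ofReal_le_ofReal (hpt ω)).trans ?_
  rw [← ofReal_integral_eq_lintegral_ofReal hI (Filter.Eventually.of_forall fun ω => by
    have h1 := mixDensity_pos hq0 hq1 b ω
    have h2 := mixDensity_pos hq0 hq1 b' ω
    exact le_trans (by positivity) (hpt ω))]
  refine ENNReal.ofReal_le_ofReal ?_
  rw [integral_add, integral_add, integral_const_mul, integral_sub, integral_const_mul,
    integral_mixDensity, integral_mixDensity]
  · have := mul_le_mul_of_nonneg_left (integral_quadDev_le hq0 hq1 hb hb' hbb) (sq_nonneg q)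
    linarith
  · exact integrable_mixDensity q b
  · exact integrable_mixDensity q b'
  · exact integrable_mixDensity q b'
  · exact ((integrable_mixDensity q b).sub (integrable_mixDensity q b')).const_mul 2
  · exact (integrable_mixDensity q b').add (((integrable_mixDensity q b).sub
      (integrable_mixDensity q b')).const_mul 2)
  · exact (integrable_quadDev q b b').const_mul _

/-- Off `largeLossSet s b b'`, where the translate by `b` is the likelier one, the remainder in the
expansion of the density ratio is dominated by remainders of linear functionals: according to
which of the untranslated measure and the translate by `b'` is the likelier one, the mixture in
the denominator is bounded below by that one, and the exponential is bounded by its chord on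
`[0, s]`. -/
theorem mixDensity_mul_expRem_le {q l s : ℝ} (hq0 : 0 ≤ q) (hq1 : q ≤ 1) (hl : 0 < l)
    (hs : 0 < s) {b b' ω : EuclideanSpace ℝ ι} (hω : ω ∉ largeLossSet s b b')
    (hxy : shiftDensity b' ω ≤ shiftDensity b ω) :
    mixDensity q b' ω *
        expRem (l * (mixDensity q b ω - mixDensity q b' ω) / mixDensity q b' ω) ≤
      expRem (l * q * ((Real.exp s - 1) / s) * inner ℝ b ω) +
        shiftDensity b' ω *
          expRem (l * q * ((Real.exp s - 1) / s) * inner ℝ (b - b') (ω - b')) := by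
  have hy := shiftDensity_pos b' ω
  have hE : 0 ≤ (Real.exp s - 1) / s :=
    div_nonneg (sub_nonneg.2 (Real.one_le_exp hs.le)) hs.le
  have hpq : mixDensity q b ω - mixDensity q b' ω =
      q * (shiftDensity b ω - shiftDensity b' ω) := by unfold mixDensity; ring
  simp only [largeLossSet, Set.mem_union, Set.mem_ofPred_eq, not_or, not_and, not_lt] at hω
  have hω1 : inner ℝ b ω ≤ s + ‖b‖ ^ 2 / 2 := by
    by_contra hlt
    exact hω.1 (not_le.1 hlt) hxy
  have hlq : 0 ≤ l * q := by positivity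
  rw [hpq, ← mul_assoc]
  rcases le_total 1 (shiftDensity b' ω) with hy1 | hy1
  · have hL0 : 0 ≤ inner ℝ b ω - ‖b‖ ^ 2 / 2 := Real.one_le_exp_iff.1 (hy1.trans hxy)
    have hch := exp_sub_one_le_chord hL0 (by linarith) hs
    have h1 : shiftDensity b ω - shiftDensity b' ω ≤ (Real.exp s - 1) / s * inner ℝ b ω := by
      have h2 : (Real.exp s - 1) / s * (inner ℝ b ω - ‖b‖ ^ 2 / 2) ≤
          (Real.exp s - 1) / s * inner ℝ b ω := by
        gcongr; linarith [sq_nonneg ‖b‖]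
      have h3 : shiftDensity b ω = Real.exp (inner ℝ b ω - ‖b‖ ^ 2 / 2) := rfl
      linarith
    have hQ : 1 ≤ mixDensity q b' ω := by unfold mixDensity; nlinarith
    have h := mul_expRem_div_le (s := 1) one_pos hQ
      (c := l * q * (shiftDensity b ω - shiftDensity b' ω))
      (c' := l * q * ((Real.exp s - 1) / s) * inner ℝ b ω)
      (mul_nonneg hlq (by linarith))
      (by rw [mul_assoc (l * q)]; exact mul_le_mul_of_nonneg_left h1 hlq)
    rw [div_one, one_mul] at h
    have := mul_nonneg hy.le (expRem_nonneg
      (l * q * ((Real.exp s - 1) / s) * inner ℝ (b - b') (ω - b')))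
    linarith
  · have hsub : ‖b - b'‖ ^ 2 = ‖b‖ ^ 2 - 2 * inner ℝ b b' + ‖b'‖ ^ 2 := norm_sub_sq_real b b'
    have hin : inner ℝ (b - b') (ω - b') =
        inner ℝ b ω - inner ℝ b' ω - inner ℝ b b' + ‖b'‖ ^ 2 := by
      rw [inner_sub_right, inner_sub_left, inner_sub_left, real_inner_self_eq_norm_sq]; ring
    have hω2 := hω.2
    rw [inner_sub_left] at hω2
    set Z := inner ℝ b ω - inner ℝ b' ω - (‖b‖ ^ 2 - ‖b'‖ ^ 2) / 2 with hZ
    have hz : shiftDensity b ω = shiftDensity b' ω * Real.exp Z := by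
      unfold shiftDensity
      rw [← Real.exp_add]; congr 1; rw [hZ]; ring
    have hZ0 : 0 ≤ Z := by
      rw [hz] at hxy
      exact Real.one_le_exp_iff.1 (le_of_mul_le_mul_left (by linarith) hy)
    have hch := exp_sub_one_le_chord hZ0 (by rw [hZ]; linarith) hs
    have h1 : shiftDensity b ω - shiftDensity b' ω ≤
        shiftDensity b' ω * ((Real.exp s - 1) / s * inner ℝ (b - b') (ω - b')) := by
      have h2 : (Real.exp s - 1) / s * Z ≤
          (Real.exp s - 1) / s * inner ℝ (b - b') (ω - b') := by
        refine mul_le_mul_of_nonneg_left ?_ hE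
        rw [hin, hZ]
        linarith [sq_nonneg ‖b - b'‖]
      have h3 := mul_le_mul_of_nonneg_left (hch.trans h2) hy.le
      rw [hz]
      linarith
    have hQ : shiftDensity b' ω ≤ mixDensity q b' ω := by unfold mixDensity; nlinarith
    have h := mul_expRem_div_le hy hQ
      (c := l * q * (shiftDensity b ω - shiftDensity b' ω))
      (c' := l * q * (shiftDensity b' ω * ((Real.exp s - 1) / s * inner ℝ (b - b') (ω - b'))))
      (mul_nonneg hlq (by linarith)) (mul_le_mul_of_nonneg_left h1 hlq)
    have e : l * q * (shiftDensity b' ω * ((Real.exp s - 1) / s * inner ℝ (b - b') (ω - b'))) /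
        shiftDensity b' ω = l * q * ((Real.exp s - 1) / s) * inner ℝ (b - b') (ω - b') := by
      field_simp
    rw [e] at h
    have := expRem_nonneg (l * q * ((Real.exp s - 1) / s) * inner ℝ b ω)
    linarith

/-- Higher moments of the density ratio, truncated to the complement of `largeLossSet`. -/
theorem setLIntegral_mixDensity_ratio_rpow_le {q m l s : ℝ} (hq0 : 0 ≤ q) (hq1 : q ≤ 1)
    (hl : 1 ≤ l) (hs : 0 < s) {b b' : EuclideanSpace ℝ ι} (hb : ‖b‖ ^ 2 ≤ m)
    (hb' : ‖b'‖ ^ 2 ≤ m) (hbb : ‖b - b'‖ ^ 2 ≤ m) :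
    ∫⁻ ω in (largeLossSet s b b')ᶜ,
        ENNReal.ofReal (mixDensity q b ω * (mixDensity q b ω / mixDensity q b' ω) ^ l)
        ∂stdGaussian (EuclideanSpace ℝ ι) ≤
      ENNReal.ofReal (1 + 2 * (1 + 1 / l) *
        (Real.exp ((l * q * ((Real.exp s - 1) / s)) ^ 2 * m / 2) - 1) +
        l * (l + 1) * q ^ 2 * (Real.exp m - 1)) := by
  set ν := stdGaussian (EuclideanSpace ℝ ι)
  set κ := l * q * ((Real.exp s - 1) / s)
  have hl0 : 0 < l := by linarith
  set J : EuclideanSpace ℝ ι → ℝ := fun ω => expRem (κ * inner ℝ b ω) +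
    shiftDensity b' ω * expRem (κ * inner ℝ (b - b') (ω - b')) with hJ
  have hJ0 : ∀ ω, 0 ≤ J ω := fun ω =>
    add_nonneg (expRem_nonneg _) (mul_nonneg (shiftDensity_pos b' ω).le (expRem_nonneg _))
  have hJI : Integrable J ν :=
    (integrable_expRem_inner κ b).add (integrable_shiftDensity_mul_expRem κ (b - b') b')
  have hJint : ∫ ω, J ω ∂ν ≤ 2 * (Real.exp (κ ^ 2 * m / 2) - 1) := by
    rw [hJ, integral_add (integrable_expRem_inner κ b)
      (integrable_shiftDensity_mul_expRem κ (b - b') b'), integral_expRem_inner,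
      integral_shiftDensity_mul_expRem]
    have h1 : Real.exp (κ ^ 2 * ‖b‖ ^ 2 / 2) ≤ Real.exp (κ ^ 2 * m / 2) := by gcongr
    have h2 : Real.exp (κ ^ 2 * ‖b - b'‖ ^ 2 / 2) ≤ Real.exp (κ ^ 2 * m / 2) := by gcongr
    linarith
  set R : EuclideanSpace ℝ ι → ℝ := fun ω => mixDensity q b' ω +
    (1 + l) * (mixDensity q b ω - mixDensity q b' ω) + (1 + 1 / l) * J ω +
    l * (l + 1) / 2 * (q ^ 2 * quadDev q b b' ω) with hR
  have hD0 : ∀ ω, 0 ≤ q ^ 2 * quadDev q b b' ω := fun ω =>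
    le_trans (div_nonneg (sq_nonneg _) (mixDensity_pos hq0 hq1 b' ω).le)
      (sq_sub_mixDensity_div_le hq0 hq1 b b' ω)
  have hpq : ∀ ω, mixDensity q b ω - mixDensity q b' ω =
      q * (shiftDensity b ω - shiftDensity b' ω) := fun ω => by unfold mixDensity; ring
  have h1l : 0 ≤ 1 + 1 / l := by positivity
  have hl2 : 0 ≤ l * (l + 1) / 2 := by positivity
  have hgood : ∀ ω, ω ∉ largeLossSet s b b' →
      mixDensity q b ω * (mixDensity q b ω / mixDensity q b' ω) ^ l ≤ R ω := by
    intro ω hω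
    have hg := mixDensity_pos hq0 hq1 b' ω
    rcases le_total (shiftDensity b' ω) (shiftDensity b ω) with hxy | hxy
    · have hgp : mixDensity q b' ω ≤ mixDensity q b ω := by unfold mixDensity; gcongr
      have h1 := mul_div_rpow_le_of_le hl0 hg hgp
      have h2 := mul_le_mul_of_nonneg_left
        (mixDensity_mul_expRem_le hq0 hq1 hl0 hs hω hxy) h1l
      have h3 := mul_nonneg hl2 (hD0 ω)
      simp only [hR, hJ]
      linarith
    · have hgp : mixDensity q b ω ≤ mixDensity q b' ω := by unfold mixDensity; gcongr
      have h1 := mul_div_rpow_le_of_ge hl (mixDensity_pos hq0 hq1 b ω) hgp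
      have h2 := mul_le_mul_of_nonneg_left (sq_sub_mixDensity_div_le hq0 hq1 b b' ω) hl2
      have h3 := mul_nonneg h1l (hJ0 ω)
      simp only [hR]
      linarith
  have hR0 : ∀ ω, 0 ≤ R ω := by
    intro ω
    have hg := mixDensity_pos hq0 hq1 b' ω
    have hp := mixDensity_pos hq0 hq1 b ω
    by_cases hω : ω ∈ largeLossSet s b b'
    · -- on the large-loss set the translate by `b` is the likelier one
      have hxy : shiftDensity b' ω ≤ shiftDensity b ω := by
        rcases hω with hω | hω
        · exact hω.2
        · simp only [Set.mem_ofPred_eq, inner_sub_left] at hω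
          exact Real.exp_le_exp.2 (by linarith)
      have hgp : mixDensity q b' ω ≤ mixDensity q b ω := by unfold mixDensity; gcongr
      have h1 : 0 ≤ (1 + l) * (mixDensity q b ω - mixDensity q b' ω) :=
        mul_nonneg (by linarith) (by linarith)
      have h2 := mul_nonneg hl2 (hD0 ω)
      have h3 := mul_nonneg h1l (hJ0 ω)
      simp only [hR]
      linarith
    · exact le_trans (by positivity) (hgood ω hω)
  have i1 := integrable_mixDensity q b
  have i2 := integrable_mixDensity q b'
  have i3 := integrable_quadDev q b b'
  have hRI : Integrable R ν :=
    ((i2.add ((i1.sub i2).const_mul _)).add (hJI.const_mul _)).add ((i3.const_mul _).const_mul _)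
  have hRint : ∫ ω, R ω ∂ν ≤ 1 + 2 * (1 + 1 / l) * (Real.exp (κ ^ 2 * m / 2) - 1) +
      l * (l + 1) * q ^ 2 * (Real.exp m - 1) := by
    rw [hR, integral_add, integral_add, integral_add, integral_const_mul, integral_const_mul,
      integral_const_mul, integral_const_mul, integral_sub i1 i2, integral_mixDensity,
      integral_mixDensity]
    · have h1 := mul_le_mul_of_nonneg_left hJint h1l
      have h2 := mul_le_mul_of_nonneg_left (mul_le_mul_of_nonneg_left
        (integral_quadDev_le hq0 hq1 hb hb' hbb) (sq_nonneg q)) hl2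
      linarith
    · exact i2
    · exact (i1.sub i2).const_mul _
    · exact i2.add ((i1.sub i2).const_mul _)
    · exact hJI.const_mul _
    · exact (i2.add ((i1.sub i2).const_mul _)).add (hJI.const_mul _)
    · exact (i3.const_mul _).const_mul _
  calc _ ≤ ∫⁻ ω in (largeLossSet s b b')ᶜ, ENNReal.ofReal (R ω) ∂ν :=
        setLIntegral_mono' (measurableSet_largeLossSet s b b').compl
          fun ω hω => ENNReal.ofReal_le_ofReal (hgood ω hω)
    _ ≤ ∫⁻ ω, ENNReal.ofReal (R ω) ∂ν := setLIntegral_le_lintegral _ _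
    _ = ENNReal.ofReal (∫ ω, R ω ∂ν) :=
        (ofReal_integral_eq_lintegral_ofReal hRI (Filter.Eventually.of_forall hR0)).symm
    _ ≤ _ := ENNReal.ofReal_le_ofReal hRint

end Mixture

/-! ### Step bounds -/

/-- The law `μ` is close to the law `μ'` for the purposes of composition: an estimate of `h` by
`k`, with the hockey-stick threshold `γ` free and a remainder `γ⁻ˡ c + D`, survives integration
against `μ` and `μ'` at the cost of a factor `M` in the first part of the remainder and a summand
`η` in the second. -/
def IsStepBound {E : Type*} [MeasurableSpace E] (μ μ' : Measure E) (l : ℝ) (M η : ℝ≥0∞) : Prop :=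
  ∀ (c D : ℝ≥0∞) (h k : E → ℝ≥0∞), Measurable h → Measurable k → (∀ ω, h ω ≤ 1) →
    (∀ ω, ∀ γ : ℝ, 0 < γ →
      h ω ≤ ENNReal.ofReal γ * k ω + ENNReal.ofReal (γ ^ (-l)) * c + D) →
    ∀ γ : ℝ, 0 < γ → ∫⁻ ω, h ω ∂μ ≤
      ENNReal.ofReal γ * ∫⁻ ω, k ω ∂μ' + ENNReal.ofReal (γ ^ (-l)) * (M * c) + D + η

theorem IsStepBound.map {E E' : Type*} [MeasurableSpace E] [MeasurableSpace E']
    {μ μ' : Measure E} {l : ℝ} {M η : ℝ≥0∞} (H : IsStepBound μ μ' l M η) {f : E → E'}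
    (hf : Measurable f) : IsStepBound (μ.map f) (μ'.map f) l M η := by
  intro c D h k hh hk h1 hhk γ hγ
  rw [lintegral_map hh hf, lintegral_map hk hf]
  exact H c D (h ∘ f) (k ∘ f) (hh.comp hf) (hk.comp hf) (fun _ => h1 _) (fun _ => hhk _) γ hγ

section Mixture

variable {ι : Type*} [Fintype ι]

/-- The mixture, with weights `1 - q` and `q`, of the standard Gaussian laws centred at `a` and
at `b`. -/
def gaussianMixture (q : ℝ) (a b : EuclideanSpace ℝ ι) :
    Measure (EuclideanSpace ℝ ι) :=
  ENNReal.ofReal (1 - q) • (stdGaussian (EuclideanSpace ℝ ι)).map (· + a) +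
    ENNReal.ofReal q • (stdGaussian (EuclideanSpace ℝ ι)).map (· + b)

theorem lintegral_gaussianMixture {q : ℝ} (hq0 : 0 ≤ q) (hq1 : q ≤ 1) (a b : EuclideanSpace ℝ ι)
    {f : EuclideanSpace ℝ ι → ℝ≥0∞} (hf : Measurable f) :
    ∫⁻ ω, f ω ∂gaussianMixture q a b = ∫⁻ ω, f (ω + a) * ENNReal.ofReal (mixDensity q (b - a) ω)
      ∂stdGaussian (EuclideanSpace ℝ ι) := by
  rw [lintegral_mul_mixDensity hq0 hq1 (b - a) (f := fun ω => f (ω + a)) (by fun_prop),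
    gaussianMixture, lintegral_add_measure, lintegral_smul_measure, lintegral_smul_measure,
    lintegral_map hf (by fun_prop), lintegral_map hf (by fun_prop)]
  simp only [smul_eq_mul, add_assoc, sub_add_cancel]

theorem isStepBound_gaussianMixture_of_moment {q : ℝ} (hq0 : 0 ≤ q) (hq1 : q ≤ 1)
    {a b b' : EuclideanSpace ℝ ι} {l : ℝ} {M η : ℝ≥0∞} {B : Set (EuclideanSpace ℝ ι)}
    (hB : MeasurableSet B)
    (hη : ∫⁻ ω in B, ENNReal.ofReal (mixDensity q (b - a) ω)
      ∂stdGaussian (EuclideanSpace ℝ ι) ≤ η)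
    (hM : ∫⁻ ω in Bᶜ, ENNReal.ofReal (mixDensity q (b - a) ω *
      (mixDensity q (b - a) ω / mixDensity q (b' - a) ω) ^ l)
      ∂stdGaussian (EuclideanSpace ℝ ι) ≤ M) :
    IsStepBound (gaussianMixture q a b) (gaussianMixture q a b') l M η := by
  intro c D h k hh hk h1 hhk γ hγ
  rw [lintegral_gaussianMixture hq0 hq1 _ _ hh, lintegral_gaussianMixture hq0 hq1 _ _ hk]
  exact lintegral_mul_density_le (h := fun ω => h (ω + a)) (k := fun ω => k (ω + a))
    (measurable_mixDensity _ _) (measurable_mixDensity _ _) (mixDensity_pos hq0 hq1 _)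
    (mixDensity_pos hq0 hq1 _) (by fun_prop) (fun _ => h1 _) (fun _ => hhk _) hB.compl
    (lintegral_mixDensity hq0 hq1 _).le (by rwa [compl_compl]) hM hγ

theorem isStepBound_gaussianMixture_one {q m : ℝ} (hq0 : 0 ≤ q) (hq1 : q ≤ 1)
    {a b b' : EuclideanSpace ℝ ι} (hb : ‖b - a‖ ^ 2 ≤ m) (hb' : ‖b' - a‖ ^ 2 ≤ m)
    (hbb : ‖b - b'‖ ^ 2 ≤ m) :
    IsStepBound (gaussianMixture q a b) (gaussianMixture q a b') 1
      (ENNReal.ofReal (1 + 2 * q ^ 2 * (Real.exp m - 1))) 0 := by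
  refine isStepBound_gaussianMixture_of_moment hq0 hq1 (B := ∅) .empty (by simp) ?_
  rw [Set.compl_empty, setLIntegral_univ]
  exact lintegral_mixDensity_ratio_sq_le hq0 hq1 hb hb' (by rwa [sub_sub_sub_cancel_right])

theorem isStepBound_gaussianMixture {q m l s : ℝ} (hq0 : 0 ≤ q) (hq1 : q ≤ 1) (hl : 1 ≤ l)
    (hs : 0 < s) (hms : m / 2 < s) {a b b' : EuclideanSpace ℝ ι} (hb : ‖b - a‖ ^ 2 ≤ m)
    (hb' : ‖b' - a‖ ^ 2 ≤ m) (hbb : ‖b - b'‖ ^ 2 ≤ m) :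
    IsStepBound (gaussianMixture q a b) (gaussianMixture q a b') l
      (ENNReal.ofReal (1 + 2 * (1 + 1 / l) *
        (Real.exp ((l * q * ((Real.exp s - 1) / s)) ^ 2 * m / 2) - 1) +
        l * (l + 1) * q ^ 2 * (Real.exp m - 1)))
      (ENNReal.ofReal (Real.exp (-((s - m / 2) ^ 2 / (2 * m))))) := by
  have hbb' : ‖b - a - (b' - a)‖ ^ 2 ≤ m := by rwa [sub_sub_sub_cancel_right]
  exact isStepBound_gaussianMixture_of_moment hq0 hq1 (measurableSet_largeLossSet s _ _)
    (setLIntegral_largeLossSet_le hq0 hq1 hb hb' hbb' hms)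
    (setLIntegral_mixDensity_ratio_rpow_le hq0 hq1 hl hs hb hb' hbb')

end Mixture

/-! ### Subsampling without replacement -/

section Subsampling

variable {N : ℕ}

/-- Exchange of the elements `i` and `j` in a finite set. -/
def swapSet (i j : Fin N) (S : Finset (Fin N)) : Finset (Fin N) :=
  S.map (Equiv.swap i j).toEmbedding

theorem card_swapSet (i j : Fin N) (S : Finset (Fin N)) : (swapSet i j S).card = S.card :=
  Finset.card_map _

theorem mem_swapSet {i j a : Fin N} {S : Finset (Fin N)} :
    a ∈ swapSet i j S ↔ Equiv.swap i j a ∈ S := by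
  simp only [swapSet, Finset.mem_map_equiv, Equiv.symm_swap]

theorem swapSet_swapSet (i j : Fin N) (S : Finset (Fin N)) :
    swapSet i j (swapSet i j S) = S := by
  ext a
  simp [mem_swapSet]

/-- The pairs `(S, j)` of a set `S` of size `n` that does not contain `i` and an element `j ∈ S`;
the exchange of `j` and `i` turns them into the pairs of a set that contains `i` and an element
outside it. -/
def swapPairs (i : Fin N) (n : ℕ) : Finset (Fin N × Finset (Fin N)) :=
  (Finset.univ ×ˢ Finset.powersetCard n Finset.univ).filter fun p => i ∉ p.2 ∧ p.1 ∈ p.2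

theorem sum_swapPairs_snd (i : Fin N) (n : ℕ) (Φ : Finset (Fin N) → ℝ≥0∞) :
    ∑ p ∈ swapPairs i n, Φ p.2 =
      n * ∑ S ∈ (Finset.powersetCard n Finset.univ).filter (i ∉ ·), Φ S := by
  rw [swapPairs, Finset.sum_filter, Finset.sum_product_right, Finset.mul_sum, Finset.sum_filter]
  refine Finset.sum_congr rfl fun S hS => ?_
  have hc := (Finset.mem_powersetCard.1 hS).2
  by_cases hi : i ∈ S
  · simp [hi]
  · simp [hi, hc]

theorem sum_swapPairs_swapSet (i : Fin N) (n : ℕ) (Φ : Finset (Fin N) → ℝ≥0∞) :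
    ∑ p ∈ swapPairs i n, Φ (swapSet i p.1 p.2) =
      (N - n : ℕ) * ∑ S ∈ (Finset.powersetCard n Finset.univ).filter (i ∈ ·), Φ S := by
  have h : ∑ p ∈ swapPairs i n, Φ (swapSet i p.1 p.2) =
      ∑ p ∈ (Finset.univ ×ˢ Finset.powersetCard n Finset.univ).filter
        (fun p : Fin N × Finset (Fin N) => i ∈ p.2 ∧ p.1 ∉ p.2), Φ p.2 := by
    refine Finset.sum_bij' (fun p _ => (p.1, swapSet i p.1 p.2))
      (fun p _ => (p.1, swapSet i p.1 p.2)) ?_ ?_ ?_ ?_ ?_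
    · rintro ⟨j, S⟩ hp
      simp only [swapPairs, Finset.mem_filter, Finset.mem_product, Finset.mem_univ, true_and,
        Finset.mem_powersetCard_univ] at hp ⊢
      simpa [mem_swapSet, card_swapSet] using ⟨hp.1, hp.2.2, hp.2.1⟩
    · rintro ⟨j, S⟩ hp
      simp only [swapPairs, Finset.mem_filter, Finset.mem_product, Finset.mem_univ, true_and,
        Finset.mem_powersetCard_univ] at hp ⊢
      simpa [mem_swapSet, card_swapSet] using ⟨hp.1, hp.2.2, hp.2.1⟩
    · rintro ⟨j, S⟩ -
      simp [swapSet_swapSet]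
    · rintro ⟨j, S⟩ -
      simp [swapSet_swapSet]
    · rintro ⟨j, S⟩ -
      rfl
  rw [h, Finset.sum_filter, Finset.sum_product_right, Finset.mul_sum, Finset.sum_filter]
  refine Finset.sum_congr rfl fun S hS => ?_
  have hc := (Finset.mem_powersetCard.1 hS).2
  by_cases hi : i ∈ S
  · have hcard : (Finset.univ.filter (· ∉ S)).card = N - n := by
      rw [Finset.filter_notMem_eq_sdiff, Finset.card_univ_sdiff, hc, Fintype.card_fin]
    simp only [hi, true_and, if_true]
    rw [← Finset.sum_filter, Finset.sum_const, hcard, nsmul_eq_mul]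
  · simp [hi]

theorem sum_swapPairs_mixture (i : Fin N) {n : ℕ} (hn : n ≤ N) (Φ : Finset (Fin N) → ℝ≥0∞) :
    N * ∑ p ∈ swapPairs i n, (ENNReal.ofReal (1 - n / N) * Φ p.2 +
        ENNReal.ofReal (n / N) * Φ (swapSet i p.1 p.2)) =
      n * (N - n : ℕ) * ∑ S ∈ Finset.powersetCard n Finset.univ, Φ S := by
  have hN : (0 : ℝ) < N := by exact_mod_cast i.pos
  have e1 : (N : ℝ≥0∞) * ENNReal.ofReal (1 - n / N) = (N - n : ℕ) := by
    rw [← ENNReal.ofReal_natCast N, ← ENNReal.ofReal_mul hN.le, ← ENNReal.ofReal_natCast (N - n),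
      Nat.cast_sub hn]
    congr 1
    field_simp
  have e2 : (N : ℝ≥0∞) * ENNReal.ofReal (n / N) = n := by
    rw [← ENNReal.ofReal_natCast N, ← ENNReal.ofReal_mul hN.le, ← ENNReal.ofReal_natCast n]
    congr 1
    field_simp
  rw [Finset.sum_add_distrib, ← Finset.mul_sum, ← Finset.mul_sum, mul_add, ← mul_assoc,
    ← mul_assoc, e1, e2, sum_swapPairs_snd, sum_swapPairs_swapSet,
    ← Finset.sum_filter_add_sum_filter_not (Finset.powersetCard n Finset.univ) (i ∈ ·) Φ]
  ring

/-- Amplification by subsampling: a step bound for the mixtures of the laws that belong to a set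
without `i` and to the set in which `i` replaces one of its elements gives one for the uniform
mixture over all sets of size `n`. -/
theorem isStepBound_subsampling {E : Type*} [MeasurableSpace E] (i : Fin N) {n : ℕ} (hn0 : 0 < n)
    (hn : n ≤ N) {μ μ' : Finset (Fin N) → Measure E} {l : ℝ} {M η : ℝ≥0∞}
    (hswap : ∀ S : Finset (Fin N), S.card = n → i ∉ S → ∀ j ∈ S,
      IsStepBound
        (ENNReal.ofReal (1 - n / N) • μ S + ENNReal.ofReal (n / N) • μ (swapSet i j S))
        (ENNReal.ofReal (1 - n / N) • μ' S + ENNReal.ofReal (n / N) • μ' (swapSet i j S)) l M η)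
    (huniv : n = N → IsStepBound (μ Finset.univ) (μ' Finset.univ) l M η) :
    IsStepBound
      ((N.choose n : ℝ≥0∞)⁻¹ • ∑ S ∈ Finset.powersetCard n Finset.univ, μ S)
      ((N.choose n : ℝ≥0∞)⁻¹ • ∑ S ∈ Finset.powersetCard n Finset.univ, μ' S) l M η := by
  rcases hn.eq_or_lt with rfl | hlt
  · have h : Finset.powersetCard n (Finset.univ : Finset (Fin n)) = {Finset.univ} := by
      simpa using Finset.powersetCard_self (Finset.univ : Finset (Fin n))
    simpa [h] using huniv rfl
  intro c D h k hh hk h1 hhk γ hγ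
  set R := ENNReal.ofReal (γ ^ (-l)) * (M * c) + D + η with hR
  set Φ : Finset (Fin N) → ℝ≥0∞ := fun S => ∫⁻ ω, h ω ∂μ S with hΦ
  set Ψ : Finset (Fin N) → ℝ≥0∞ := fun S => ∫⁻ ω, k ω ∂μ' S with hΨ
  have hpair : ∀ p ∈ swapPairs i n, ENNReal.ofReal (1 - n / N) * Φ p.2 +
      ENNReal.ofReal (n / N) * Φ (swapSet i p.1 p.2) ≤
      ENNReal.ofReal γ * (ENNReal.ofReal (1 - n / N) * Ψ p.2 +
        ENNReal.ofReal (n / N) * Ψ (swapSet i p.1 p.2)) + R := by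
    rintro ⟨j, S⟩ hp
    simp only [swapPairs, Finset.mem_filter, Finset.mem_product, Finset.mem_univ, true_and,
      Finset.mem_powersetCard_univ] at hp
    have := hswap S hp.1 hp.2.1 j hp.2.2 c D h k hh hk h1 hhk γ hγ
    simpa only [lintegral_add_measure, lintegral_smul_measure, smul_eq_mul, add_assoc, hR, hΦ, hΨ]
      using this
  have hN : (0 : ℝ) < N := by exact_mod_cast i.pos
  have hw : ENNReal.ofReal (1 - n / N) + ENNReal.ofReal (n / N) = 1 := by
    have hle : (n : ℝ) / N ≤ 1 := (div_le_one hN).2 (by exact_mod_cast hn)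
    rw [← ENNReal.ofReal_add (by linarith) (by positivity)]
    simp
  have hone := sum_swapPairs_mixture i hn (fun _ => 1)
  simp only [mul_one, hw, Finset.sum_const, nsmul_eq_mul, Finset.card_powersetCard,
    Finset.card_univ, Fintype.card_fin] at hone
  have hsum : (n * (N - n : ℕ) : ℝ≥0∞) * ∑ S ∈ Finset.powersetCard n Finset.univ, Φ S ≤
      (n * (N - n : ℕ) : ℝ≥0∞) * (ENNReal.ofReal γ * ∑ S ∈ Finset.powersetCard n Finset.univ, Ψ S
        + N.choose n * R) := by
    have hR' : (n * (N - n : ℕ) : ℝ≥0∞) * (N.choose n * R) = N * ((swapPairs i n).card * R) := by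
      rw [← mul_assoc, ← hone, mul_assoc]
    rw [← sum_swapPairs_mixture i hn Φ, mul_add, mul_left_comm _ (ENNReal.ofReal γ),
      ← sum_swapPairs_mixture i hn Ψ, hR', mul_left_comm, ← mul_add]
    gcongr
    refine (Finset.sum_le_sum hpair).trans ?_
    rw [Finset.sum_add_distrib, ← Finset.mul_sum, Finset.sum_const, nsmul_eq_mul]
  have hpos : (n * (N - n : ℕ) : ℝ≥0∞) ≠ 0 := by
    have : N - n ≠ 0 := by omega
    exact mul_ne_zero (by exact_mod_cast hn0.ne') (by exact_mod_cast this)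
  have hfin : (n * (N - n : ℕ) : ℝ≥0∞) ≠ ∞ :=
    ENNReal.mul_ne_top (ENNReal.natCast_ne_top _) (ENNReal.natCast_ne_top _)
  have hsum' := (ENNReal.mul_le_mul_iff_right hpos hfin).1 hsum
  have hC0 : (N.choose n : ℝ≥0∞) ≠ 0 := by exact_mod_cast (Nat.choose_pos hn).ne'
  simp only [lintegral_smul_measure, lintegral_finsetSum_measure, smul_eq_mul]
  calc (N.choose n : ℝ≥0∞)⁻¹ * ∑ S ∈ Finset.powersetCard n Finset.univ, Φ S
      ≤ (N.choose n : ℝ≥0∞)⁻¹ * (ENNReal.ofReal γ *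
          ∑ S ∈ Finset.powersetCard n Finset.univ, Ψ S + N.choose n * R) := by gcongr
    _ = ENNReal.ofReal γ * ((N.choose n : ℝ≥0∞)⁻¹ *
          ∑ S ∈ Finset.powersetCard n Finset.univ, Ψ S) + R := by
        rw [mul_add, ← mul_assoc _ (N.choose n : ℝ≥0∞),
          ENNReal.inv_mul_cancel hC0 (ENNReal.natCast_ne_top _), one_mul, mul_left_comm]
    _ = _ := by rw [hR, add_assoc, add_assoc, add_assoc]

end Subsampling

/-! ### Composition over the iterations -/

namespace SGFSInput

variable {𝒳 : Type*} {d : ℕ} (P : SGFSInput 𝒳 d)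

theorem isProbabilityMeasure_noiseLaw {N : ℕ} (hτ : P.τ ≤ N) (t : ℕ) :
    IsProbabilityMeasure (P.noiseLaw N t) := by
  obtain ⟨S, -, hS⟩ := Finset.exists_subset_card_eq
    (s := (Finset.univ : Finset (Fin N))) (n := P.τ) (by simpa using hτ)
  have := isProbabilityMeasure_uniformOn (s := {S : Finset (Fin N) | S.card = P.τ})
    (Set.toFinite _) ⟨S, hS⟩
  unfold noiseLaw
  infer_instance

/-- The law of the releases of iterations `t, …, t + n - 1` that start in the state `s`. -/
def runLaw {N : ℕ} (X : Fin N → 𝒳) (n t : ℕ) (s : SGFSState d) :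
    Measure (Fin n → SGFSRelease d) :=
  (Measure.pi fun i : Fin n => P.noiseLaw N (i + t)).map (P.run X n t s)

/-- The law of what iteration `t` releases when it starts in the state `s`. -/
def releaseLaw {N : ℕ} (X : Fin N → 𝒳) (t : ℕ) (s : SGFSState d) : Measure (SGFSRelease d) :=
  (P.noiseLaw N t).map (P.release X t s)

/-- The state after iteration `t` is a function of what that iteration releases. -/
def stateOfRelease (t : ℕ) (s : SGFSState d) (r : SGFSRelease d) : SGFSState d :=
  (r.2.2, P.nextInfo t s.2 r.2.1)

theorem measurable_stateOfRelease (t : ℕ) (s : SGFSState d) :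
    Measurable (P.stateOfRelease t s) :=
  measurable_snd.snd.prodMk (P.measurable_nextInfo t measurable_const measurable_snd.fst)

theorem measurable_run_right {N : ℕ} (X : Fin N → 𝒳) (n t : ℕ) (s : SGFSState d) :
    Measurable (P.run X n t s) :=
  (P.measurable_run X n t).comp measurable_prodMk_left

theorem measurable_release_right {N : ℕ} (X : Fin N → 𝒳) (t : ℕ) (s : SGFSState d) :
    Measurable (P.release X t s) :=
  P.measurable_release X t measurable_const measurable_id

theorem measurable_fin_cons {n : ℕ} {α R : Type*} [MeasurableSpace α] [MeasurableSpace R]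
    {f : α → R} {g : α → Fin n → R} (hf : Measurable f) (hg : Measurable g) :
    Measurable fun a => (Fin.cons (f a) (g a) : Fin (n + 1) → R) := by
  refine measurable_pi_lambda _ fun i => ?_
  refine Fin.cases ?_ (fun j => ?_) i
  · exact hf
  · exact (measurable_pi_apply j).comp hg

theorem measurableSet_fin_cons_mem {n : ℕ} {R : Type*} [MeasurableSpace R] (r : R)
    {A : Set (Fin (n + 1) → R)} (hA : MeasurableSet A) :
    MeasurableSet {o : Fin n → R | Fin.cons r o ∈ A} :=
  measurableSet_preimage (measurable_fin_cons measurable_const measurable_id) hA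

theorem measurable_runLaw_cons {N : ℕ} (hτ : P.τ ≤ N) (X : Fin N → 𝒳) (n t : ℕ)
    (s : SGFSState d) {A : Set (Fin (n + 1) → SGFSRelease d)} (hA : MeasurableSet A) :
    Measurable fun r => P.runLaw X n (t + 1) (P.stateOfRelease t s r) {o | Fin.cons r o ∈ A} := by
  have := fun i : Fin n => P.isProbabilityMeasure_noiseLaw hτ (i + (t + 1))
  set B : Set (SGFSRelease d × (Fin n → SGFSNoise N d)) :=
    {p | Fin.cons p.1 (P.run X n (t + 1) (P.stateOfRelease t s p.1) p.2) ∈ A}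
  have hB : MeasurableSet B := by
    refine measurableSet_preimage (measurable_fin_cons measurable_fst ?_) hA
    exact (P.measurable_run X n (t + 1)).comp
      (((P.measurable_stateOfRelease t s).comp measurable_fst).prodMk measurable_snd)
  convert measurable_measure_prodMk_left
    (ν := Measure.pi fun i : Fin n => P.noiseLaw N (i + (t + 1))) hB using 2 with r
  rw [runLaw, Measure.map_apply (P.measurable_run_right X n (t + 1) _)
    (measurableSet_fin_cons_mem _ hA)]
  rfl

theorem runLaw_succ {N : ℕ} (hτ : P.τ ≤ N) (X : Fin N → 𝒳) (n t : ℕ)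
    (s : SGFSState d) {A : Set (Fin (n + 1) → SGFSRelease d)} (hA : MeasurableSet A) :
    P.runLaw X (n + 1) t s A =
      ∫⁻ r, P.runLaw X n (t + 1) (P.stateOfRelease t s r) {o | Fin.cons r o ∈ A}
        ∂P.releaseLaw X t s := by
  have := fun t => P.isProbabilityMeasure_noiseLaw hτ t
  rw [releaseLaw, lintegral_map (P.measurable_runLaw_cons hτ X n t s hA)
    (P.measurable_release_right X t s), runLaw,
    Measure.map_apply (P.measurable_run_right X (n + 1) t s) hA]
  have hmp := measurePreserving_piFinSuccAbove
    (fun i : Fin (n + 1) => P.noiseLaw N (i + t)) 0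
  set B : Set (SGFSNoise N d × (Fin n → SGFSNoise N d)) :=
    {p | Fin.cons (P.release X t s p.1) (P.run X n (t + 1) (P.nextState X t s p.1) p.2) ∈ A}
  have hB : MeasurableSet B := by
    refine measurableSet_preimage (measurable_fin_cons
      ((P.measurable_release_right X t s).comp measurable_fst) ?_) hA
    exact (P.measurable_run X n (t + 1)).comp
      ((P.measurable_nextState X t measurable_const measurable_fst).prodMk measurable_snd)
  have hpre : P.run X (n + 1) t s ⁻¹' A =
      MeasurableEquiv.piFinSuccAbove (fun _ : Fin (n + 1) => SGFSNoise N d) 0 ⁻¹' B := rfl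
  rw [hpre, hmp.measure_preimage hB.nullMeasurableSet, Measure.prod_apply hB]
  have e0 : P.noiseLaw N (((0 : Fin (n + 1)) : ℕ) + t) = P.noiseLaw N t := by simp
  have e1 : (fun j : Fin n => P.noiseLaw N (((Fin.succAbove 0 j : Fin (n + 1)) : ℕ) + t)) =
      fun j : Fin n => P.noiseLaw N (j + (t + 1)) := by
    ext1 j
    rw [Fin.succAbove_zero, Fin.val_succ]
    congr 1
    omega
  rw [e0, e1]
  refine lintegral_congr fun ω => ?_
  rw [runLaw, Measure.map_apply (P.measurable_run_right X n (t + 1) _)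
    (measurableSet_fin_cons_mem _ hA)]
  rfl

/-- Adaptive composition of step bounds. -/
theorem runLaw_le_of_isStepBound {N : ℕ} (hτ : P.τ ≤ N) {X Y : Fin N → 𝒳} {l : ℝ}
    {c M η : ℝ≥0∞}
    (hc : ∀ γ : ℝ, 0 < γ → 1 ≤ ENNReal.ofReal γ + ENNReal.ofReal (γ ^ (-l)) * c)
    (H : ∀ t s, IsStepBound (P.releaseLaw X t s) (P.releaseLaw Y t s) l M η) (n : ℕ) :
    ∀ (t : ℕ) (s : SGFSState d) (A : Set (Fin n → SGFSRelease d)), MeasurableSet A →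
      ∀ γ : ℝ, 0 < γ → P.runLaw X n t s A ≤ ENNReal.ofReal γ * P.runLaw Y n t s A +
        ENNReal.ofReal (γ ^ (-l)) * (M ^ n * c) + n * η := by
  have := fun t => P.isProbabilityMeasure_noiseLaw hτ t
  have hprob : ∀ (Z : Fin N → 𝒳) n t s, IsProbabilityMeasure (P.runLaw Z n t s) := fun Z n t s =>
    Measure.isProbabilityMeasure_map (P.measurable_run_right Z n t s).aemeasurable
  induction n with
  | zero =>
    intro t s A hA γ hγ
    rcases A.eq_empty_or_nonempty with rfl | hne
    · simp
    · have := hprob X 0 t s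
      have := hprob Y 0 t s
      rw [Subsingleton.eq_univ_of_nonempty hne, measure_univ, measure_univ]
      simpa using hc γ hγ
  | succ n ih =>
    intro t s A hA γ hγ
    rw [P.runLaw_succ hτ X n t s hA, P.runLaw_succ hτ Y n t s hA]
    refine (H t s (M ^ n * c) (n * η) _ _ (P.measurable_runLaw_cons hτ X n t s hA)
      (P.measurable_runLaw_cons hτ Y n t s hA) (fun r => ?_) (fun r γ' hγ' => ?_) γ hγ).trans
      (le_of_eq ?_)
    · have := hprob X n (t + 1) (P.stateOfRelease t s r)
      exact prob_le_one
    · exact ih (t + 1) _ _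
        (measurableSet_fin_cons_mem r hA) γ' hγ'
    · push_cast
      ring

end SGFSInput

/-! ### The noise of one iteration -/

theorem pi_gaussianReal_map_const_mul {κ : Type*} [Fintype κ] (c : ℝ) :
    (Measure.pi fun _ : κ => gaussianReal 0 1).map (fun x i => c * x i) =
      Measure.pi fun _ : κ => gaussianReal 0 (c ^ 2).toNNReal := by
  have h : (gaussianReal 0 1).map (fun x => c * x) = gaussianReal 0 (c ^ 2).toNNReal := by
    rw [gaussianReal_map_const_mul]
    congr 1
    · simp
    · ext; simp [sq_nonneg]
  have hp : ∀ _ : κ, IsProbabilityMeasure ((gaussianReal 0 1).map (fun x => c * x)) := fun _ =>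
    Measure.isProbabilityMeasure_map (by fun_prop)
  rw [Measure.pi_map_pi (f := fun _ x => c * x) (fun i => by fun_prop)]
  simp_rw [h]

theorem pi_map_curry {κ κ' : Type*} [Fintype κ] [Fintype κ'] (μ : Measure ℝ)
    [IsProbabilityMeasure μ] :
    (Measure.pi fun _ : κ × κ' => μ).map (fun x i j => x (i, j)) =
      Measure.pi fun _ : κ => Measure.pi fun _ : κ' => μ := by
  have h := Measure.infinitePi_map_curry (fun (_ : κ) (_ : κ') => μ)
  simp only [Measure.infinitePi_eq_pi] at h
  exact h

/-- The index set of the coordinates of the noise of one iteration: those of the noise of the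
gradient, followed by those of the noise of the covariance. -/
abbrev NoiseIndex (d : ℕ) : Type := Fin d ⊕ (Fin d × Fin d)

/-- The noise of one iteration with standard deviations `a` and `b`, in terms of a standard
Gaussian vector. -/
def scaledNoise {d : ℕ} (a b : ℝ) (e : EuclideanSpace ℝ (NoiseIndex d)) :
    (Fin d → ℝ) × (Fin d → Fin d → ℝ) :=
  (fun i => a * e (Sum.inl i), fun i j => b * e (Sum.inr (i, j)))

theorem measurable_scaledNoise {d : ℕ} (a b : ℝ) : Measurable (scaledNoise (d := d) a b) := by
  unfold scaledNoise
  fun_prop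

theorem stdGaussian_map_scaledNoise {d : ℕ} (a b : ℝ) :
    (stdGaussian (EuclideanSpace ℝ (NoiseIndex d))).map (scaledNoise a b) =
      (Measure.pi fun _ : Fin d => gaussianReal 0 (a ^ 2).toNNReal).prod
        (Measure.pi fun _ : Fin d => Measure.pi fun _ : Fin d =>
          gaussianReal 0 (b ^ 2).toNNReal) := by
  have hsum := (measurePreserving_sumPiEquivProdPi
    (fun _ : NoiseIndex d => gaussianReal 0 1)).map_eq
  have h1 : (scaledNoise a b ∘ WithLp.toLp 2 : (NoiseIndex d → ℝ) → _) =
      Prod.map (fun x i => a * x i) ((fun x i j => x (i, j)) ∘ fun x p => b * x p) ∘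
        MeasurableEquiv.sumPiEquivProdPi (fun _ : NoiseIndex d => ℝ) := rfl
  have hm1 : Measurable fun (x : Fin d → ℝ) (i : Fin d) => a * x i := by fun_prop
  have hm2 : Measurable fun (x : Fin d × Fin d → ℝ) (p : Fin d × Fin d) => b * x p := by fun_prop
  have hm3 : Measurable fun (x : Fin d × Fin d → ℝ) (i j : Fin d) => x (i, j) := by fun_prop
  rw [← map_pi_eq_stdGaussian, Measure.map_map (measurable_scaledNoise a b) (by fun_prop), h1,
    ← Measure.map_map (hm1.prodMap (hm3.comp hm2)) (by fun_prop), hsum,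
    ← Measure.map_prod_map _ _ hm1 (hm3.comp hm2), pi_gaussianReal_map_const_mul,
    ← Measure.map_map hm3 hm2, pi_gaussianReal_map_const_mul, pi_map_curry]


/-! ### Sensitivity of the minibatch statistics -/

theorem sum_sub_mean_mul_sub_mean {κ : Type*} (S : Finset κ) (x y : κ → ℝ) {n : ℝ} (hn : n ≠ 0)
    (hS : (S.card : ℝ) = n) :
    ∑ l ∈ S, (x l - 1 / n * ∑ k ∈ S, x k) * (y l - 1 / n * ∑ k ∈ S, y k) =
      ∑ l ∈ S, x l * y l - 1 / n * ((∑ k ∈ S, x k) * ∑ k ∈ S, y k) := by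
  set a := ∑ k ∈ S, x k with ha
  set b := ∑ k ∈ S, y k with hb
  have h : ∀ l, (x l - 1 / n * a) * (y l - 1 / n * b) =
      x l * y l - 1 / n * b * x l - 1 / n * a * y l + 1 / n * a * (1 / n * b) := fun l => by ring
  simp_rw [h, Finset.sum_add_distrib, Finset.sum_sub_distrib, ← Finset.mul_sum, ← ha, ← hb,
    Finset.sum_const, nsmul_eq_mul, hS]
  field_simp
  ring

/-- The Frobenius norm of a symmetrized tensor product. -/
theorem sum_sq_symm_mul_le {d : ℕ} (s r : EuclideanSpace ℝ (Fin d)) :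
    ∑ i, ∑ j, ((s i * r j + r i * s j) / 2) ^ 2 ≤ ‖s‖ ^ 2 * ‖r‖ ^ 2 := by
  have h1 : ∑ i, ∑ j, (s i) ^ 2 * (r j) ^ 2 = ‖s‖ ^ 2 * ‖r‖ ^ 2 := by
    rw [EuclideanSpace.real_norm_sq_eq, EuclideanSpace.real_norm_sq_eq, Finset.sum_mul_sum]
  have h2 : ∑ i, ∑ j, (r i) ^ 2 * (s j) ^ 2 = ‖s‖ ^ 2 * ‖r‖ ^ 2 := by
    rw [EuclideanSpace.real_norm_sq_eq, EuclideanSpace.real_norm_sq_eq, mul_comm,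
      Finset.sum_mul_sum]
  calc _ ≤ ∑ i, ∑ j, ((s i) ^ 2 * (r j) ^ 2 / 2 + (r i) ^ 2 * (s j) ^ 2 / 2) := by
        refine Finset.sum_le_sum fun i _ => Finset.sum_le_sum fun j _ => ?_
        nlinarith [sq_nonneg (s i * r j - r i * s j)]
    _ = _ := by
        simp_rw [Finset.sum_add_distrib, ← Finset.sum_div]
        rw [h1, h2, add_halves]

/-- The joint sensitivity of mean and covariance: for two points of the unit ball at distance `D`
and with a sum of length `S`. -/
theorem joint_sensitivity_le {D S : ℝ} (hS : 0 ≤ S) (h : D ^ 2 + S ^ 2 ≤ 4) :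
    D ^ 2 + D ^ 2 * (S + 2) ^ 2 / 49 ≤ 109 / 25 := by
  have h1 : D ^ 2 * (1 + (S + 2) ^ 2 / 49) ≤ (4 - S ^ 2) * (1 + (S + 2) ^ 2 / 49) := by
    gcongr
    linarith
  nlinarith [sq_nonneg (7 * S - 8 / 7), pow_nonneg hS 3, pow_nonneg hS 4]

namespace SGFSInput

variable {𝒳 : Type*} {d : ℕ} (P : SGFSInput 𝒳 d)

theorem toEuclideanCLM_ofLp_apply (F : Matrix (Fin d) (Fin d) ℝ) (v : EuclideanSpace ℝ (Fin d)) :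
    (Matrix.toEuclideanCLM (𝕜 := ℝ) F v) = WithLp.toLp 2 (F *ᵥ v.ofLp) := by
  simp [← Matrix.ofLp_toEuclideanCLM]

theorem gradCov_apply {N : ℕ} (X : Fin N → 𝒳) {S : Finset (Fin N)} (hτ : 2 ≤ P.τ)
    (hS : S.card = P.τ) (θ : EuclideanSpace ℝ (Fin d)) (i j : Fin d) :
    P.gradCov X S θ i j = 1 / ((P.τ : ℝ) - 1) *
      (∑ l ∈ S, ∇ (P.loss (X l)) θ i * ∇ (P.loss (X l)) θ j -
        1 / (P.τ : ℝ) * ((∑ l ∈ S, ∇ (P.loss (X l)) θ i) * ∑ l ∈ S, ∇ (P.loss (X l)) θ j)) := by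
  have hτ0 : (P.τ : ℝ) ≠ 0 := by
    have : P.τ ≠ 0 := by omega
    exact_mod_cast this
  rw [← sum_sub_mean_mul_sub_mean S _ _ hτ0 (by rw [hS])]
  simp [gradCov, meanGrad, Matrix.sum_apply, Matrix.vecMulVec_apply]

theorem gradCov_insert_sub {N : ℕ} {X Y : Fin N → 𝒳} {T : Finset (Fin N)} {a b : Fin N}
    (ha : a ∉ T) (hb : b ∉ T) (hτ : 2 ≤ P.τ) (hT : T.card + 1 = P.τ)
    (hXY : ∀ l ∈ T, X l = Y l) (θ : EuclideanSpace ℝ (Fin d)) (i j : Fin d) :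
    P.gradCov X (insert a T) θ i j - P.gradCov Y (insert b T) θ i j =
      1 / (P.τ : ℝ) * (((∇ (P.loss (X a)) θ - ∇ (P.loss (Y b)) θ) i *
        (∇ (P.loss (X a)) θ + ∇ (P.loss (Y b)) θ -
          (2 / ((P.τ : ℝ) - 1)) • ∑ l ∈ T, ∇ (P.loss (X l)) θ) j +
        (∇ (P.loss (X a)) θ + ∇ (P.loss (Y b)) θ -
          (2 / ((P.τ : ℝ) - 1)) • ∑ l ∈ T, ∇ (P.loss (X l)) θ) i *
        (∇ (P.loss (X a)) θ - ∇ (P.loss (Y b)) θ) j) / 2) := by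
  have hτ0 : (P.τ : ℝ) ≠ 0 := by
    have : P.τ ≠ 0 := by omega
    exact_mod_cast this
  have hτ1 : (P.τ : ℝ) - 1 ≠ 0 := by
    have : (2 : ℝ) ≤ P.τ := by exact_mod_cast hτ
    linarith
  have e : ∀ f : 𝒳 → ℝ, ∑ l ∈ T, f (Y l) = ∑ l ∈ T, f (X l) := fun f =>
    Finset.sum_congr rfl fun l hl => by rw [hXY l hl]
  rw [P.gradCov_apply X hτ (by rw [Finset.card_insert_of_notMem ha, hT]),
    P.gradCov_apply Y hτ (by rw [Finset.card_insert_of_notMem hb, hT])]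
  simp only [Finset.sum_insert ha, Finset.sum_insert hb]
  rw [e fun x => ∇ (P.loss x) θ i * ∇ (P.loss x) θ j, e fun x => ∇ (P.loss x) θ i,
    e fun x => ∇ (P.loss x) θ j]
  simp only [PiLp.sub_apply, PiLp.add_apply, PiLp.smul_apply, WithLp.ofLp_sum, Finset.sum_apply,
    smul_eq_mul]
  field_simp
  ring

/-- The centre of the Gaussian vector from which iteration `t` computes its release, in units of
the standard deviations `a` and `b` of the noise; `u x` is a preimage of the gradient at `x`
under `F`. -/
def noiseCentre {N : ℕ} (u : 𝒳 → EuclideanSpace ℝ (Fin d)) (a b : ℝ) (X : Fin N → 𝒳)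
    (θ : EuclideanSpace ℝ (Fin d)) (S : Finset (Fin N)) : EuclideanSpace ℝ (NoiseIndex d) :=
  WithLp.toLp 2 (Sum.elim (fun i => a⁻¹ * (1 / (P.τ : ℝ) * ∑ l ∈ S, u (X l) i))
    (fun p => b⁻¹ * P.gradCov X S θ p.1 p.2))

/-- The sensitivity of one iteration. Exchanging one data point moves the mean gradient by
`F (u - u') / τ` and the sample covariance by `1 / τ` times the symmetrized product of `F (u - u')`
and a vector of length at most `‖F‖ (‖u + u'‖ + 2)`; measured in the standard deviations of the
noise, both shifts together are bounded through the parallelogram law. -/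
theorem norm_noiseCentre_insert_sub_sq_le {N : ℕ} {X Y : Fin N → 𝒳} {T : Finset (Fin N)}
    {i j : Fin N} (hi : i ∉ T) (hj : j ∉ T) (hτ : 2 ≤ P.τ) (hT : T.card + 1 = P.τ)
    (hXY : ∀ l ∈ T, X l = Y l) {θ : EuclideanSpace ℝ (Fin d)}
    {u : 𝒳 → EuclideanSpace ℝ (Fin d)} (hu1 : ∀ x, ‖u x‖ ≤ 1)
    (hu : ∀ x, Matrix.toEuclideanCLM (𝕜 := ℝ) P.F (u x) = ∇ (P.loss x) θ) {v a b : ℝ}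
    (hv : 0 < v) (ha : v ≤ a ^ 2) (hb : b ^ 2 = 49 * P.normF ^ 4 * v) :
    ‖P.noiseCentre u a b X θ (insert i T) - P.noiseCentre u a b Y θ (insert j T)‖ ^ 2 ≤
      109 / 25 / ((P.τ : ℝ) ^ 2 * v) := by
  have hτ2 : (2 : ℝ) ≤ P.τ := by exact_mod_cast hτ
  have hτ0 : (0 : ℝ) < P.τ := by linarith
  have hTc : (T.card : ℝ) = P.τ - 1 := by
    have : (T.card : ℝ) + 1 = P.τ := by exact_mod_cast hT
    linarith
  set D := ‖u (X i) - u (Y j)‖ with hD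
  set Sm := ‖u (X i) + u (Y j)‖ with hSm
  have hDS : D ^ 2 + Sm ^ 2 ≤ 4 := by
    have h := parallelogram_law_with_norm ℝ (u (X i)) (u (Y j))
    have h1 := hu1 (X i)
    have h2 := hu1 (Y j)
    have h3 := norm_nonneg (u (X i))
    have h4 := norm_nonneg (u (Y j))
    nlinarith
  set s := ∇ (P.loss (X i)) θ - ∇ (P.loss (Y j)) θ with hs
  set r := ∇ (P.loss (X i)) θ + ∇ (P.loss (Y j)) θ -
          (2 / ((P.τ : ℝ) - 1)) • ∑ l ∈ T, ∇ (P.loss (X l)) θ with hr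
  have hnF : 0 ≤ P.normF := norm_nonneg _
  have hsn : ‖s‖ ≤ P.normF * D := by
    rw [hs, ← hu, ← hu, ← map_sub]
    exact ContinuousLinearMap.le_opNorm _ _
  have hrn : ‖r‖ ≤ P.normF * (Sm + 2) := by
    have e : r = Matrix.toEuclideanCLM (𝕜 := ℝ) P.F
        (u (X i) + u (Y j) - (2 / ((P.τ : ℝ) - 1)) • ∑ l ∈ T, u (X l)) := by
      rw [hr, map_sub, map_add, map_smul, map_sum]
      simp_rw [hu]
    rw [e]
    refine (ContinuousLinearMap.le_opNorm _ _).trans (mul_le_mul_of_nonneg_left ?_ hnF)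
    refine (norm_sub_le _ _).trans (add_le_add le_rfl ?_)
    have h1 : ‖∑ l ∈ T, u (X l)‖ ≤ P.τ - 1 := by
      refine (norm_sum_le _ _).trans ((Finset.sum_le_sum fun l _ => hu1 (X l)).trans ?_)
      simp [hTc]
    rw [norm_smul, Real.norm_eq_abs, abs_of_nonneg (div_nonneg two_pos.le (by linarith))]
    calc 2 / ((P.τ : ℝ) - 1) * ‖∑ l ∈ T, u (X l)‖ ≤ 2 / ((P.τ : ℝ) - 1) * (P.τ - 1) :=
          mul_le_mul_of_nonneg_left h1 (div_nonneg two_pos.le (by linarith))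
      _ = 2 := div_mul_cancel₀ _ (by linarith)
  have hnorm : ‖P.noiseCentre u a b X θ (insert i T) - P.noiseCentre u a b Y θ (insert j T)‖ ^ 2 =
      (a⁻¹) ^ 2 * (1 / (P.τ : ℝ)) ^ 2 * D ^ 2 + (b⁻¹) ^ 2 * (1 / (P.τ : ℝ)) ^ 2 *
        ∑ k, ∑ l, ((s k * r l + r k * s l) / 2) ^ 2 := by
    rw [EuclideanSpace.real_norm_sq_eq, Fintype.sum_sum_type, Fintype.sum_prod_type]
    congr 1
    · rw [hD, EuclideanSpace.real_norm_sq_eq, Finset.mul_sum]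
      refine Finset.sum_congr rfl fun k _ => ?_
      have e : ∑ l ∈ T, u (X l) k = ∑ l ∈ T, u (Y l) k :=
        Finset.sum_congr rfl fun l hl => by rw [hXY l hl]
      simp only [noiseCentre, PiLp.sub_apply, Sum.elim_inl, Finset.sum_insert hi,
        Finset.sum_insert hj, e]
      ring
    · rw [Finset.mul_sum]
      refine Finset.sum_congr rfl fun k _ => ?_
      rw [Finset.mul_sum]
      refine Finset.sum_congr rfl fun l _ => ?_
      simp only [noiseCentre, PiLp.sub_apply, Sum.elim_inr]
      rw [← mul_sub, P.gradCov_insert_sub hi hj hτ hT hXY]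
      ring
  have hF : (b⁻¹) ^ 2 * P.normF ^ 4 ≤ 1 / (49 * v) := by
    rcases hnF.eq_or_lt with h0 | h0
    · rw [← h0]; simp; positivity
    · rw [inv_pow, hb]
      refine le_of_eq ?_
      field_simp
  have hfrob : ∑ k, ∑ l, ((s k * r l + r k * s l) / 2) ^ 2 ≤
      P.normF ^ 4 * (D ^ 2 * (Sm + 2) ^ 2) := by
    refine (sum_sq_symm_mul_le s r).trans ?_
    have h1 : ‖s‖ ^ 2 ≤ (P.normF * D) ^ 2 := by gcongr
    have h2 : ‖r‖ ^ 2 ≤ (P.normF * (Sm + 2)) ^ 2 := by gcongr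
    calc ‖s‖ ^ 2 * ‖r‖ ^ 2 ≤ (P.normF * D) ^ 2 * (P.normF * (Sm + 2)) ^ 2 := by gcongr
      _ = _ := by ring
  have ha' : (a⁻¹) ^ 2 ≤ 1 / v := by
    rw [inv_pow, ← one_div]
    exact one_div_le_one_div_of_le hv ha
  rw [hnorm]
  calc _ ≤ 1 / v * (1 / (P.τ : ℝ)) ^ 2 * D ^ 2 + (b⁻¹) ^ 2 * (1 / (P.τ : ℝ)) ^ 2 *
        (P.normF ^ 4 * (D ^ 2 * (Sm + 2) ^ 2)) := by gcongr
    _ = 1 / v * (1 / (P.τ : ℝ)) ^ 2 * D ^ 2 + ((b⁻¹) ^ 2 * P.normF ^ 4) * (1 / (P.τ : ℝ)) ^ 2 *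
        (D ^ 2 * (Sm + 2) ^ 2) := by ring
    _ ≤ 1 / v * (1 / (P.τ : ℝ)) ^ 2 * D ^ 2 + 1 / (49 * v) * (1 / (P.τ : ℝ)) ^ 2 *
        (D ^ 2 * (Sm + 2) ^ 2) := by gcongr
    _ = (D ^ 2 + D ^ 2 * (Sm + 2) ^ 2 / 49) / ((P.τ : ℝ) ^ 2 * v) := by field_simp
    _ ≤ _ := by
      gcongr
      exact joint_sensitivity_le (norm_nonneg _) hDS

/-! ### The release as a function of a Gaussian vector -/

/-- What iteration `t` computes from the Gaussian vector `e` when it starts in the state `s`. -/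
def releaseOfVector (N t : ℕ) (s : SGFSState d) (a b : ℝ)
    (e : EuclideanSpace ℝ (NoiseIndex d)) : SGFSRelease d :=
  (WithLp.toLp 2 (P.F *ᵥ (scaledNoise a b e).1),
    psdProj (Matrix.of (scaledNoise a b e).2),
    P.nextParam N t s.1 (P.nextInfo t s.2 (psdProj (Matrix.of (scaledNoise a b e).2)))
      (WithLp.toLp 2 (P.F *ᵥ (scaledNoise a b e).1)))

theorem measurable_releaseOfVector (N t : ℕ) (s : SGFSState d) (a b : ℝ) :
    Measurable (P.releaseOfVector N t s a b) := by
  have h2 : Continuous fun z : Fin d → ℝ => WithLp.toLp 2 (P.F *ᵥ z) := by fun_prop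
  have hg := h2.measurable.comp (measurable_scaledNoise (d := d) a b).fst
  have hV : Measurable fun e => psdProj (Matrix.of (scaledNoise (d := d) a b e).2) :=
    continuous_psdProj.measurable.comp (measurable_scaledNoise (d := d) a b).snd
  exact hg.prodMk (hV.prodMk (P.measurable_nextParam N t measurable_const
    (P.measurable_nextInfo t measurable_const hV) hg))

theorem release_scaledNoise {N : ℕ} (X : Fin N → 𝒳) (t : ℕ) (s : SGFSState d)
    (S : Finset (Fin N)) {u : 𝒳 → EuclideanSpace ℝ (Fin d)}
    (hu : ∀ x, Matrix.toEuclideanCLM (𝕜 := ℝ) P.F (u x) = ∇ (P.loss x) s.1) {a b : ℝ}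
    (ha : a ≠ 0) (hb : b = 0 → P.normF = 0) (e : EuclideanSpace ℝ (NoiseIndex d)) :
    P.release X t s (S, scaledNoise a b e) =
      P.releaseOfVector N t s a b (e + P.noiseCentre u a b X s.1 S) := by
  have hg : P.privGrad X s.1 (S, scaledNoise a b e) =
      WithLp.toLp 2 (P.F *ᵥ (scaledNoise a b (e + P.noiseCentre u a b X s.1 S)).1) := by
    have h1 : P.meanGrad X S s.1 = WithLp.toLp 2
        (P.F *ᵥ fun i => 1 / (P.τ : ℝ) * ∑ l ∈ S, u (X l) i) := by
      rw [meanGrad]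
      simp_rw [← hu]
      rw [← map_sum, ← map_smul, toEuclideanCLM_ofLp_apply]
      congr 2
      ext i
      simp
    rw [privGrad, h1, ← WithLp.toLp_add, ← Matrix.mulVec_add]
    congr 2
    ext i
    simp only [scaledNoise, noiseCentre, Pi.add_apply, PiLp.add_apply, Sum.elim_inl]
    rw [mul_add, mul_inv_cancel_left₀ ha, add_comm]
  have hV : P.privCov X s.1 (S, scaledNoise a b e) =
      psdProj (Matrix.of (scaledNoise a b (e + P.noiseCentre u a b X s.1 S)).2) := by
    rw [privCov]
    congr 1
    ext i j
    simp only [scaledNoise, noiseCentre, Matrix.add_apply, Matrix.of_apply, PiLp.add_apply,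
      Sum.elim_inr]
    rw [mul_add, add_comm]
    congr 1
    rcases eq_or_ne b 0 with h0 | h0
    · have hF : Matrix.toEuclideanCLM (𝕜 := ℝ) P.F = 0 := norm_eq_zero.1 (hb h0)
      have hz : ∀ x, ∇ (P.loss x) s.1 = 0 := fun x => by rw [← hu, hF]; rfl
      rw [h0, zero_mul]
      simp [gradCov, meanGrad, hz]
    · rw [mul_inv_cancel_left₀ h0]
  rw [release, releaseOfVector, hg, hV]

theorem uniformOn_card_singleton {N n : ℕ} (S : Finset (Fin N)) :
    uniformOn {S : Finset (Fin N) | S.card = n} {S} =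
      if S ∈ Finset.powersetCard n Finset.univ then (N.choose n : ℝ≥0∞)⁻¹ else 0 := by
  have h : {S : Finset (Fin N) | S.card = n} =
      ((Finset.powersetCard n Finset.univ : Finset (Finset (Fin N))) : Set (Finset (Fin N))) := by
    ext S; simp
  rw [h, uniformOn, cond_apply (Finset.measurableSet _), Measure.count_apply_finset,
    Finset.card_powersetCard, Finset.card_univ, Fintype.card_fin]
  split_ifs with hS
  · rw [Set.inter_eq_right.2 (by simpa using hS), Measure.count_singleton, mul_one]
  · rw [Set.inter_singleton_eq_empty.2 (by simpa using hS), measure_empty, mul_zero]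

/-- The law of a release is a uniform mixture, over the minibatches, of images of Gaussian laws. -/
theorem releaseLaw_eq {N : ℕ} (X : Fin N → 𝒳) (t : ℕ) (s : SGFSState d)
    {u : 𝒳 → EuclideanSpace ℝ (Fin d)}
    (hu : ∀ x, Matrix.toEuclideanCLM (𝕜 := ℝ) P.F (u x) = ∇ (P.loss x) s.1) {a b : ℝ}
    (ha : a ≠ 0) (hb : b = 0 → P.normF = 0)
    (ha2 : a ^ 2 = max (P.sigmaSq N) (1 / (N ^ 2 * P.η t)))
    (hb2 : b ^ 2 = 49 * P.normF ^ 4 * P.sigmaSq N) :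
    P.releaseLaw X t s = ((N.choose P.τ : ℝ≥0∞)⁻¹ • ∑ S ∈ Finset.powersetCard P.τ Finset.univ,
      (stdGaussian (EuclideanSpace ℝ (NoiseIndex d))).map
        (· + P.noiseCentre u a b X s.1 S)).map (P.releaseOfVector N t s a b) := by
  have hm := P.measurable_releaseOfVector N t s a b
  ext A hA
  rw [releaseLaw, noiseLaw, Measure.map_apply (P.measurable_release_right X t s) hA,
    Measure.map_apply hm hA, Measure.prod_apply (P.measurable_release_right X t s hA),
    lintegral_fintype, ← ha2, ← hb2, ← stdGaussian_map_scaledNoise, Measure.smul_apply,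
    Measure.finsetSum_apply, smul_eq_mul, Finset.mul_sum]
  simp_rw [uniformOn_card_singleton, mul_ite, mul_zero]
  rw [← Finset.sum_filter, Finset.filter_mem_eq_inter, Finset.univ_inter]
  refine Finset.sum_congr rfl fun S _ => ?_
  rw [mul_comm, Measure.map_apply (measurable_scaledNoise a b)
    (measurable_prodMk_left (P.measurable_release_right X t s hA)),
    Measure.map_apply (by fun_prop) (hm hA)]
  congr 2
  ext e
  simp only [Set.mem_preimage]
  rw [P.release_scaledNoise X t s S hu ha hb]

end SGFSInput


/-! ### One iteration of the algorithm -/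

theorem swapSet_eq_insert_erase {N : ℕ} {i j : Fin N} {S : Finset (Fin N)} (hi : i ∉ S)
    (hj : j ∈ S) : swapSet i j S = insert i (S.erase j) := by
  ext a
  have hij : i ≠ j := fun h => hi (h ▸ hj)
  rw [mem_swapSet, Finset.mem_insert, Finset.mem_erase]
  rcases eq_or_ne a i with rfl | hai
  · simp [hj]
  rcases eq_or_ne a j with rfl | haj
  · simp [hi, hai]
  · simp [Equiv.swap_apply_of_ne_of_ne hai haj, hai, haj]

namespace SGFSInput

variable {𝒳 : Type*} {d : ℕ} (P : SGFSInput 𝒳 d)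

theorem noiseCentre_congr {N : ℕ} {X Y : Fin N → 𝒳} {S : Finset (Fin N)}
    (hXY : ∀ l ∈ S, X l = Y l) (u : 𝒳 → EuclideanSpace ℝ (Fin d)) (a b : ℝ)
    (θ : EuclideanSpace ℝ (Fin d)) :
    P.noiseCentre u a b X θ S = P.noiseCentre u a b Y θ S := by
  have e : ∀ {β : Type _} [AddCommMonoid β] (f : 𝒳 → β), ∑ l ∈ S, f (X l) = ∑ l ∈ S, f (Y l) :=
    fun f => Finset.sum_congr rfl fun l hl => by rw [hXY l hl]
  have hmean : P.meanGrad X S θ = P.meanGrad Y S θ := by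
    rw [meanGrad, meanGrad, e fun x => ∇ (P.loss x) θ]
  have hcov : P.gradCov X S θ = P.gradCov Y S θ := by
    rw [gradCov, gradCov, hmean]
    exact congrArg _ (e fun x => Matrix.vecMulVec (∇ (P.loss x) θ - P.meanGrad Y S θ).ofLp
      (∇ (P.loss x) θ - P.meanGrad Y S θ).ofLp)
  simp only [noiseCentre, hcov]
  simp_rw [e fun x => u x _]

/-- One iteration inherits the step bounds of mixtures of nearby Gaussian laws. -/
theorem isStepBound_releaseLaw {N : ℕ} (hτ : 2 ≤ P.τ) (hτN : P.τ ≤ N) {X Y : Fin N → 𝒳}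
    {i : Fin N} (hXY : ∀ j, j ≠ i → X j = Y j) {l : ℝ} {M η : ℝ≥0∞} (hσ : 0 < P.sigmaSq N)
    (hF : ∀ θ : EuclideanSpace ℝ (Fin d), ∀ x : 𝒳, ∃ v : EuclideanSpace ℝ (Fin d), ‖v‖ ≤ 1 ∧
      Matrix.toEuclideanCLM (𝕜 := ℝ) P.F v = ∇ (P.loss x) θ)
    (H : ∀ a b b' : EuclideanSpace ℝ (NoiseIndex d),
      ‖b - a‖ ^ 2 ≤ 109 / 25 / ((P.τ : ℝ) ^ 2 * P.sigmaSq N) →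
      ‖b' - a‖ ^ 2 ≤ 109 / 25 / ((P.τ : ℝ) ^ 2 * P.sigmaSq N) →
      ‖b - b'‖ ^ 2 ≤ 109 / 25 / ((P.τ : ℝ) ^ 2 * P.sigmaSq N) →
      IsStepBound (gaussianMixture (P.τ / N) a b) (gaussianMixture (P.τ / N) a b') l M η)
    (t : ℕ) (s : SGFSState d) :
    IsStepBound (P.releaseLaw X t s) (P.releaseLaw Y t s) l M η := by
  choose u hu1 hu using hF s.1
  set a := √(max (P.sigmaSq N) (1 / (N ^ 2 * P.η t))) with ha
  set b := √(49 * P.normF ^ 4 * P.sigmaSq N) with hb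
  have hmax : 0 < max (P.sigmaSq N) (1 / (N ^ 2 * P.η t)) := lt_max_of_lt_left hσ
  have ha2 : a ^ 2 = max (P.sigmaSq N) (1 / (N ^ 2 * P.η t)) := Real.sq_sqrt hmax.le
  have hb2 : b ^ 2 = 49 * P.normF ^ 4 * P.sigmaSq N := by
    have : 0 ≤ P.normF := norm_nonneg _
    exact Real.sq_sqrt (by positivity)
  have ha0 : a ≠ 0 := (Real.sqrt_pos.2 hmax).ne'
  have hb0 : b = 0 → P.normF = 0 := by
    intro h
    rw [h] at hb2
    by_contra hne
    have : P.normF ^ 4 ≠ 0 := pow_ne_zero 4 hne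
    have h3 : 49 * P.normF ^ 4 * P.sigmaSq N ≠ 0 := by positivity
    exact h3 (by rw [← hb2]; ring)
  have hva : P.sigmaSq N ≤ a ^ 2 := ha2 ▸ le_max_left _ _
  have key : ∀ {X' Y' : Fin N → 𝒳} {T : Finset (Fin N)} {j k : Fin N}, j ∉ T → k ∉ T →
      T.card + 1 = P.τ → (∀ l ∈ T, X' l = Y' l) →
      ‖P.noiseCentre u a b X' s.1 (insert j T) - P.noiseCentre u a b Y' s.1 (insert k T)‖ ^ 2 ≤
        109 / 25 / ((P.τ : ℝ) ^ 2 * P.sigmaSq N) := fun hj hk hT hXY' =>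
    P.norm_noiseCentre_insert_sub_sq_le hj hk hτ hT hXY' hu1 hu hσ hva hb2
  have hXYT : ∀ {T : Finset (Fin N)}, i ∉ T → ∀ l ∈ T, X l = Y l := fun hiT l hl =>
    hXY l fun h => hiT (h ▸ hl)
  rw [P.releaseLaw_eq X t s hu ha0 hb0 ha2 hb2, P.releaseLaw_eq Y t s hu ha0 hb0 ha2 hb2]
  refine IsStepBound.map (isStepBound_subsampling i (by omega) hτN ?_ ?_)
    (P.measurable_releaseOfVector N t s a b)
  · intro S hS hi j hj
    have hT : (S.erase j).card + 1 = P.τ := by rw [Finset.card_erase_add_one hj, hS]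
    have hiT : i ∉ S.erase j := fun h => hi (Finset.mem_of_mem_erase h)
    have hjT : j ∉ S.erase j := Finset.notMem_erase j S
    have hSj : S = insert j (S.erase j) := (Finset.insert_erase hj).symm
    have hcong := P.noiseCentre_congr (hXYT hi) u a b s.1
    rw [swapSet_eq_insert_erase hi hj, ← hcong]
    refine H _ _ _ ?_ ?_ ?_
    · conv_lhs => rw [hSj, Finset.erase_insert hjT]
      exact key hiT hjT hT fun _ _ => rfl
    · rw [hcong]
      conv_lhs => rw [hSj, Finset.erase_insert hjT]
      exact key hiT hjT hT fun _ _ => rfl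
    · exact key hiT hiT hT (hXYT hiT)
  · -- without subsampling the mixtures are degenerate
    intro hN
    have hq : (P.τ : ℝ) / N = 1 := by
      rw [hN]
      exact div_self (by exact_mod_cast i.pos.ne')
    have hmix : ∀ a b : EuclideanSpace ℝ (NoiseIndex d), gaussianMixture (P.τ / N) a b =
        (stdGaussian (EuclideanSpace ℝ (NoiseIndex d))).map (· + b) := fun a b => by
      rw [gaussianMixture, hq]; simp
    have hiT : i ∉ (Finset.univ : Finset (Fin N)).erase i := Finset.notMem_erase _ _
    have hu' : (Finset.univ : Finset (Fin N)) = insert i (Finset.univ.erase i) :=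
      (Finset.insert_erase (Finset.mem_univ i)).symm
    have hT : ((Finset.univ : Finset (Fin N)).erase i).card + 1 = P.τ := by
      rw [Finset.card_erase_add_one (Finset.mem_univ i), Finset.card_univ, Fintype.card_fin, hN]
    have hd : ‖P.noiseCentre u a b X s.1 Finset.univ - P.noiseCentre u a b Y s.1 Finset.univ‖ ^ 2
        ≤ 109 / 25 / ((P.τ : ℝ) ^ 2 * P.sigmaSq N) := by
      rw [hu']
      exact key hiT hiT hT (hXYT hiT)
    have h := H (P.noiseCentre u a b Y s.1 Finset.univ) (P.noiseCentre u a b X s.1 Finset.univ)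
      (P.noiseCentre u a b Y s.1 Finset.univ) hd (by simp; positivity) hd
    rwa [hmix, hmix] at h

end SGFSInput

/-! ### Numerical estimates -/

theorem exp_natCast_div_le {p k : ℕ} (hk : k ≠ 0) {c : ℝ} (hc : 0 ≤ c)
    (h : (2.7182818286 : ℝ) ^ p ≤ c ^ k) : Real.exp (p / k) ≤ c := by
  have hk' : (k : ℝ) ≠ 0 := by exact_mod_cast hk
  refine le_of_pow_le_pow_left₀ hk hc ?_
  calc Real.exp (p / k) ^ k = Real.exp 1 ^ p := by
        rw [← Real.exp_nat_mul, ← Real.exp_nat_mul]; congr 1; field_simp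
    _ ≤ 2.7182818286 ^ p := by gcongr; exact Real.exp_one_lt_d9.le
    _ ≤ c ^ k := h

/-- In the regime of large `ε`, second moments suffice. Here `m` is the squared shift of the
Gaussian laws, `q` the sampling rate and `n` the number of iterations; the summand `4 log 2` is the
gain from the initial constant `1 / 4` of the composition and from the target `2 δ = 4 exp (-L₂)`. -/
theorem second_moment_exponent_le {ε L₂ L m q n : ℝ} (hε : 0 < ε) (hL₂ : 1.386 ≤ L₂)
    (hεL : ε ^ 2 ≤ 4 * L₂) (hL : L₂ + 0.22 ≤ L) (hm : 0 ≤ m) (hn : 0 ≤ n) (hmL : m * L ≤ 109 / 25)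
    (hw : n * q ^ 2 * m * (32 * L₂ * L) ≤ 109 / 25 * ε ^ 2) (hbig : L₂ - 2.5 ≤ 2 * ε) :
    n * (2 * q ^ 2 * (Real.exp m - 1)) ≤ 2 * ε - L₂ + 4 * Real.log 2 := by
  have hlog := Real.log_two_gt_d9
  have hL0 : 0 < L := by linarith
  have hL20 : 0 < L₂ := by linarith
  set w := n * q ^ 2 * m with hwdef
  have hw0 : 0 ≤ w := by positivity
  have hK : ∀ K : ℝ, Real.exp m - 1 ≤ K * m →
      n * (2 * q ^ 2 * (Real.exp m - 1)) ≤ 2 * K * w := by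
    intro K hK
    have := mul_le_mul_of_nonneg_left hK (show 0 ≤ 2 * (n * q ^ 2) by positivity)
    rw [hwdef]
    linarith
  -- for small `L₂` the bound on `m` is weak, but so is the requirement, since `4 log 2 ≥ L₂`
  rcases le_total L₂ 2.77 with h | h
  · have hm1 : m ≤ 2.75 := by nlinarith
    have hE : Real.exp 2.75 ≤ 15.65 := by
      have := exp_natCast_div_le (p := 11) (k := 4) (by norm_num) (c := 15.65) (by norm_num)
        (by norm_num)
      norm_num at this ⊢
      exact this
    have h1 := exp_sub_one_le_chord hm hm1 (by norm_num)
    have h2 := hK 5.33 (h1.trans (mul_le_mul_of_nonneg_right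
      (by rw [div_le_iff₀ (by norm_num)]; linarith) hm))
    refine h2.trans ?_
    have h3 : 10.66 * w ≤ 2 * ε := by
      have h4 : ε ≤ 1.3 * L₂ * L := by
        refine le_of_sq_le_sq ?_ (by positivity)
        have h5 : 2.5 ≤ L ^ 2 := by nlinarith
        have h6 : 3.4 ≤ L₂ * L ^ 2 := by nlinarith
        have h7 : (1.3 * L₂ * L) ^ 2 = 1.69 * L₂ * (L₂ * L ^ 2) := by ring
        rw [h7]
        nlinarith
      have h8 : 0 < 32 * L₂ * L := by positivity
      refine le_of_mul_le_mul_right ?_ h8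
      have h9 : 10.66 * w * (32 * L₂ * L) ≤ 46.48 * ε ^ 2 := by linarith [sq_nonneg ε]
      nlinarith
    linarith
  · have hm1 : m ≤ 1.5 := by nlinarith
    have hE : Real.exp 1.5 ≤ 4.482 := by
      have := exp_natCast_div_le (p := 3) (k := 2) (by norm_num) (c := 4.482) (by norm_num)
        (by norm_num)
      norm_num at this ⊢
      exact this
    have h1 := exp_sub_one_le_chord hm hm1 (by norm_num)
    have h2 := hK 2.322 (h1.trans (mul_le_mul_of_nonneg_right
      (by rw [div_le_iff₀ (by norm_num)]; linarith) hm))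
    refine h2.trans ?_
    have h3 : w * (32 * L₂ ^ 2) ≤ 109 / 25 * ε ^ 2 := by
      refine le_trans ?_ hw
      have : L₂ ^ 2 ≤ L₂ * L := by nlinarith
      have := mul_le_mul_of_nonneg_left this hw0
      linarith
    have h32 : 0 < 32 * L₂ ^ 2 := by positivity
    refine le_of_mul_le_mul_right (a := 32 * L₂ ^ 2) ?_ h32
    have h4 : 2 * 2.322 * w * (32 * L₂ ^ 2) ≤ 20.248 * ε ^ 2 := by linarith [sq_nonneg ε]
    refine h4.trans ?_
    rcases le_total ε (0.65 * L₂) with hx | hx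
    · have h5 : ε ^ 2 ≤ (0.65 * L₂) ^ 2 := by gcongr
      have h6 : 0.27 ≤ 2 * ε - L₂ + 4 * Real.log 2 := by linarith
      nlinarith
    · have h6 : 3.6 ≤ 2 * ε - L₂ + 4 * Real.log 2 := by linarith
      nlinarith

/-- In the regime of small `ε`, the truncated moment of order `l = 3 L₂ / (4 ε)` suffices: at the
threshold `exp (2 ε)` it gains `exp (-2 l ε) = exp (-1.5 L₂)`, of which the moments and the initial
constant `1 / (e l)` may use up `exp (0.5 L₂)`. -/
theorem truncated_moment_exponent_le {ε L₂ L m q n l : ℝ} (hε : 0 < ε) (hsmall : 2 * ε ≤ L₂ - 2.5)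
    (hl : l * ε = 0.75 * L₂) (hL : L₂ ≤ L) (hm : 0 ≤ m) (hn : 0 ≤ n) (hmL : m * L ≤ 109 / 25)
    (hw : n * q ^ 2 * m * (32 * L₂ * L) ≤ 109 / 25 * ε ^ 2) :
    n * (2 * (1 + 1 / l) * ((l * q * ((Real.exp 3 - 1) / 3)) ^ 2 * m / 2) +
      l * (l + 1) * q ^ 2 * (Real.exp m - 1)) ≤ 0.5 * L₂ + 1 + Real.log l := by
  have hL20 : 0 < L₂ := by linarith
  have hL0 : 0 < L := by linarith
  have hl0 : 0 < l := by
    by_contra h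
    nlinarith
  set t := 1 / l with ht
  have ht0 : 0 < t := by positivity
  have hlt : l * t = 1 := by rw [ht]; field_simp
  have hεt : ε = 0.75 * L₂ * t := by
    calc ε = l * t * ε := by rw [hlt, one_mul]
      _ = l * ε * t := by ring
      _ = _ := by rw [hl]
  set w := n * q ^ 2 * m with hwdef
  have hw0 : 0 ≤ w := by positivity
  have he3 : Real.exp 3 ≤ 20.0856 := by
    have := exp_natCast_div_le (p := 3) (k := 1) (by norm_num) (c := 20.0856) (by norm_num)
      (by norm_num)
    norm_num at this ⊢
    exact this
  have he3' : 1 ≤ Real.exp 3 := Real.one_le_exp (by norm_num)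
  have hA : ((Real.exp 3 - 1) / 3) ^ 2 ≤ 40.48 := by
    have h1 : (Real.exp 3 - 1) / 3 ≤ 6.362 := by linarith
    have h0 : 0 ≤ (Real.exp 3 - 1) / 3 := by linarith
    nlinarith
  have hm1 : m ≤ 1.75 := by nlinarith
  have hE : Real.exp 1.75 ≤ 5.756 := by
    have := exp_natCast_div_le (p := 7) (k := 4) (by norm_num) (c := 5.756) (by norm_num)
      (by norm_num)
    norm_num at this ⊢
    exact this
  have hem : Real.exp m - 1 ≤ 2.72 * m :=
    (exp_sub_one_le_chord hm hm1 (by norm_num)).trans (mul_le_mul_of_nonneg_right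
      (by rw [div_le_iff₀ (by norm_num)]; linarith) hm)
  have hl2w : l ^ 2 * w ≤ 0.07665 := by
    have h1 : l ^ 2 * w * (32 * L₂ * L) ≤ 109 / 25 * (0.75 * L₂) ^ 2 := by
      rw [← hl]
      nlinarith [mul_le_mul_of_nonneg_left hw (sq_nonneg l)]
    have h2 : 109 / 25 * (0.75 * L₂) ^ 2 ≤ 0.07665 * (32 * L₂ * L) := by nlinarith
    exact le_of_mul_le_mul_right (h1.trans h2) (by positivity)
  have hmain : n * (2 * (1 + t) * ((l * q * ((Real.exp 3 - 1) / 3)) ^ 2 * m / 2) +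
      l * (l + 1) * q ^ 2 * (Real.exp m - 1)) ≤ 3.312 * (1 + t) := by
    have h1 : n * (l * (l + 1) * q ^ 2 * (Real.exp m - 1)) ≤ (1 + t) * (l ^ 2 * w) * 2.72 := by
      have h2 := mul_le_mul_of_nonneg_left hem (show 0 ≤ n * (l * (l + 1) * q ^ 2) by positivity)
      have h3 : (1 + t) * (l ^ 2 * w) * 2.72 = n * (l * (l + 1) * q ^ 2) * (2.72 * m) := by
        have : (1 + t) * l ^ 2 = l * (l + 1) := by
          calc (1 + t) * l ^ 2 = l ^ 2 + l * (l * t) := by ring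
            _ = _ := by rw [hlt]; ring
        calc _ = ((1 + t) * l ^ 2) * w * 2.72 := by ring
          _ = _ := by rw [this, hwdef]; ring
      linarith
    have h2 : n * (2 * (1 + t) * ((l * q * ((Real.exp 3 - 1) / 3)) ^ 2 * m / 2)) ≤
        (1 + t) * (l ^ 2 * w) * 40.48 := by
      have h3 := mul_le_mul_of_nonneg_left hA (show 0 ≤ (1 + t) * (l ^ 2 * w) by positivity)
      refine le_trans (le_of_eq ?_) h3
      rw [hwdef]; ring
    have h4 : (1 + t) * (l ^ 2 * w) ≤ (1 + t) * 0.07665 := by gcongr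
    rw [mul_add]
    linarith
  refine hmain.trans ?_
  have hlog3 : 1.09 ≤ Real.log 3 := by
    rw [Real.le_log_iff_exp_le (by norm_num)]
    have := exp_natCast_div_le (p := 109) (k := 100) (by norm_num) (c := 3) (by norm_num)
      (by norm_num)
    norm_num at this ⊢
    exact this
  -- the tangent of the logarithm at `3`, in terms of `t = 1 / l`
  have hlogl : 1.09 + 1 - 3 * t ≤ Real.log l := by
    have h1 := Real.one_sub_inv_le_log_of_pos (show 0 < l / 3 by positivity)
    rw [Real.log_div hl0.ne' (by norm_num), inv_div] at h1
    have h2 : 3 / l = 3 * t := by rw [ht]; ring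
    linarith
  have h5 : 2.5 ≤ L₂ * (1 - 1.5 * t) := by nlinarith
  have h6 : 0 < 1 - 1.5 * t := by
    by_contra hneg
    nlinarith
  have h7 : (3.312 * (1 + t) - 1 - (2.09 - 3 * t)) * (1 - 1.5 * t) ≤ 0.5 * L₂ * (1 - 1.5 * t) := by
    nlinarith [sq_nonneg (t - 0.315)]
  have h8 := le_of_mul_le_mul_right h7 h6
  linarith

/-- The total mass of the truncated events, at the truncation level `3`. -/
theorem truncation_mass_le {δ L m n : ℝ} (hδ : 0 < δ) (hm : 0 < m) (hmL : m * L ≤ 109 / 25)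
    (hn : n ≤ δ * Real.exp L / 2.5) :
    n * Real.exp (-((3 - m / 2) ^ 2 / (2 * m))) ≤ 1.5 * δ := by
  have hE : Real.exp 1.3 ≤ 3.75 := by
    have := exp_natCast_div_le (p := 13) (k := 10) (by norm_num) (c := 3.75) (by norm_num)
      (by norm_num)
    norm_num at this ⊢
    exact this
  have h1 : L - (3 - m / 2) ^ 2 / (2 * m) ≤ 1.3 := by
    refine le_of_mul_le_mul_right (a := 2 * m) ?_ (by positivity)
    rw [sub_mul, div_mul_cancel₀ _ (by positivity)]
    nlinarith [sq_nonneg (m - 1)]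
  calc n * Real.exp (-((3 - m / 2) ^ 2 / (2 * m)))
      ≤ δ * Real.exp L / 2.5 * Real.exp (-((3 - m / 2) ^ 2 / (2 * m))) := by gcongr
    _ = δ / 2.5 * Real.exp (L - (3 - m / 2) ^ 2 / (2 * m)) := by
        rw [sub_eq_add_neg L, Real.exp_add]; ring
    _ ≤ δ / 2.5 * 3.75 := by gcongr; exact (Real.exp_le_exp.2 h1).trans hE
    _ = 1.5 * δ := by ring

/-- The constant `1 / (e l)` starts the composition of step bounds of order `l`. -/
theorem one_le_add_rpow_neg_div {l γ : ℝ} (hl : 0 < l) (hγ : 0 < γ) :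
    1 ≤ γ + γ ^ (-l) * (Real.exp (-1) / l) := by
  have h1 : Real.exp (l * (1 - γ)) ≤ γ ^ (-l) := by
    rw [Real.rpow_def_of_pos hγ]
    refine Real.exp_le_exp.2 ?_
    nlinarith [Real.log_le_sub_one_of_pos hγ]
  have h2 := Real.add_one_le_exp (l * (1 - γ) - 1)
  have h3 : Real.exp (l * (1 - γ) - 1) = Real.exp (l * (1 - γ)) * Real.exp (-1) := by
    rw [← Real.exp_add]; rfl
  have h4 : l * (1 - γ) ≤ γ ^ (-l) * Real.exp (-1) := by
    have := mul_le_mul_of_nonneg_right h1 (Real.exp_pos (-1)).le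
    linarith
  have h5 : 1 - γ ≤ γ ^ (-l) * Real.exp (-1) / l := by
    rw [le_div_iff₀ hl]; linarith
  rw [← mul_div_assoc]
  linarith

theorem moment_le_exp {A x v : ℝ} (hA : 1 ≤ A) (hx : 0 ≤ x) (hv : 0 ≤ v) :
    1 + A * (Real.exp x - 1) + v ≤ Real.exp (A * x + v) := by
  have h1 : 1 + A * (Real.exp x - 1) ≤ Real.exp (A * x) := by
    have h := one_add_mul_self_le_rpow_one_add (s := Real.exp x - 1)
      (by linarith [Real.exp_pos x]) hA
    rwa [add_sub_cancel, ← Real.exp_mul, mul_comm x] at h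
  have h2 : 1 ≤ Real.exp (A * x) := Real.one_le_exp (by positivity)
  have h3 := Real.add_one_le_exp v
  rw [Real.exp_add]
  nlinarith


/-! ### The privacy guarantee -/

theorem exists_eq_of_hammingDist_le_one {ι β : Type*} [Fintype ι] [DecidableEq β] [Nonempty ι]
    {X Y : ι → β} (h : hammingDist X Y ≤ 1) : ∃ i, ∀ j, j ≠ i → X j = Y j := by
  obtain ⟨i, hi⟩ := Finset.card_le_one_iff_subset_singleton.1 h
  refine ⟨i, fun j hj => ?_⟩
  by_contra hne
  exact hj (Finset.mem_singleton.1 (hi (by simpa using hne)))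

theorem ofReal_remainder_le {g M c η D : ℝ} (hg : 0 ≤ g) (hM : 0 ≤ M) (hc : 0 ≤ c) (hη : 0 ≤ η)
    {n : ℕ} (h : g * (M ^ n * c) + n * η ≤ D) :
    ENNReal.ofReal g * (ENNReal.ofReal M ^ n * ENNReal.ofReal c) + n * ENNReal.ofReal η ≤
      ENNReal.ofReal D := by
  rw [← ENNReal.ofReal_pow hM, ← ENNReal.ofReal_mul (by positivity), ← ENNReal.ofReal_mul hg,
    ← ENNReal.ofReal_natCast, ← ENNReal.ofReal_mul (by positivity),
    ← ENNReal.ofReal_add (by positivity) (by positivity)]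
  exact ENNReal.ofReal_le_ofReal h

/-- The remainder of the second-moment step bounds after `n` iterations. -/
theorem second_moment_remainder_le {ε δ L m q : ℝ} {n : ℕ} (hε : 0 < ε) (hδ : 0 < δ)
    (hL₂ : 1.386 ≤ Real.log (2 / δ)) (hεL : ε ^ 2 ≤ 4 * Real.log (2 / δ))
    (hL : Real.log (2 / δ) + 0.22 ≤ L) (hm : 0 ≤ m) (hmL : m * L ≤ 109 / 25)
    (hw : n * q ^ 2 * m * (32 * Real.log (2 / δ) * L) ≤ 109 / 25 * ε ^ 2)
    (hbig : Real.log (2 / δ) - 2.5 ≤ 2 * ε) :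
    Real.exp (2 * ε) ^ (-1 : ℝ) * ((1 + 2 * q ^ 2 * (Real.exp m - 1)) ^ n * (1 / 4)) + n * 0 ≤
      2 * δ := by
  have h := second_moment_exponent_le hε hL₂ hεL hL hm n.cast_nonneg hmL hw hbig
  have hem : 0 ≤ Real.exp m - 1 := by linarith [Real.add_one_le_exp m]
  have hpow : (1 + 2 * q ^ 2 * (Real.exp m - 1)) ^ n ≤
      Real.exp (2 * ε - Real.log (2 / δ) + 4 * Real.log 2) := by
    calc (1 + 2 * q ^ 2 * (Real.exp m - 1)) ^ n
        ≤ Real.exp (2 * q ^ 2 * (Real.exp m - 1)) ^ n := by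
          gcongr
          linarith [Real.add_one_le_exp (2 * q ^ 2 * (Real.exp m - 1))]
      _ = Real.exp (n * (2 * q ^ 2 * (Real.exp m - 1))) := (Real.exp_nat_mul _ _).symm
      _ ≤ _ := Real.exp_le_exp.2 h
  have h16 : Real.exp (4 * Real.log 2) = 16 := by
    have := Real.exp_nat_mul (Real.log 2) 4
    rw [Real.exp_log (by norm_num)] at this
    norm_num at this
    exact this
  rw [mul_zero, add_zero, ← Real.exp_mul]
  calc Real.exp (2 * ε * -1) * ((1 + 2 * q ^ 2 * (Real.exp m - 1)) ^ n * (1 / 4))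
      ≤ Real.exp (2 * ε * -1) *
          (Real.exp (2 * ε - Real.log (2 / δ) + 4 * Real.log 2) * (1 / 4)) := by gcongr
    _ = Real.exp (2 * ε * -1 + (2 * ε - Real.log (2 / δ) + 4 * Real.log 2)) * (1 / 4) := by
        rw [Real.exp_add (2 * ε * -1)]; ring
    _ = Real.exp (-Real.log (2 / δ) + 4 * Real.log 2) * (1 / 4) := by congr 2; ring
    _ = 2 * δ := by
        rw [Real.exp_add, h16, Real.exp_neg, Real.exp_log (by positivity)]
        field_simp
        norm_num

/-- The remainder of the truncated step bounds after `n` iterations: a quarter of it is due to the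
moments, the rest to the truncated events. -/
theorem truncated_moment_remainder_le {ε δ L m q l : ℝ} {n : ℕ} (hε : 0 < ε) (hδ : 0 < δ)
    (hL : Real.log (2 / δ) ≤ L) (hm : 0 < m) (hmL : m * L ≤ 109 / 25)
    (hw : n * q ^ 2 * m * (32 * Real.log (2 / δ) * L) ≤ 109 / 25 * ε ^ 2)
    (hn : n ≤ δ * Real.exp L / 2.5) (hsmall : 2 * ε ≤ Real.log (2 / δ) - 2.5)
    (hl0 : 0 < l) (hl : l * ε = 0.75 * Real.log (2 / δ)) :
    Real.exp (2 * ε) ^ (-l) * ((1 + 2 * (1 + 1 / l) *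
      (Real.exp ((l * q * ((Real.exp 3 - 1) / 3)) ^ 2 * m / 2) - 1) +
        l * (l + 1) * q ^ 2 * (Real.exp m - 1)) ^ n * (Real.exp (-1) / l)) +
      n * Real.exp (-((3 - m / 2) ^ 2 / (2 * m))) ≤ 2 * δ := by
  have h := truncated_moment_exponent_le hε hsmall hl hL hm.le n.cast_nonneg hmL hw
  have hη := truncation_mass_le hδ hm hmL hn
  have hem : 0 ≤ Real.exp m - 1 := by linarith [Real.add_one_le_exp m]
  set x := (l * q * ((Real.exp 3 - 1) / 3)) ^ 2 * m / 2 with hx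
  have hx0 : 0 ≤ x := by positivity
  have hex : 0 ≤ Real.exp x - 1 := by linarith [Real.add_one_le_exp x]
  set L₂ := Real.log (2 / δ) with hL₂
  have hpow : (1 + 2 * (1 + 1 / l) * (Real.exp x - 1) +
      l * (l + 1) * q ^ 2 * (Real.exp m - 1)) ^ n ≤ Real.exp (0.5 * L₂ + 1 + Real.log l) := by
    have hA : 1 ≤ 2 * (1 + 1 / l) := by
      have : 0 < 1 / l := by positivity
      linarith
    calc _ ≤ Real.exp (2 * (1 + 1 / l) * x + l * (l + 1) * q ^ 2 * (Real.exp m - 1)) ^ n := by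
          gcongr
          exact moment_le_exp hA hx0 (by positivity)
      _ = _ := (Real.exp_nat_mul _ _).symm
      _ ≤ _ := Real.exp_le_exp.2 h
  have hmain : Real.exp (2 * ε) ^ (-l) * ((1 + 2 * (1 + 1 / l) * (Real.exp x - 1) +
      l * (l + 1) * q ^ 2 * (Real.exp m - 1)) ^ n * (Real.exp (-1) / l)) ≤ δ / 2 := by
    rw [← Real.exp_mul]
    calc _ ≤ Real.exp (2 * ε * -l) *
          (Real.exp (0.5 * L₂ + 1 + Real.log l) * (Real.exp (-1) / l)) := by gcongr
      _ = Real.exp (2 * ε * -l + (0.5 * L₂ + 1) + -1) * (Real.exp (Real.log l) / l) := by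
          rw [Real.exp_add _ (Real.log l), Real.exp_add _ (-1), Real.exp_add (2 * ε * -l)]; ring
      _ = Real.exp (-L₂) := by
          rw [Real.exp_log hl0, div_self hl0.ne', mul_one]
          congr 1
          linear_combination -2 * hl
      _ = δ / 2 := by
          rw [Real.exp_neg, hL₂, Real.exp_log (by positivity), inv_div]
  linarith

/-- The privacy estimate in the case where it has content: `δ < 1 / 2`, and there is at least one
iteration, so that `N T / τ ≥ 1` and the logarithm in `σ²` exceeds `log (2 / δ)`. -/
theorem SGFSInput.law_le {𝒳 : Type*} {d N : ℕ} (P : SGFSInput 𝒳 d)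
    (hτ : 2 ≤ P.τ) (hτN : P.τ ≤ N) (hε : 0 < P.ε) (hδ : 0 < P.δ) (hδ2 : P.δ < 1 / 2)
    (hεδ : P.ε < 2 * √(Real.log (2 / P.δ)))
    (hT : P.ε ^ 2 * N / (32 * P.τ * Real.log (2 / P.δ)) ≤ P.T) (hsteps : P.steps N ≠ 0)
    (hF : ∀ θ : EuclideanSpace ℝ (Fin d), ∀ x : 𝒳, ∃ v : EuclideanSpace ℝ (Fin d), ‖v‖ ≤ 1 ∧
      Matrix.toEuclideanCLM (𝕜 := ℝ) P.F v = ∇ (P.loss x) θ)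
    {X Y : Fin N → 𝒳} {i : Fin N} (hXY : ∀ j, j ≠ i → X j = Y j)
    {A : Set (Fin (P.steps N) → SGFSRelease d)} (hA : MeasurableSet A) :
    P.law X A ≤ ENNReal.ofReal (Real.exp (2 * P.ε)) * P.law Y A + ENNReal.ofReal (2 * P.δ) := by
  have hτ0 : (0 : ℝ) < P.τ := by exact_mod_cast (show 0 < P.τ by omega)
  have hN0 : (0 : ℝ) < N := by exact_mod_cast i.pos
  have hn1 : (1 : ℝ) ≤ P.steps N := by exact_mod_cast Nat.one_le_iff_ne_zero.2 hsteps
  have hn0 : (P.steps N : ℝ) ≤ N * P.T / P.τ := by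
    have h : 1 ≤ ⌊N * P.T / P.τ⌋₊ := Nat.one_le_iff_ne_zero.2 hsteps
    exact Nat.floor_le (by linarith [Nat.floor_pos.1 h])
  have hT0 : 0 < P.T := by
    have h : 0 < N * P.T / P.τ := by linarith
    rw [lt_div_iff₀ hτ0, zero_mul] at h
    exact pos_of_mul_pos_right h hN0.le
  set L₂ := Real.log (2 / P.δ) with hL₂
  set L := Real.log (2.5 * N * P.T / (P.τ * P.δ)) with hL
  have harg : 2.5 * N * P.T / (P.τ * P.δ) = 2.5 * (N * P.T / P.τ) / P.δ := by field_simp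
  have hexpL : Real.exp L = 2.5 * (N * P.T / P.τ) / P.δ := by
    rw [hL, harg, Real.exp_log (by positivity)]
  have hL₂1 : 1.386 ≤ L₂ := by
    have h4 : Real.log 4 ≤ L₂ := by
      refine Real.log_le_log (by norm_num) ?_
      rw [le_div_iff₀ hδ]; linarith
    have h2 : Real.log 4 = 2 * Real.log 2 := by
      rw [show (4 : ℝ) = 2 ^ 2 by norm_num, Real.log_pow]; norm_num
    linarith [Real.log_two_gt_d9]
  have hLL : L₂ + 0.22 ≤ L := by
    have h1 : Real.exp 0.22 ≤ 1.25 := by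
      have := exp_natCast_div_le (p := 11) (k := 50) (by norm_num) (c := 1.25) (by norm_num)
        (by norm_num)
      norm_num at this ⊢
      exact this
    rw [← Real.exp_le_exp, Real.exp_add, hexpL, hL₂, Real.exp_log (by positivity)]
    calc 2 / P.δ * Real.exp 0.22 ≤ 2 / P.δ * 1.25 := by gcongr
      _ = 2.5 * 1 / P.δ := by ring
      _ ≤ _ := by gcongr; exact hn1.trans hn0
  have hL₂0 : 0 < L₂ := by linarith
  have hL0 : 0 < L := by linarith
  have hσdef : P.sigmaSq N = 32 * P.T * L * L₂ / (N * P.τ * P.ε ^ 2) := rfl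
  have hσ : 0 < P.sigmaSq N := by rw [hσdef]; positivity
  set q : ℝ := P.τ / N with hq
  have hq0 : 0 ≤ q := by positivity
  have hq1 : q ≤ 1 := (div_le_one hN0).2 (by exact_mod_cast hτN)
  set m : ℝ := 109 / 25 / ((P.τ : ℝ) ^ 2 * P.sigmaSq N) with hm
  have hm0 : 0 < m := by positivity
  have hmL : m * L ≤ 109 / 25 := by
    have h : L ≤ (P.τ : ℝ) ^ 2 * P.sigmaSq N := by
      have h1 : (P.τ : ℝ) ^ 2 * P.sigmaSq N =
          L * (P.T * (32 * P.τ * L₂)) / (N * P.ε ^ 2) := by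
        rw [hσdef]; field_simp
      rw [h1, le_div_iff₀ (by positivity)]
      rw [div_le_iff₀ (by positivity)] at hT
      have := mul_le_mul_of_nonneg_left hT hL0.le
      linarith
    rw [hm, div_mul_eq_mul_div, div_le_iff₀ (by positivity)]
    gcongr
  have hw : (P.steps N : ℝ) * q ^ 2 * m * (32 * L₂ * L) ≤ 109 / 25 * P.ε ^ 2 := by
    have h : (P.steps N : ℝ) * q ^ 2 * m * (32 * L₂ * L) =
        P.steps N / (N * P.T / P.τ) * (109 / 25 * P.ε ^ 2) := by
      rw [hm, hq, hσdef]; field_simp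
    rw [h]
    refine mul_le_of_le_one_left (by positivity) ((div_le_one (by positivity)).2 hn0)
  have hnL : (P.steps N : ℝ) ≤ P.δ * Real.exp L / 2.5 := by
    rw [hexpL, mul_div_cancel₀ _ hδ.ne', mul_div_cancel_left₀ _ (by norm_num)]
    exact hn0
  have hεL : P.ε ^ 2 ≤ 4 * L₂ := by
    have h : P.ε ^ 2 ≤ (2 * √L₂) ^ 2 := by gcongr
    rwa [mul_pow, Real.sq_sqrt hL₂0.le, show (2 : ℝ) ^ 2 = 4 by norm_num] at h
  have hexp : 0 < Real.exp (2 * P.ε) := Real.exp_pos _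
  have hem : 0 ≤ Real.exp m - 1 := by linarith [Real.add_one_le_exp m]
  rcases le_total (L₂ - 2.5) (2 * P.ε) with hbig | hsmall
  · have hc : ∀ γ : ℝ, 0 < γ →
        1 ≤ ENNReal.ofReal γ + ENNReal.ofReal (γ ^ (-1 : ℝ)) * ENNReal.ofReal (1 / 4) := by
      intro γ hγ
      rw [← ENNReal.ofReal_mul (by positivity), ← ENNReal.ofReal_add hγ.le (by positivity),
        ENNReal.one_le_ofReal, Real.rpow_neg_one]
      refine le_of_mul_le_mul_right ?_ hγ
      rw [add_mul, mul_right_comm, inv_mul_cancel₀ hγ.ne']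
      nlinarith [sq_nonneg (γ - 1 / 2)]
    have h := P.runLaw_le_of_isStepBound hτN hc (P.isStepBound_releaseLaw hτ hτN hXY hσ hF
      fun _ _ _ => isStepBound_gaussianMixture_one hq0 hq1) _ 1 (P.θ₁, P.I₀) A hA _ hexp
    refine h.trans ?_
    rw [add_assoc, ← ENNReal.ofReal_zero]
    refine add_le_add le_rfl ?_
    exact ofReal_remainder_le (by positivity) (by positivity) (by norm_num) le_rfl
      (second_moment_remainder_le hε hδ hL₂1 hεL hLL hm0.le hmL hw hbig)
  · set l := 0.75 * L₂ / P.ε with hl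
    have hlε : l * P.ε = 0.75 * L₂ := div_mul_cancel₀ _ hε.ne'
    have hl1 : 1 ≤ l := by rw [hl, le_div_iff₀ hε]; linarith
    have hl0 : 0 < l := by linarith
    have hm3 : m / 2 < 3 := by nlinarith
    have hc : ∀ γ : ℝ, 0 < γ →
        1 ≤ ENNReal.ofReal γ + ENNReal.ofReal (γ ^ (-l)) * ENNReal.ofReal (Real.exp (-1) / l) := by
      intro γ hγ
      rw [← ENNReal.ofReal_mul (by positivity), ← ENNReal.ofReal_add hγ.le (by positivity),
        ENNReal.one_le_ofReal]
      exact one_le_add_rpow_neg_div hl0 hγ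
    have h := P.runLaw_le_of_isStepBound hτN hc (P.isStepBound_releaseLaw hτ hτN hXY hσ hF
      fun _ _ _ => isStepBound_gaussianMixture hq0 hq1 hl1 (by norm_num) hm3)
      _ 1 (P.θ₁, P.I₀) A hA _ hexp
    refine h.trans ?_
    rw [add_assoc]
    refine add_le_add le_rfl ?_
    have hex : 0 ≤ Real.exp ((l * q * ((Real.exp 3 - 1) / 3)) ^ 2 * m / 2) - 1 := by
      have : 0 ≤ (l * q * ((Real.exp 3 - 1) / 3)) ^ 2 * m / 2 := by positivity
      linarith [Real.add_one_le_exp ((l * q * ((Real.exp 3 - 1) / 3)) ^ 2 * m / 2)]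
    exact ofReal_remainder_le (by positivity) (by positivity) (by positivity) (by positivity)
      (truncated_moment_remainder_le hε hδ (by linarith) hm0 hmL hw hnL hsmall hl0 hlε)

end

theorem mainTheorem7 {𝒳 : Type*} {d N : ℕ} (P : SGFSInput 𝒳 d)
    (hτ : 2 ≤ P.τ) (hτN : P.τ ≤ N)
    (hε : 0 < P.ε) (hδ : 0 < P.δ) (hδ1 : P.δ < 1)
    (hεδ : P.ε < 2 * Real.sqrt (Real.log (2 / P.δ)))
    (hη : ∀ t ∈ Finset.Icc 1 (P.steps N), 0 < P.η t)
    (hloss : ∀ x, Differentiable ℝ (P.loss x)) (hreg : Differentiable ℝ P.reg)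
    (hquad : ∀ (x : 𝒳) (θ θ' : EuclideanSpace ℝ (Fin d)),
      P.loss x θ' ≤ P.loss x θ + inner ℝ (∇ (P.loss x) θ) (θ' - θ)
        + 1 / 2 * ‖Matrix.toEuclideanCLM (𝕜 := ℝ) P.F (θ' - θ)‖ ^ 2)
    (hF : ∀ (θ : EuclideanSpace ℝ (Fin d)) (X : Fin N → 𝒳),
      convexHull ℝ (Set.range (fun i => ∇ (P.loss (X i)) θ) ∪
          Set.range (fun i => -∇ (P.loss (X i)) θ)) ⊆
        Matrix.toEuclideanCLM (𝕜 := ℝ) P.F '' Metric.closedBall 0 1)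
    (hT : P.ε ^ 2 * N / (32 * P.τ * Real.log (2 / P.δ)) ≤ P.T) :
    IsDifferentiallyPrivate (fun X : Fin N → 𝒳 => P.law X) (2 * P.ε) (2 * P.δ) := by
  classical
  intro X Y hXY A hA
  have := P.isProbabilityMeasure_law hτN X
  have := P.isProbabilityMeasure_law hτN Y
  have hN : 0 < N := by omega
  have : Nonempty (Fin N) := ⟨⟨0, hN⟩⟩
  rcases le_or_gt (1 / 2) P.δ with hδ2 | hδ2
  · -- a probability never exceeds `2 δ`
    refine (prob_le_one.trans ?_).trans le_add_self
    rw [ENNReal.one_le_ofReal]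
    linarith
  by_cases hsteps : P.steps N = 0
  · -- the output is empty
    have : IsEmpty (Fin (P.steps N)) := by rw [hsteps]; infer_instance
    refine le_trans ?_ le_self_add
    rcases A.eq_empty_or_nonempty with rfl | hne
    · simp
    · rw [Subsingleton.eq_univ_of_nonempty hne, measure_univ, measure_univ, mul_one,
        ENNReal.one_le_ofReal]
      exact Real.one_le_exp (by positivity)
  obtain ⟨i, hi⟩ := exists_eq_of_hammingDist_le_one (X := X) (Y := Y) (by convert hXY)
  refine P.law_le hτ hτN hε hδ hδ2 hεδ hT hsteps (fun θ x => ?_) hi hA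
  obtain ⟨v, hv, hvx⟩ := hF θ (fun _ => x) (subset_convexHull ℝ _ (Or.inl ⟨⟨0, hN⟩, rfl⟩))
  exact ⟨v, by simpa using hv, hvx⟩
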